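/- Let $n,N,k$ be integers with $2\le k\le\min\{n,N\}$, and let $1\le p<k$ and $1\le q<k$ be real. For real $r$ with $1\le r<\infty$, a Borel measurable function $g\colon\mathbb{R}^{N\times n}\to\mathbb{R}$ that is bounded below is called $W^{1,r}$-quasiconvex if for every $\xi\in\mathbb{R}^{N\times n}$ there is a nonempty bounded open set $\Omega\subset\mathbb{R}^n$ with $\mathscr{L}^n(\partial\Omega)=0$ such that $$\int_\Omega g(\xi+\nabla\varphi(x))\,dx\ \ge\ \mathscr{L}^n(\Omega)\,g(\xi)\qquad\text{for all }\varphi\in W^{1,r}_0(\Omega;\mathbb{R}^N),$$ where $\mathscr{L}^n$ is Lebesgue measure, the integral takes values in $(-\infty,+\infty]$, and $W^{1,r}_0(\Omega;\mathbb{R}^N)$ is the closure of $C_c^\infty(\Omega;\mathbb{R}^N)$ in $W^{1,r}(\Omega;\mathbb{R}^N)$. Let $f\colon\mathbb{R}^{N\times n}\to\mathbb{R}$ be continuous, bounded below and $W^{1,p}$-quasiconvex, and suppose that for some constant $L$ $$f(\xi)\le L\,(1+|\xi|^q)\qquad\text{for all }\xi\in\mathbb{R}^{N\times n}\text{ with }\operatorname{rank}(\xi)\le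 k-1,$$ where $|\xi|=\big(\sum_{i,j}\xi_{ij}^2\big)^{1/2}$. Then there is a constant $L'\ge L$ such that $f(\xi)\le L'(1+|\xi|^q)$ for all $\xi\in\mathbb{R}^{N\times n}$, and $f$ is $W^{1,q}$-quasiconvex. -/

import Mathlib

open MeasureTheory Filter Topology
open scoped ENNReal ContDiff

namespace GrowthQC

/-- The Euclidean space `ℝⁿ`. -/
abbrev E (n : ℕ) : Type := EuclideanSpace ℝ (Fin n)

/-- The space `ℝ^{N × n}` of real matrices with `N` rows and `n` columns. -/
abbrev Mat (N n : ℕ) : Type := Matrix (Fin N) (Fin n) ℝ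

/-- The (Euclidean) norm `|ξ| = (∑ᵢ ∑ⱼ ξᵢⱼ²)^{1/2}` of a matrix. -/
noncomputable def matNorm {N n : ℕ} (ξ : Mat N n) : ℝ :=
  Real.sqrt (∑ i, ∑ j, ξ i j ^ 2)

/-- The classical partial derivative `∂ⱼ u` of a scalar function on `ℝⁿ`. -/
noncomputable def partialDeriv {n : ℕ} (j : Fin n) (u : E n → ℝ) (x : E n) : ℝ :=
  fderiv ℝ u x (EuclideanSpace.single j 1)

/-- `ψ ∈ C_c^∞(Ω; F)`: `ψ` is smooth, with compact support contained in `Ω`. -/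
structure IsTestFunction {n : ℕ} {F : Type*} [NormedAddCommGroup F] [NormedSpace ℝ F]
    (Ω : Set (E n)) (ψ : E n → F) : Prop where
  contDiff : ContDiff ℝ ∞ ψ
  hasCompactSupport : HasCompactSupport ψ
  tsupport_subset : tsupport ψ ⊆ Ω

/-- `φ` belongs to the Sobolev space `W^{1,p}(Ω; ℝᴺ)` and `Φ` is (a representative of) its weak
gradient: all components of `φ` and `Φ` lie in `L^p(Ω)`, and
`∫_Ω φᵢ ∂ⱼψ = - ∫_Ω Φᵢⱼ ψ` for all `ψ ∈ C_c^∞(Ω)`. -/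
structure MemSobolev {n N : ℕ} (Ω : Set (E n)) (p : ℝ) (φ : E n → E N) (Φ : E n → Mat N n) :
    Prop where
  memLp : ∀ i, MemLp (fun x => φ x i) (ENNReal.ofReal p) (volume.restrict Ω)
  memLp_grad : ∀ i j, MemLp (fun x => Φ x i j) (ENNReal.ofReal p) (volume.restrict Ω)
  weak_grad : ∀ i j, ∀ ψ : E n → ℝ, IsTestFunction Ω ψ →
    ∫ x in Ω, φ x i * partialDeriv j ψ x = - ∫ x in Ω, Φ x i j * ψ x

/-- `φ ∈ W_0^{1,p}(Ω; ℝᴺ)` with weak gradient `Φ`, for `1 ≤ p < ∞`: `φ` lies in the closure of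
`C_c^∞(Ω; ℝᴺ)` in `W^{1,p}(Ω; ℝᴺ)`. -/
structure MemSobolevZero {n N : ℕ} (Ω : Set (E n)) (p : ℝ) (φ : E n → E N)
    (Φ : E n → Mat N n) : Prop extends MemSobolev Ω p φ Φ where
  approx : ∃ u : ℕ → E n → E N, (∀ m, IsTestFunction Ω (u m)) ∧
    (∀ i, Tendsto (fun m => eLpNorm (fun x => u m x i - φ x i) (ENNReal.ofReal p)
      (volume.restrict Ω)) atTop (𝓝 0)) ∧
    (∀ i j, Tendsto (fun m => eLpNorm (fun x => partialDeriv j (fun y => u m y i) x - Φ x i j)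
      (ENNReal.ofReal p) (volume.restrict Ω)) atTop (𝓝 0))

/-- The Lebesgue integral `∫_Ω g dx` as an extended real number: the integral of the positive part
minus that of the negative part. If `g` is bounded below and `Ω` is bounded, the second one is
finite, so that this is the usual integral with values in `(-∞, +∞]`. -/
noncomputable def extIntegral {n : ℕ} (Ω : Set (E n)) (g : E n → ℝ) : EReal :=
  ((∫⁻ x in Ω, ENNReal.ofReal (g x) : ℝ≥0∞) : EReal) -
    ((∫⁻ x in Ω, ENNReal.ofReal (-g x) : ℝ≥0∞) : EReal)

/-- `f` is `W^{1,p}`-quasiconvex at `ξ`: for some nonempty bounded open set `Ω` with Lebesgue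
null boundary, `∫_Ω f(ξ + ∇φ(x)) dx ≥ |Ω| f(ξ)` for all `φ ∈ W_0^{1,p}(Ω; ℝᴺ)`. -/
def IsW1QuasiconvexAt {N n : ℕ} (p : ℝ) (f : Mat N n → ℝ) (ξ : Mat N n) : Prop :=
  ∃ Ω : Set (E n), Ω.Nonempty ∧ Bornology.IsBounded Ω ∧ IsOpen Ω ∧ volume (frontier Ω) = 0 ∧
    ∀ (φ : E n → E N) (Φ : E n → Mat N n), MemSobolevZero Ω p φ Φ →
      ((volume.real Ω * f ξ : ℝ) : EReal) ≤ extIntegral Ω (fun x => f (ξ + Φ x))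

/-- `W^{1,p}`-quasiconvexity, `1 ≤ p < ∞`, of a Borel measurable integrand that is bounded
below. -/
structure IsW1Quasiconvex {N n : ℕ} (p : ℝ) (f : Mat N n → ℝ) : Prop where
  measurable : Measurable[borel (Mat N n)] f
  bddBelow : BddBelow (Set.range f)
  quasiconvexAt : ∀ ξ, IsW1QuasiconvexAt p f ξ

end GrowthQC

/-! Write a matrix `ξ` of rank `m ≥ k` as `A ∘ fst ∘ T`, where `T` identifies `ℝⁿ` with `ℝᵐ × Z`, `Z
= ℝ^{n-m}`. Suppose that some `φ₀` in `W^{1,r}`, `r = max p q < m`, vanishes outside the unit ball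
of `ℝᵐ × Z` and makes the gradient of `fst + φ₀` fail to be onto `ℝᵐ` almost everywhere inside. A
small copy of `A ∘ φ₀ ∘ T` is admissible in the quasiconvexity inequality because `p ≤ r`. On the
copy only matrices of rank below `m` occur, where growth is already known, and the resulting
integral is finite because `q ≤ r`. This bounds `f ξ` (`le_of_skeletonMap`), uniformly in `ξ`
because `exists_adapted_coordinates` controls `‖A‖ ‖T‖` by the norm of `ξ`. Induction on the rank
gives growth everywhere (`exists_growth`).

The heart is the construction of `φ₀` in `exists_skeletonMap`. If `Z = 0`, the radial projection of
the sup-norm cube onto its boundary works: some coordinate is `±1`, and the gradient is `O(1 /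
‖y‖)`, which is in `L^r` since `r < m`. A map near every point of which some coordinate lies in a
finite set cannot have a surjective derivative (`not_surjective_of_eventually_mem`).

If `Z ≠ 0`, put `t = ‖z‖` and work in the cell `‖y‖ < 1`, `0 < t < 1`. The map must return to `y` at
`t = 1`, so one projection is not enough. For `t < 1/2` the point `v = y / max(‖y‖, 2t)` of the cube
is projected radially, inside the one of the `2^m` subcubes that contains it, to the boundary of
that subcube; this puts a coordinate into `{-1, 0, 1}`. At `t = 1/2` the result matches rescaled
radial projections of the `2^m` upper subcells of half the size, and there the construction is
repeated. Rescaling preserves gradients, while `2^m` copies of volume `2^{-(m+1)}` occupy half the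
measure, so the corrections sum geometrically in `L^r`. The correction `project` belonging to a sign
vector `σ` is singular only along the line `y = tσ`, which has codimension `m > r`. Composition with
`(y, z) ↦ (y, ‖z‖)` gives `φ₀`.

Once `f` has growth `q`, the quasiconvexity inequality passes to `L^q` limits of gradients. It holds
for test functions, which are admissible for every exponent, hence on all of `W^{1,q}_0`
(`isW1QuasiconvexAt_of_growth`). -/

set_option linter.unusedSectionVars false

namespace GrowthQC

/-! ### Pairs (map, gradient) that are `L^r` limits of smooth compactly supported functions -/

section Lp

variable {α F : Type*} [MeasurableSpace α] {μ : Measure α} [NormedAddCommGroup F]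

/-- Dominated convergence in `L^r`, for sequences converging to zero. -/
theorem tendsto_eLpNorm_zero_of_dominated {r : ℝ≥0∞} (hr0 : r ≠ 0) (hr : r ≠ ⊤) {u : ℕ → α → F}
    {g : α → ℝ} (hu : ∀ k, AEStronglyMeasurable (u k) μ) (hg : MemLp g r μ)
    (hbound : ∀ k, ∀ᵐ x ∂μ, ‖u k x‖ ≤ g x)
    (hlim : ∀ᵐ x ∂μ, Tendsto (fun k => u k x) atTop (𝓝 0)) :
    Tendsto (fun k => eLpNorm (u k) r μ) atTop (𝓝 0) := by
  have hrpos : 0 < r.toReal := ENNReal.toReal_pos hr0 hr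
  have h1 : Tendsto (fun k => ∫⁻ x, ‖u k x‖ₑ ^ r.toReal ∂μ) atTop (𝓝 (∫⁻ _, 0 ∂μ)) := by
    refine tendsto_lintegral_of_dominated_convergence' (fun x => ‖g x‖ₑ ^ r.toReal)
      (fun k => ((hu k).enorm).pow_const _) ?_ ?_ ?_
    · intro k
      filter_upwards [hbound k] with x hx
      have : ‖u k x‖ₑ ≤ ‖g x‖ₑ :=
        enorm_le_iff_norm_le.2 (hx.trans (le_abs_self _))
      exact ENNReal.rpow_le_rpow this hrpos.le
    · exact (lintegral_rpow_enorm_lt_top_of_eLpNorm_lt_top hr0 hr hg.2).ne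
    · filter_upwards [hlim] with x hx
      have h2 : Tendsto (fun k => ‖u k x‖ₑ) atTop (𝓝 0) := by
        simpa [Function.comp_def] using (continuous_enorm.tendsto (0 : F)).comp hx
      have := ((ENNReal.continuous_rpow_const (y := r.toReal)).tendsto 0).comp h2
      simpa [Function.comp_def, ENNReal.zero_rpow_of_pos hrpos] using this
  simp only [lintegral_zero] at h1
  have h3 := ((ENNReal.continuous_rpow_const (y := 1 / r.toReal)).tendsto 0).comp h1
  rw [ENNReal.zero_rpow_of_pos (by positivity)] at h3
  refine h3.congr fun k => ?_
  rw [eLpNorm_eq_lintegral_rpow_enorm_toReal hr0 hr]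
  rfl

end Lp

variable {X : Type*} [NormedAddCommGroup X] [NormedSpace ℝ X] [FiniteDimensional ℝ X]
  [MeasurableSpace X] [BorelSpace X]
  {F : Type*} [NormedAddCommGroup F] [NormedSpace ℝ F] [FiniteDimensional ℝ F]


/-- `φ` is the limit of a sequence of functions in `C_c^∞(Ω; F)` and `Φ` is the limit of their
derivatives, both with respect to the `L^r` norm on the whole space. -/
structure W1Zero (μ : Measure X) (Ω : Set X) (r : ℝ≥0∞) (φ : X → F) (Φ : X → X →L[ℝ] F) :
    Prop where
  aesm : AEStronglyMeasurable φ μ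
  aesm_grad : AEStronglyMeasurable Φ μ
  approx : ∀ ε : ℝ≥0∞, ε ≠ 0 → ∃ u : X → F, ContDiff ℝ ∞ u ∧ HasCompactSupport u ∧
    tsupport u ⊆ Ω ∧ eLpNorm (fun x => u x - φ x) r μ ≤ ε ∧
    eLpNorm (fun x => fderiv ℝ u x - Φ x) r μ ≤ ε

theorem aestronglyMeasurable_fderiv (μ : Measure X) (u : X → F) :
    AEStronglyMeasurable (fderiv ℝ u) μ :=
  (measurable_fderiv ℝ u).aestronglyMeasurable

namespace W1Zero

variable {μ : Measure X} {Ω : Set X} {r : ℝ≥0∞} {φ φ' : X → F} {Φ Φ' : X → X →L[ℝ] F}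

theorem zero : W1Zero μ Ω r (0 : X → F) 0 where
  aesm := aestronglyMeasurable_zero
  aesm_grad := aestronglyMeasurable_zero
  approx ε _ := by
    refine ⟨0, contDiff_zero_fun, HasCompactSupport.zero, ?_, ?_, ?_⟩
    · simp [tsupport]
    · simp
    · simp only [fderiv_zero, Pi.zero_apply, sub_zero]
      exact (eLpNorm_zero' (ε := X →L[ℝ] F)).trans_le zero_le

theorem congr (h : W1Zero μ Ω r φ Φ) (h1 : φ =ᵐ[μ] φ') (h2 : Φ =ᵐ[μ] Φ') :
    W1Zero μ Ω r φ' Φ' where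
  aesm := h.aesm.congr h1
  aesm_grad := h.aesm_grad.congr h2
  approx ε hε := by
    obtain ⟨u, hu1, hu2, hu3, hu4, hu5⟩ := h.approx ε hε
    refine ⟨u, hu1, hu2, hu3, ?_, ?_⟩
    · refine (eLpNorm_congr_ae ?_).trans_le hu4
      filter_upwards [h1] with x hx
      rw [hx]
    · refine (eLpNorm_congr_ae ?_).trans_le hu5
      filter_upwards [h2] with x hx
      rw [hx]

theorem of_approx (hr : 1 ≤ r) (h1 : AEStronglyMeasurable φ μ) (h2 : AEStronglyMeasurable Φ μ)
    (h : ∀ ε : ℝ≥0∞, ε ≠ 0 → ∃ (φ' : X → F) (Φ' : X → X →L[ℝ] F), W1Zero μ Ω r φ' Φ' ∧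
      eLpNorm (fun x => φ' x - φ x) r μ ≤ ε ∧ eLpNorm (fun x => Φ' x - Φ x) r μ ≤ ε) :
    W1Zero μ Ω r φ Φ where
  aesm := h1
  aesm_grad := h2
  approx ε hε := by
    obtain ⟨φ', Φ', hW, h3, h4⟩ := h (ε / 2) (by simpa using hε)
    obtain ⟨u, hu1, hu2, hu3, hu4, hu5⟩ := hW.approx (ε / 2) (by simpa using hε)
    refine ⟨u, hu1, hu2, hu3, ?_, ?_⟩
    · have : (fun x => u x - φ x) = (fun x => u x - φ' x) + fun x => φ' x - φ x := by
        ext x; simp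
      rw [this, ← ENNReal.add_halves ε]
      exact (eLpNorm_add_le (hu1.continuous.aestronglyMeasurable.sub hW.aesm) (hW.aesm.sub h1)
        hr).trans (add_le_add hu4 h3)
    · have : (fun x => fderiv ℝ u x - Φ x) = (fun x => fderiv ℝ u x - Φ' x) +
          fun x => Φ' x - Φ x := by
        ext1 x; simp
      rw [this, ← ENNReal.add_halves ε]
      exact (eLpNorm_add_le ((aestronglyMeasurable_fderiv μ u).sub hW.aesm_grad)
        (hW.aesm_grad.sub h2) hr).trans (add_le_add hu5 h4)

theorem add (hr : 1 ≤ r) (h : W1Zero μ Ω r φ Φ) (h' : W1Zero μ Ω r φ' Φ') :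
    W1Zero μ Ω r (φ + φ') (Φ + Φ') where
  aesm := h.aesm.add h'.aesm
  aesm_grad := h.aesm_grad.add h'.aesm_grad
  approx ε hε := by
    obtain ⟨u, hu1, hu2, hu3, hu4, hu5⟩ := h.approx (ε / 2) (by simpa using hε)
    obtain ⟨v, hv1, hv2, hv3, hv4, hv5⟩ := h'.approx (ε / 2) (by simpa using hε)
    refine ⟨u + v, hu1.add hv1, hu2.add hv2, ?_, ?_, ?_⟩
    · exact (tsupport_add u v).trans (Set.union_subset hu3 hv3)
    · have : (fun x => (u + v) x - (φ + φ') x) = (fun x => u x - φ x) + fun x => v x - φ' x := by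
        ext x; simp only [Pi.add_apply]; abel
      rw [this, ← ENNReal.add_halves ε]
      exact (eLpNorm_add_le (hu1.continuous.aestronglyMeasurable.sub h.aesm)
        (hv1.continuous.aestronglyMeasurable.sub h'.aesm) hr).trans (add_le_add hu4 hv4)
    · have : (fun x => fderiv ℝ (u + v) x - (Φ + Φ') x) = (fun x => fderiv ℝ u x - Φ x) +
          fun x => fderiv ℝ v x - Φ' x := by
        ext1 x
        rw [fderiv_add (hu1.differentiable (by simp) x) (hv1.differentiable (by simp) x)]
        simp only [Pi.add_apply]; abel
      rw [this, ← ENNReal.add_halves ε]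
      exact (eLpNorm_add_le ((aestronglyMeasurable_fderiv μ u).sub h.aesm_grad)
        ((aestronglyMeasurable_fderiv μ v).sub h'.aesm_grad) hr).trans (add_le_add hu5 hv5)

theorem sum (hr : 1 ≤ r) {ι : Type*} (s : Finset ι) {φ : ι → X → F} {Φ : ι → X → X →L[ℝ] F}
    (h : ∀ i ∈ s, W1Zero μ Ω r (φ i) (Φ i)) : W1Zero μ Ω r (∑ i ∈ s, φ i) (∑ i ∈ s, Φ i) := by
  classical
  induction s using Finset.induction_on with
  | empty => simpa using zero
  | insert a s ha ih =>
    rw [Finset.sum_insert ha, Finset.sum_insert ha]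
    exact (h a (by simp)).add hr (ih fun i hi => h i (by simp [hi]))

theorem memLp [IsFiniteMeasureOnCompacts μ] (h : W1Zero μ Ω r φ Φ) :
    MemLp φ r μ ∧ MemLp Φ r μ := by
  obtain ⟨u, hu1, hu2, hu3, hu4, hu5⟩ := h.approx 1 (by simp)
  have h1 : MemLp u r μ := hu1.continuous.memLp_of_hasCompactSupport hu2
  have h2 : MemLp (fderiv ℝ u) r μ :=
    (hu1.continuous_fderiv (by simp)).memLp_of_hasCompactSupport (hu2.fderiv ℝ)
  have h3 : MemLp (fun x => u x - φ x) r μ :=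
    ⟨h1.1.sub h.aesm, hu4.trans_lt ENNReal.one_lt_top⟩
  have h4 : MemLp (fun x => fderiv ℝ u x - Φ x) r μ :=
    ⟨h2.1.sub h.aesm_grad, hu5.trans_lt ENNReal.one_lt_top⟩
  refine ⟨(h1.sub h3).congr_norm h.aesm ?_, (h2.sub h4).congr_norm h.aesm_grad ?_⟩ <;>
  · refine Eventually.of_forall fun x => ?_
    simp

end W1Zero
end GrowthQC

/-! ### Mollification, cut-off and absolutely convergent series -/

namespace GrowthQC

open scoped Convolution

variable {X : Type*} [NormedAddCommGroup X] [NormedSpace ℝ X] [FiniteDimensional ℝ X]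
  [MeasurableSpace X] [BorelSpace X]
  {F : Type*} [NormedAddCommGroup F] [NormedSpace ℝ F] [FiniteDimensional ℝ F]

-- Differentiation under the integral sign, with the Lipschitz constant as dominating factor.
-- Rademacher's theorem supplies the derivative of `u` at almost every shifted point.
open ContinuousLinearMap in
theorem hasFDerivAt_normed_convolution {μ : Measure X} [μ.IsAddHaarMeasure]
    (ψ : ContDiffBump (0 : X)) {u : X → F} {K : NNReal} (hu : LipschitzWith K u) (x : X) :
    HasFDerivAt (ψ.normed μ ⋆[lsmul ℝ ℝ, μ] u)
      ((ψ.normed μ ⋆[lsmul ℝ ℝ, μ] (fderiv ℝ u)) x) x := by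
  have hψc := ψ.continuous_normed (μ := μ)
  have hψs := ψ.hasCompactSupport_normed (μ := μ)
  refine (hasFDerivAt_integral_of_dominated_loc_of_lip (𝕜 := ℝ) (μ := μ)
    (F := fun y t => (lsmul ℝ ℝ) (ψ.normed μ t) (u (y - t)))
    (F' := fun t => (lsmul ℝ ℝ) (ψ.normed μ t) (fderiv ℝ u (x - t)))
    (bound := fun t => ψ.normed μ t * K) (s := Set.univ) univ_mem ?_ ?_ ?_ ?_ ?_ ?_).2
  · refine Eventually.of_forall fun y => ?_
    simp only [lsmul_apply]
    exact (hψc.smul (hu.continuous.comp (by fun_prop))).aestronglyMeasurable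
  · simp only [lsmul_apply]
    exact (hψc.smul (hu.continuous.comp (by fun_prop))).integrable_of_hasCompactSupport
      hψs.smul_right
  · simp only [lsmul_apply]
    exact hψc.aestronglyMeasurable.smul
      (((measurable_fderiv ℝ u).comp (measurable_const.sub measurable_id)).aestronglyMeasurable)
  · refine Eventually.of_forall fun t => LipschitzOnWith.of_dist_le_mul fun y _ z _ => ?_
    simp only [lsmul_apply, dist_eq_norm, ← smul_sub, norm_smul]
    rw [Real.norm_of_nonneg (ψ.nonneg_normed t)]
    have h1 : ‖u (y - t) - u (z - t)‖ ≤ K * ‖y - z‖ := by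
      simpa [dist_eq_norm] using hu.dist_le_mul (y - t) (z - t)
    have h2 := mul_le_mul_of_nonneg_left h1 (ψ.nonneg_normed (μ := μ) t)
    have h3 : ((Real.nnabs (ψ.normed μ t * K) : NNReal) : ℝ) = ψ.normed μ t * K := by
      rw [Real.coe_nnabs, abs_of_nonneg (mul_nonneg (ψ.nonneg_normed (μ := μ) t) K.coe_nonneg)]
    rw [h3, mul_assoc]
    exact h2
  · exact (hψc.integrable_of_hasCompactSupport hψs).mul_const _
  · have h1 := (quasiMeasurePreserving_sub_left μ x).ae hu.ae_differentiableAt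
    filter_upwards [h1] with t ht
    simp only [lsmul_apply]
    have h2 : HasFDerivAt (fun y => u (y - t)) (fderiv ℝ u (x - t)) x := by
      have := ht.hasFDerivAt.comp x ((hasFDerivAt_id x).sub_const t)
      simpa [Function.comp_def] using this
    exact h2.const_smul _

open ContinuousLinearMap in
/-- A Lipschitz function with compact support is approximated by its mollifications. -/
theorem W1Zero.of_lipschitzWith {μ : Measure X} [μ.IsAddHaarMeasure] {r : ℝ≥0∞} (hr0 : r ≠ 0)
    (hr : r ≠ ⊤) {u : X → F} {K : NNReal} (hu : LipschitzWith K u) (hc : HasCompactSupport u) :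
    W1Zero μ Set.univ r u (fderiv ℝ u) where
  aesm := hu.continuous.aestronglyMeasurable
  aesm_grad := aestronglyMeasurable_fderiv μ u
  approx ε hε := by
    obtain ⟨R, hR⟩ := hc.isCompact.isBounded.subset_closedBall 0
    -- The outer radius is exactly twice the inner one. A bounded ratio is what the almost
    -- everywhere convergence of the mollified gradient requires; for `u` itself continuity is
    -- enough.
    let ψ : ℕ → ContDiffBump (0 : X) := fun k =>
      ⟨1 / (2 * ((k : ℝ) + 1)), 1 / ((k : ℝ) + 1), by positivity, by
        apply one_div_lt_one_div_of_lt <;> nlinarith [(Nat.cast_nonneg k : (0 : ℝ) ≤ k)]⟩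
    have hψ1 : ∀ k, (ψ k).rOut ≤ 1 := fun k => by
      change 1 / ((k : ℝ) + 1) ≤ 1
      rw [div_le_one (by positivity)]
      linarith [(Nat.cast_nonneg k : (0 : ℝ) ≤ k)]
    have hψ0 : Tendsto (fun k => (ψ k).rOut) atTop (𝓝 0) :=
      tendsto_one_div_add_atTop_nhds_zero_nat
    have hψ2 : ∀ᶠ k in atTop, (ψ k).rOut ≤ 2 * (ψ k).rIn := by
      refine Eventually.of_forall fun k => ?_
      change 1 / ((k : ℝ) + 1) ≤ 2 * (1 / (2 * ((k : ℝ) + 1)))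
      apply le_of_eq
      field_simp
    let v : ℕ → X → F := fun k => (ψ k).normed μ ⋆[lsmul ℝ ℝ, μ] u
    let v' : ℕ → X → X →L[ℝ] F := fun k => (ψ k).normed μ ⋆[lsmul ℝ ℝ, μ] (fderiv ℝ u)
    have hv' : ∀ k x, fderiv ℝ (v k) x = v' k x := fun k x =>
      (hasFDerivAt_normed_convolution (ψ k) hu x).fderiv
    have hu0 : ∀ x, R < ‖x‖ → u x = 0 := fun x hx => by
      by_contra h
      have := hR (subset_tsupport u h)
      simp at this
      linarith
    have hu'0 : ∀ x, R < ‖x‖ → fderiv ℝ u x = 0 := fun x hx => by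
      by_contra h
      have := hR (support_fderiv_subset ℝ h)
      simp at this
      linarith
    have hfar : ∀ (k : ℕ) (x : X), R + 1 < ‖x‖ → ∀ y ∈ Metric.ball x (ψ k).rOut, R < ‖y‖ := by
      intro k x hx y hy
      have h1 : dist y x < 1 := lt_of_lt_of_le hy (hψ1 k)
      have h2 : ‖x‖ ≤ ‖y‖ + dist y x := by
        rw [dist_comm, dist_eq_norm]
        have := norm_add_le y (x - y)
        simpa using this
      linarith
    have hbd : ∀ x, ‖fderiv ℝ u x‖ ≤ K := fun x => norm_fderiv_le_of_lipschitz ℝ hu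
    have hvlim : ∀ x, Tendsto (fun k => v k x) atTop (𝓝 (u x)) := fun x =>
      ContDiffBump.convolution_tendsto_right_of_continuous hψ0 hu.continuous x
    have hloc : LocallyIntegrable (fderiv ℝ u) μ := by
      refine (MeasureTheory.locallyIntegrable_const (K : ℝ)).mono
        (aestronglyMeasurable_fderiv μ u) (Eventually.of_forall fun x => ?_)
      simpa using hbd x
    have hv'lim : ∀ᵐ x ∂μ, Tendsto (fun k => v' k x) atTop (𝓝 (fderiv ℝ u x)) :=
      ContDiffBump.ae_convolution_tendsto_right_of_locallyIntegrable hψ0 hψ2 hloc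
    have hvd : ∀ k x, ‖v k x - u x‖ ≤ K := by
      intro k x
      rw [← dist_eq_norm]
      refine (ψ k).dist_normed_convolution_le hu.continuous.aestronglyMeasurable fun y hy => ?_
      refine (hu.dist_le_mul y x).trans ?_
      have h1 : dist y x ≤ 1 := (le_of_lt hy).trans (hψ1 k)
      nlinarith [K.2]
    have hvd' : ∀ k x, ‖v' k x - fderiv ℝ u x‖ ≤ 2 * K := by
      intro k x
      rw [← dist_eq_norm]
      refine (ψ k).dist_normed_convolution_le (aestronglyMeasurable_fderiv μ u) fun y _ => ?_
      rw [dist_eq_norm]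
      refine (norm_sub_le _ _).trans ?_
      linarith [hbd x, hbd y]
    have hv0 : ∀ k x, R + 1 < ‖x‖ → v k x = u x := fun k x hx =>
      (ψ k).normed_convolution_eq_right fun y hy => by
        rw [hu0 y (hfar k x hx y hy), hu0 x (by linarith)]
    have hv'0 : ∀ k x, R + 1 < ‖x‖ → v' k x = fderiv ℝ u x := fun k x hx =>
      (ψ k).normed_convolution_eq_right fun y hy => by
        rw [hu'0 y (hfar k x hx y hy), hu'0 x (by linarith)]
    have hvsmooth : ∀ k, ContDiff ℝ ∞ (v k) := fun k =>
      ((ψ k).hasCompactSupport_normed).contDiff_convolution_left _ ((ψ k).contDiff_normed)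
        hu.continuous.locallyIntegrable
    have hvc : ∀ k, HasCompactSupport (v k) := fun k =>
      ((ψ k).hasCompactSupport_normed).convolution _ hc
    have hmem : ∀ c : ℝ, MemLp ((Metric.closedBall (0 : X) (R + 1)).indicator fun _ => c) r μ :=
      fun c => memLp_indicator_const r measurableSet_closedBall c
        (Or.inr (isCompact_closedBall _ _).measure_lt_top.ne)
    have hind : ∀ (c : ℝ) (a : X → ℝ), (∀ x, a x ≤ c) → (∀ x, R + 1 < ‖x‖ → a x = 0) →
        ∀ x, a x ≤ (Metric.closedBall (0 : X) (R + 1)).indicator (fun _ => c) x := by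
      intro c a h1 h2 x
      by_cases hx : x ∈ Metric.closedBall (0 : X) (R + 1)
      · rw [Set.indicator_of_mem hx]; exact h1 x
      · rw [Set.indicator_of_notMem hx, h2 x (by simpa using hx)]
    have t1 := tendsto_eLpNorm_zero_of_dominated (μ := μ) hr0 hr
      (u := fun k x => v k x - u x) (g := _)
      (fun k => ((hvsmooth k).continuous.sub hu.continuous).aestronglyMeasurable) (hmem K)
      (fun k => Eventually.of_forall (hind K (fun x => ‖v k x - u x‖) (hvd k)
        fun x hx => by simp [hv0 k x hx]))
      (Eventually.of_forall fun x => by simpa using (hvlim x).sub_const (u x))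
    have t2 := tendsto_eLpNorm_zero_of_dominated (μ := μ) hr0 hr
      (u := fun k x => fderiv ℝ (v k) x - fderiv ℝ u x) (g := _)
      (fun k => (aestronglyMeasurable_fderiv μ (v k)).sub (aestronglyMeasurable_fderiv μ u))
      (hmem (2 * K))
      (fun k => Eventually.of_forall (hind (2 * K) (fun x => ‖fderiv ℝ (v k) x - fderiv ℝ u x‖)
        (fun x => by rw [hv']; exact hvd' k x)
        fun x hx => by simp [hv', hv'0 k x hx]))
      (by
        filter_upwards [hv'lim] with x hx
        simp only [hv']
        simpa using hx.sub_const (fderiv ℝ u x))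
    have hpos : 0 < ε := pos_iff_ne_zero.2 hε
    obtain ⟨k, hk1, hk2⟩ := ((t1.eventually_le_const hpos).and (t2.eventually_le_const hpos)).exists
    exact ⟨v k, hvsmooth k, hvc k, Set.subset_univ _, hk1, hk2⟩

/-- The partial sums of an absolutely convergent series in `L^r` converge in `L^r` to their
pointwise limit. -/
theorem tendsto_eLpNorm_sum_sub {α G : Type*} [MeasurableSpace α] {μ : Measure α}
    [NormedAddCommGroup G] {r : ℝ≥0∞} (hr : 1 ≤ r) {a : ℕ → α → G} {φ : α → G}
    (hm : ∀ j, AEStronglyMeasurable (a j) μ) (ha : ∑' j, eLpNorm (a j) r μ ≠ ⊤)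
    (hφ : ∀ᵐ x ∂μ, Tendsto (fun J => ∑ j ∈ Finset.range J, a j x) atTop (𝓝 (φ x))) :
    Tendsto (fun J => eLpNorm (fun x => ∑ j ∈ Finset.range J, a j x - φ x) r μ) atTop (𝓝 0) := by
  have t := ENNReal.tendsto_sum_nat_add (fun j => eLpNorm (a j) r μ) ha
  refine tendsto_of_tendsto_of_tendsto_of_le_of_le tendsto_const_nhds t (fun _ => zero_le)
    fun J => ?_
  -- The error after `J` terms is the pointwise limit of minus the partial sums of the tail, so
  -- Fatou's lemma for the `L^r` norm bounds it by the tail of the series of norms.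
  have hlim : ∀ᵐ x ∂μ, Tendsto (fun K => (-∑ j ∈ Finset.range K, a (j + J)) x) atTop
      (𝓝 (∑ j ∈ Finset.range J, a j x - φ x)) := by
    filter_upwards [hφ] with x hx
    have h1 := (hx.comp (tendsto_add_atTop_nat J)).const_sub (∑ j ∈ Finset.range J, a j x)
    refine h1.congr fun K => ?_
    simp only [Function.comp_apply]
    rw [add_comm K J, Finset.sum_range_add]
    simp [add_comm]
  have hms : ∀ K, AEStronglyMeasurable (-∑ j ∈ Finset.range K, a (j + J)) μ :=
    fun K => (Finset.aestronglyMeasurable_sum _ fun j _ => hm (j + J)).neg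
  refine (Lp.eLpNorm_lim_le_liminf_eLpNorm hms _ hlim).trans ?_
  refine liminf_le_of_le (by isBoundedDefault) fun b hb => ?_
  obtain ⟨K, hK⟩ := hb.exists
  rw [eLpNorm_neg] at hK
  exact hK.trans ((eLpNorm_sum_le (fun j _ => hm (j + J)) hr).trans
    (ENNReal.sum_le_tsum (f := fun j => eLpNorm (a (j + J)) r μ) _))

namespace W1Zero
variable {μ : Measure X} {Ω : Set X} {r : ℝ≥0∞} {φ φ' : X → F} {Φ Φ' : X → X →L[ℝ] F}

/-- Cutting off: if `φ` and `Φ` vanish outside a compact subset of the open set `Ω`, the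
approximating functions can be supported in `Ω`. -/
theorem of_univ (hr : 1 ≤ r) {K : Set X} (hK : IsCompact K) (hΩ : IsOpen Ω) (hKΩ : K ⊆ Ω)
    (h : W1Zero μ Set.univ r φ Φ) (hφ : ∀ x ∉ K, φ x = 0) (hΦ : ∀ x ∉ K, Φ x = 0) :
    W1Zero μ Ω r φ Φ where
  aesm := h.aesm
  aesm_grad := h.aesm_grad
  approx ε hε := by
    obtain ⟨χ, hχ1, hχc, hχs, hχ01, hχK⟩ : ∃ χ : X → ℝ, ContDiff ℝ ∞ χ ∧ HasCompactSupport χ ∧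
      tsupport χ ⊆ Ω ∧ (∀ x, χ x ∈ Set.Icc (0 : ℝ) 1) ∧ ∀ᶠ x in 𝓝ˢ K, χ x = 1 := by
      obtain ⟨K', hK', hKK', hK'Ω⟩ := exists_compact_between hK hΩ hKΩ
      obtain ⟨f, hf1, hf2, hf3⟩ := exists_contMDiffMap_one_nhds_of_subset_interior
        (n := ⊤) (modelWithCornersSelf ℝ X) hK.isClosed hKK'
      have hts : tsupport f ⊆ K' := closure_minimal
        (fun x hx => by_contra fun h' => hx (hf2 x h')) hK'.isClosed
      exact ⟨f, f.contMDiff.contDiff, hK'.of_isClosed_subset (isClosed_tsupport _) hts,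
        hts.trans hK'Ω, hf3, hf1⟩
    obtain ⟨M, hM⟩ : ∃ M : ℝ, ∀ x, ‖fderiv ℝ χ x‖ ≤ M :=
      (hχ1.continuous_fderiv (by simp)).bounded_above_of_compact_support (hχc.fderiv ℝ)
    have hM0 : 0 ≤ M := (norm_nonneg _).trans (hM 0)
    -- The product rule costs an extra `M` times the `L^r` error of the function itself.
    obtain ⟨C, hC0, hCε⟩ : ∃ δ : ℝ≥0∞, δ ≠ 0 ∧ δ + ENNReal.ofReal M * δ ≤ ε ∧ δ ≤ ε := by
      have h1 : ε / (1 + ENNReal.ofReal M) +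
          ENNReal.ofReal M * (ε / (1 + ENNReal.ofReal M)) ≤ ε := by
        rw [← one_add_mul]
        exact ENNReal.mul_div_le
      exact ⟨ε / (1 + ENNReal.ofReal M), ENNReal.div_ne_zero.2 ⟨hε, by finiteness⟩, h1,
        le_self_add.trans h1⟩
    obtain ⟨u, hu1, hu2, hu3, hu4, hu5⟩ := h.approx C hC0
    -- `χ φ = φ`, since `χ = 1` on `K` and `φ = 0` off `K`. In `e2` the cut-off must be `1` near
    -- `K`, so that its derivative vanishes there.
    have e1 : ∀ x, χ x • u x - φ x = χ x • (u x - φ x) := by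
      intro x
      by_cases hx : x ∈ K
      · rw [hχK.self_of_nhdsSet x hx]; simp
      · simp [hφ x hx]
    have e2 : ∀ x, fderiv ℝ (fun x => χ x • u x) x - Φ x =
        χ x • (fderiv ℝ u x - Φ x) + (fderiv ℝ χ x).smulRight (u x - φ x) := by
      intro x
      have hd := ((hχ1.differentiable (by simp) x).hasFDerivAt.smul
        (hu1.differentiable (by simp) x).hasFDerivAt).fderiv
      rw [show (fun x => χ x • u x) = χ • u from rfl, hd]
      by_cases hx : x ∈ K
      · have h1 : χ =ᶠ[𝓝 x] fun _ => 1 := (eventually_nhdsSet_iff_forall.1 hχK) x hx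
        have h2 : fderiv ℝ χ x = 0 := by rw [h1.fderiv_eq]; simp
        rw [h2, h1.self_of_nhds]
        simp
      · simp [hφ x hx, hΦ x hx]
    refine ⟨fun x => χ x • u x, hχ1.smul hu1, hχc.smul_right, ?_, ?_, ?_⟩
    · exact (tsupport_smul_subset_left χ u).trans hχs
    · refine le_trans (eLpNorm_mono fun x => ?_) (hu4.trans hCε.2)
      rw [e1, norm_smul, Real.norm_of_nonneg (hχ01 x).1]
      exact mul_le_of_le_one_left (norm_nonneg _) (hχ01 x).2
    · have e3 : (fun x => fderiv ℝ (fun x => χ x • u x) x - Φ x) =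
        (fun x => χ x • (fderiv ℝ u x - Φ x)) +
          fun x => (fderiv ℝ χ x).smulRight (u x - φ x) := funext e2
      rw [e3]
      have m1 : AEStronglyMeasurable (fun x => fderiv ℝ u x - Φ x) μ :=
        (aestronglyMeasurable_fderiv μ u).sub h.aesm_grad
      have m2 : AEStronglyMeasurable (fun x => u x - φ x) μ :=
        hu1.continuous.aestronglyMeasurable.sub h.aesm
      have m3 : AEStronglyMeasurable (fun x => (fderiv ℝ χ x).smulRight (u x - φ x)) μ := by
        have : Continuous fun p : (X →L[ℝ] ℝ) × F => p.1.smulRight p.2 := by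
          have h2 : Continuous fun p : (X →L[ℝ] ℝ) × F =>
            ContinuousLinearMap.smulRightL ℝ X F p.1 p.2 := by fun_prop
          exact h2
        exact this.comp_aestronglyMeasurable
          ((aestronglyMeasurable_fderiv μ χ).prodMk m2)
      refine (eLpNorm_add_le (hχ1.continuous.aestronglyMeasurable.smul m1) m3 hr).trans
        (le_trans (add_le_add ?_ ?_) hCε.1)
      · refine le_trans (eLpNorm_mono fun x => ?_) hu5
        rw [Pi.smul_apply', norm_smul, Real.norm_of_nonneg (hχ01 x).1]
        exact mul_le_of_le_one_left (norm_nonneg _) (hχ01 x).2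
      · refine le_trans (eLpNorm_le_mul_eLpNorm_of_ae_le_mul (c := M)
          (Eventually.of_forall fun x => ?_) r) (mul_le_mul_right hu4 _)
        rw [ContinuousLinearMap.norm_smulRight_apply]
        exact mul_le_mul_of_nonneg_right (hM x) (norm_nonneg _)

/-- A series which converges absolutely in `L^r` together with the series of the derivatives. -/
theorem of_series (hr : 1 ≤ r) {a : ℕ → X → F} {A : ℕ → X → X →L[ℝ] F}
    (h : ∀ j, W1Zero μ Ω r (a j) (A j))
    (ha : ∑' j, eLpNorm (a j) r μ ≠ ⊤) (hA : ∑' j, eLpNorm (A j) r μ ≠ ⊤)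
    (hφ : ∀ᵐ x ∂μ, Tendsto (fun J => ∑ j ∈ Finset.range J, a j x) atTop (𝓝 (φ x)))
    (hΦ : ∀ᵐ x ∂μ, Tendsto (fun J => ∑ j ∈ Finset.range J, A j x) atTop (𝓝 (Φ x))) :
    W1Zero μ Ω r φ Φ := by
  have m1 : AEStronglyMeasurable φ μ := aestronglyMeasurable_of_tendsto_ae atTop
    (fun J => Finset.aestronglyMeasurable_fun_sum _ fun j _ => (h j).aesm) hφ
  have m2 : AEStronglyMeasurable Φ μ := aestronglyMeasurable_of_tendsto_ae atTop
    (fun J => Finset.aestronglyMeasurable_fun_sum _ fun j _ => (h j).aesm_grad) hΦ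
  refine of_approx hr m1 m2 fun ε hε => ?_
  have hpos : 0 < ε := pos_iff_ne_zero.2 hε
  obtain ⟨J, h1, h2⟩ :=
    (((tendsto_eLpNorm_sum_sub hr (fun j => (h j).aesm) ha hφ).eventually_le_const hpos).and
    ((tendsto_eLpNorm_sum_sub hr (fun j => (h j).aesm_grad) hA hΦ).eventually_le_const hpos)).exists
  refine ⟨_, _, sum hr (Finset.range J) fun j _ => h j, ?_, ?_⟩
  · simpa [Finset.sum_apply] using h1
  · simpa [Finset.sum_apply] using h2

end W1Zero
end GrowthQC

/-! ### Maps with a weighted singularity, and affine changes of variables -/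

namespace GrowthQC

variable {X : Type*} [NormedAddCommGroup X] [NormedSpace ℝ X] [FiniteDimensional ℝ X]
  [MeasurableSpace X] [BorelSpace X]
  {F : Type*} [NormedAddCommGroup F] [NormedSpace ℝ F] [FiniteDimensional ℝ F]

theorem exists_ne_zero_mul_le {D ε : ℝ≥0∞} (hD : D ≠ ⊤) (hε : ε ≠ 0) :
    ∃ δ : ℝ≥0∞, δ ≠ 0 ∧ D * δ ≤ ε :=
  ⟨ε / (1 + D), ENNReal.div_ne_zero.2 ⟨hε, by finiteness⟩,
    (mul_le_mul_left le_add_self _).trans ENNReal.mul_div_le⟩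

theorem eLpNorm_comp_le {α β G : Type*} [MeasurableSpace α] [MeasurableSpace β]
    [NormedAddCommGroup G] {μ : Measure β} {μ' : Measure α} {a : α → β} (ha : Measurable a)
    {C : ℝ≥0∞} (h : μ'.map a ≤ C • μ) {f : β → G} (hf : AEStronglyMeasurable f μ) (r : ℝ≥0∞) :
    eLpNorm (fun x => f (a x)) r μ' ≤ C ^ (1 / r).toReal * eLpNorm f r μ := by
  have hac : μ'.map a ≪ μ := (Measure.absolutelyContinuous_of_le h).trans
    Measure.smul_absolutelyContinuous
  rw [show (fun x => f (a x)) = f ∘ a from rfl,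
    ← eLpNorm_map_measure (hf.mono_ac hac) ha.aemeasurable]
  exact (eLpNorm_mono_measure f h).trans (eLpNorm_smul_measure_le C f r μ)

theorem exists_map_affine_eq {X' : Type*} [NormedAddCommGroup X'] [NormedSpace ℝ X']
    [FiniteDimensional ℝ X'] [MeasurableSpace X'] [BorelSpace X'] (μ : Measure X)
    [μ.IsAddHaarMeasure] (μ' : Measure X') [μ'.IsAddHaarMeasure] (L : X' ≃L[ℝ] X) (c : X) :
    ∃ C : ℝ≥0∞, C ≠ 0 ∧ C ≠ ⊤ ∧ μ'.map (fun x => L x + c) = C • μ := by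
  have : (μ'.map L).IsAddHaarMeasure := L.isAddHaarMeasure_map μ'
  refine ⟨(Measure.addHaarScalarFactor (μ'.map L) μ : NNReal), ?_, ENNReal.coe_ne_top, ?_⟩
  · rw [ENNReal.coe_ne_zero]
    exact (Measure.addHaarScalarFactor_pos_of_isAddHaarMeasure _ _).ne'
  · have h1 : (fun x => L x + c) = (fun y => y + c) ∘ L := rfl
    rw [h1, ← Measure.map_map (measurable_add_const c) L.continuous.measurable,
      map_add_right_eq_self]
    exact Measure.isAddLeftInvariant_eq_smul _ _

namespace W1Zero
variable {μ : Measure X} {Ω : Set X} {r : ℝ≥0∞} {φ φ' : X → F} {Φ Φ' : X → X →L[ℝ] F}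

/-- A bounded function with compact support which is Lipschitz with constant of order `1 / η`,
where the weight `η` is Lipschitz and `1 / η` belongs to `L^r` on the support. -/
theorem of_weight [μ.IsAddHaarMeasure] (hr1 : 1 ≤ r) (hr : r ≠ ⊤) {w : X → F} {η : X → ℝ}
    {C M R : ℝ} {κ : NNReal} (hη : LipschitzWith κ η)
    (hM : ∀ x, ‖w x‖ ≤ M) (hw : ∀ x x', ‖w x - w x'‖ * min (η x) (η x') ≤ C * ‖x - x'‖)
    (hsupp : ∀ x, R < ‖x‖ → w x = 0) (hpos : ∀ᵐ x ∂μ, 0 < η x)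
    (hint : MemLp ((Metric.closedBall (0 : X) R).indicator fun x => (η x)⁻¹) r μ) :
    W1Zero μ Set.univ r w (fderiv ℝ w) ∧ ∀ᵐ x ∂μ, DifferentiableAt ℝ w x := by
  have hr0 : r ≠ 0 := (zero_lt_one.trans_le hr1).ne'
  have hM0 : 0 ≤ M := (norm_nonneg _).trans (hM 0)
  wlog hC : 0 ≤ C generalizing C
  · refine this (C := max C 0) (fun x x' => (hw x x').trans ?_) (le_max_right _ _)
    exact mul_le_mul_of_nonneg_right (le_max_left _ _) (norm_nonneg _)
  let ε : ℕ → ℝ := fun k => 1 / ((k : ℝ) + 1)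
  have hε : ∀ k, 0 < ε k := fun k => by positivity
  have hε0 : Tendsto ε atTop (𝓝 0) := tendsto_one_div_add_atTop_nhds_zero_nat
  -- The cut-off removes the set `η ≤ ε k`, near which `w` need not be Lipschitz, and equals `1` as
  -- soon as `η ≥ 2 ε k`.
  let χ : ℕ → X → ℝ := fun k x => min 1 (max 0 (η x / ε k - 1))
  have hχ0 : ∀ k x, 0 ≤ χ k x := fun k x => le_min zero_le_one (le_max_left _ _)
  have hχ1 : ∀ k x, χ k x ≤ 1 := fun k x => min_le_left _ _
  have hχz : ∀ k x, η x ≤ ε k → χ k x = 0 := fun k x h => by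
    have : η x / ε k - 1 ≤ 0 := by rw [sub_nonpos, div_le_one (hε k)]; exact h
    simp [χ, max_eq_left this]
  have hχo : ∀ k x, 2 * ε k ≤ η x → χ k x = 1 := fun k x h => by
    have : 1 ≤ η x / ε k - 1 := by rw [le_sub_iff_add_le, le_div_iff₀ (hε k)]; linarith
    simp only [χ]
    rw [max_eq_right (by linarith), min_eq_left this]
  have hχL : ∀ k x x', |χ k x - χ k x'| ≤ κ / ε k * ‖x - x'‖ := fun k x x' => by
    have h1 : |η x - η x'| ≤ κ * ‖x - x'‖ := by
      simpa [dist_eq_norm] using hη.dist_le_mul x x'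
    have h2 : |χ k x - χ k x'| ≤ |η x / ε k - 1 - (η x' / ε k - 1)| := by
      refine (abs_min_sub_min_le_max _ _ _ _).trans (max_le (by simp) ?_)
      exact (abs_max_sub_max_le_max _ _ _ _).trans (max_le (by simp) le_rfl)
    refine h2.trans ?_
    rw [sub_sub_sub_cancel_right, ← sub_div, abs_div, abs_of_pos (hε k), div_mul_eq_mul_div]
    exact div_le_div_of_nonneg_right h1 (hε k).le
  let v : ℕ → X → F := fun k x => χ k x • w x
  have hv : ∀ k x x', ‖v k x - v k x'‖ ≤ |χ k x - χ k x'| * M + χ k x * ‖w x - w x'‖ := by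
    intro k x x'
    have : v k x - v k x' = (χ k x - χ k x') • w x' + χ k x • (w x - w x') := by
      simp only [v]; module
    rw [this]
    refine (norm_add_le _ _).trans (add_le_add ?_ ?_)
    · rw [norm_smul, Real.norm_eq_abs]
      exact mul_le_mul_of_nonneg_left (hM _) (abs_nonneg _)
    · rw [norm_smul, Real.norm_of_nonneg (hχ0 k x)]
  -- In the splitting `hv` the increment of `w` carries the cut-off at `x`. That point must have the
  -- smaller weight: either `η x ≤ ε k` and the term vanishes, or the minimum of the weights exceeds
  -- `ε k`.
  have hvL' : ∀ k x x', η x ≤ η x' → ‖v k x - v k x'‖ ≤ (κ * M + C) / ε k * ‖x - x'‖ := by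
    intro k x x' hxx
    refine (hv k x x').trans ?_
    have h1 := mul_le_mul_of_nonneg_right (hχL k x x') hM0
    have h2 : χ k x * ‖w x - w x'‖ ≤ C / ε k * ‖x - x'‖ := by
      rcases le_or_gt (η x) (ε k) with h | h
      · rw [hχz k x h, zero_mul]; have := hε k; positivity
      · have h3 := hw x x'
        rw [min_eq_left hxx] at h3
        rw [div_mul_eq_mul_div, le_div_iff₀ (hε k)]
        have h4 : χ k x * ‖w x - w x'‖ ≤ ‖w x - w x'‖ :=
          mul_le_of_le_one_left (norm_nonneg _) (hχ1 k x)
        nlinarith [norm_nonneg (w x - w x'), hε k]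
    calc _ ≤ κ / ε k * ‖x - x'‖ * M + C / ε k * ‖x - x'‖ := add_le_add h1 h2
      _ = _ := by ring
  have hvL : ∀ k, ∃ K, LipschitzWith K (v k) := fun k => by
    refine ⟨Real.toNNReal ((κ * M + C) / ε k), LipschitzWith.of_dist_le_mul fun x x' => ?_⟩
    rw [Real.coe_toNNReal _ (by have := hε k; positivity), dist_eq_norm, dist_eq_norm]
    rcases le_total (η x) (η x') with h | h
    · exact hvL' k x x' h
    · rw [norm_sub_rev, norm_sub_rev x]; exact hvL' k x' x h
  have hv0 : ∀ k x, R < ‖x‖ → v k x = 0 := fun k x hx => by simp [v, hsupp x hx]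
  have hcs : ∀ u : X → F, (∀ x, R < ‖x‖ → u x = 0) → HasCompactSupport u := fun u hu =>
    HasCompactSupport.intro (isCompact_closedBall (0 : X) R) fun x hx =>
      hu x (by simpa using hx)
  have hfd0 : ∀ u : X → F, (∀ x, R < ‖x‖ → u x = 0) → ∀ x, R < ‖x‖ → fderiv ℝ u x = 0 := by
    intro u hu x hx
    have h1 : u =ᶠ[𝓝 x] fun _ => 0 := by
      filter_upwards [(isOpen_lt continuous_const continuous_norm).mem_nhds hx] with y hy
      exact hu y hy
    rw [h1.fderiv_eq]; simp
  have hW : ∀ k, W1Zero μ Set.univ r (v k) (fderiv ℝ (v k)) := fun k => by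
    obtain ⟨K, hK⟩ := hvL k
    exact W1Zero.of_lipschitzWith hr0 hr hK (hcs _ (hv0 k))
  have hev : ∀ x, 0 < η x → ∀ᶠ k in atTop, v k =ᶠ[𝓝 x] w := by
    intro x hx
    filter_upwards [hε0.eventually_le_const (show 0 < η x / 4 by positivity)] with k hk
    filter_upwards [hη.continuous.continuousAt.eventually_const_lt
      (show η x / 2 < η x by linarith)] with y hy
    simp [v, hχo k y (by linarith)]
  -- The bound is independent of `k`, as dominated convergence needs: either `ε k ≤ η x / 4` and the
  -- cut-off is `1` near `x`, or its Lipschitz constant `κ / ε k` is at most `4 κ / η x`.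
  have hgrad : ∀ k x, 0 < η x → ‖fderiv ℝ (v k) x‖ ≤ (4 * κ * M + 2 * C) * (η x)⁻¹ := by
    intro k x hx
    refine norm_fderiv_le_of_lip' ℝ (by positivity) ?_
    filter_upwards [hη.continuous.continuousAt.eventually_const_lt
      (show η x / 2 < η x by linarith)] with y hy1
    refine (hv k y x).trans ?_
    have h1 : |χ k y - χ k x| ≤ 4 * κ * (η x)⁻¹ * ‖y - x‖ := by
      rcases le_or_gt (ε k) (η x / 4) with h | h
      · rw [hχo k y (by linarith), hχo k x (by linarith)]
        simp only [sub_self, abs_zero]; positivity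
      · refine (hχL k y x).trans (mul_le_mul_of_nonneg_right ?_ (norm_nonneg _))
        have h5 : (ε k)⁻¹ ≤ 4 * (η x)⁻¹ := by
          rw [inv_le_comm₀ (hε k) (by positivity), mul_inv, inv_inv]
          linarith
        calc (κ : ℝ) / ε k = κ * (ε k)⁻¹ := div_eq_mul_inv _ _
          _ ≤ κ * (4 * (η x)⁻¹) := mul_le_mul_of_nonneg_left h5 κ.coe_nonneg
          _ = _ := by ring
    have h2 : χ k y * ‖w y - w x‖ ≤ 2 * C * (η x)⁻¹ * ‖y - x‖ := by
      have h3 := hw y x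
      have h4 : η x / 2 ≤ min (η y) (η x) := le_min hy1.le (by linarith)
      have h5 : χ k y * ‖w y - w x‖ ≤ ‖w y - w x‖ :=
        mul_le_of_le_one_left (norm_nonneg _) (hχ1 k y)
      have h6 : ‖w y - w x‖ * (η x / 2) ≤ C * ‖y - x‖ :=
        (mul_le_mul_of_nonneg_left h4 (norm_nonneg _)).trans h3
      refine h5.trans ?_
      rw [show 2 * C * (η x)⁻¹ * ‖y - x‖ = C * ‖y - x‖ / (η x / 2) by field_simp]
      rwa [le_div_iff₀ (by positivity)]
    calc _ ≤ 4 * κ * (η x)⁻¹ * ‖y - x‖ * M + 2 * C * (η x)⁻¹ * ‖y - x‖ :=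
          add_le_add (mul_le_mul_of_nonneg_right h1 hM0) h2
      _ = _ := by ring
  have hgrad' : ∀ x, 0 < η x → ‖fderiv ℝ w x‖ ≤ (4 * κ * M + 2 * C) * (η x)⁻¹ := by
    intro x hx
    obtain ⟨k, hk⟩ := (hev x hx).exists
    rw [← hk.fderiv_eq]
    exact hgrad k x hx
  have hlim : ∀ᵐ x ∂μ, Tendsto (fun k => v k x) atTop (𝓝 (w x)) := by
    filter_upwards [hpos] with x hx
    exact tendsto_const_nhds.congr' ((hev x hx).mono fun k hk => hk.self_of_nhds.symm)
  have hlim' : ∀ᵐ x ∂μ, Tendsto (fun k => fderiv ℝ (v k) x) atTop (𝓝 (fderiv ℝ w x)) := by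
    filter_upwards [hpos] with x hx
    exact tendsto_const_nhds.congr' ((hev x hx).mono fun k hk => hk.fderiv_eq.symm)
  have hwm : AEStronglyMeasurable w μ :=
    aestronglyMeasurable_of_tendsto_ae atTop (fun k => (hW k).aesm) hlim
  have hmem : MemLp ((Metric.closedBall (0 : X) R).indicator fun _ => 2 * M) r μ :=
    memLp_indicator_const r measurableSet_closedBall _
      (Or.inr (isCompact_closedBall _ _).measure_lt_top.ne)
  have hdiff : ∀ᵐ x ∂μ, DifferentiableAt ℝ w x := by
    have h1 : ∀ᵐ x ∂μ, ∀ k, DifferentiableAt ℝ (v k) x := ae_all_iff.2 fun k => by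
      obtain ⟨K, hK⟩ := hvL k
      exact hK.ae_differentiableAt
    filter_upwards [h1, hpos] with x hx hx'
    obtain ⟨k, hk⟩ := (hev x hx').exists
    exact hk.differentiableAt_iff.1 (hx k)
  refine ⟨?_, hdiff⟩
  have t1 := tendsto_eLpNorm_zero_of_dominated (μ := μ) hr0 hr (u := fun k x => v k x - w x)
    (fun k => (hW k).aesm.sub hwm) hmem
    (fun k => Eventually.of_forall fun x => by
      by_cases hx : x ∈ Metric.closedBall (0 : X) R
      · rw [Set.indicator_of_mem hx]
        refine (norm_sub_le _ _).trans ?_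
        have h1 : ‖v k x‖ ≤ M := by
          simp only [v]
          rw [norm_smul, Real.norm_of_nonneg (hχ0 k x)]
          exact (mul_le_of_le_one_left (norm_nonneg _) (hχ1 k x)).trans (hM x)
        linarith [hM x]
      · rw [Set.indicator_of_notMem hx]
        have hx' : R < ‖x‖ := by simpa using hx
        simp [hv0 k x hx', hsupp x hx'])
    (by filter_upwards [hlim] with x hx
        simpa using hx.sub_const (w x))
  have t2 := tendsto_eLpNorm_zero_of_dominated (μ := μ) hr0 hr
    (u := fun k x => fderiv ℝ (v k) x - fderiv ℝ w x)
    (fun k => (aestronglyMeasurable_fderiv μ _).sub (aestronglyMeasurable_fderiv μ w))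
    (hint.const_mul (2 * (4 * κ * M + 2 * C)))
    (fun k => by
      filter_upwards [hpos] with x hη
      by_cases hx : x ∈ Metric.closedBall (0 : X) R
      · rw [Set.indicator_of_mem hx]
        refine (norm_sub_le _ _).trans ?_
        linarith [hgrad k x hη, hgrad' x hη]
      · rw [Set.indicator_of_notMem hx]
        have hx' : R < ‖x‖ := by simpa using hx
        simp [hfd0 _ (hv0 k) x hx', hfd0 _ hsupp x hx'])
    (by filter_upwards [hlim'] with x hx
        simpa using hx.sub_const (fderiv ℝ w x))
  refine of_approx hr1 hwm (aestronglyMeasurable_fderiv μ w)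
    fun ε hε => ?_
  have hpos : 0 < ε := pos_iff_ne_zero.2 hε
  obtain ⟨k, h1, h2⟩ := ((t1.eventually_le_const hpos).and (t2.eventually_le_const hpos)).exists
  exact ⟨v k, _, hW k, h1, h2⟩

theorem comp_affine {X' F' : Type*} [NormedAddCommGroup X'] [NormedSpace ℝ X']
    [FiniteDimensional ℝ X'] [MeasurableSpace X'] [BorelSpace X'] [NormedAddCommGroup F']
    [NormedSpace ℝ F'] [μ.IsAddHaarMeasure] (μ' : Measure X')
    [μ'.IsAddHaarMeasure] (L : X' ≃L[ℝ] X) (c : X) (B : F →L[ℝ] F')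
    (h : W1Zero μ Set.univ r φ Φ) :
    W1Zero μ' Set.univ r (fun x => B (φ (L x + c)))
      (fun x => (B ∘L Φ (L x + c)) ∘L (L : X' →L[ℝ] X)) := by
  obtain ⟨C, hC0, hC, hmap⟩ := exists_map_affine_eq μ μ' L c
  have ha : Continuous fun x => L x + c := by fun_prop
  have hq : Measure.QuasiMeasurePreserving (fun x => L x + c) μ' μ :=
    ⟨ha.measurable, hmap ▸ Measure.smul_absolutelyContinuous⟩
  let T : (X →L[ℝ] F) →L[ℝ] X' →L[ℝ] F' :=
    (ContinuousLinearMap.compL ℝ X' X F').flip (L : X' →L[ℝ] X) ∘L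
      ContinuousLinearMap.compL ℝ X F F' B
  have hT : ∀ A, T A = (B ∘L A) ∘L (L : X' →L[ℝ] X) := fun A => rfl
  refine ⟨B.continuous.comp_aestronglyMeasurable (h.aesm.comp_quasiMeasurePreserving hq),
    T.continuous.comp_aestronglyMeasurable (h.aesm_grad.comp_quasiMeasurePreserving hq),
    fun ε hε => ?_⟩
  have hD : C ^ (1 / r).toReal ≠ ⊤ := ENNReal.rpow_ne_top_of_nonneg ENNReal.toReal_nonneg hC
  obtain ⟨δ, hδ, hδ'⟩ := exists_ne_zero_mul_le
    (D := (ENNReal.ofReal ‖B‖ + ENNReal.ofReal ‖T‖) * C ^ (1 / r).toReal) (by finiteness) hε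
  obtain ⟨u, hu1, hu2, -, hu4, hu5⟩ := h.approx δ hδ
  refine ⟨fun x => B (u (L x + c)), ?_, ?_, Set.subset_univ _, ?_, ?_⟩
  · exact B.contDiff.comp (hu1.comp (L.contDiff.add contDiff_const))
  · have h1 : HasCompactSupport (fun x => u (L x + c)) :=
      hu2.comp_homeomorph (L.toHomeomorph.trans (Homeomorph.addRight c))
    exact h1.comp_left B.map_zero
  · calc eLpNorm (fun x => B (u (L x + c)) - B (φ (L x + c))) r μ'
        ≤ ENNReal.ofReal ‖B‖ * eLpNorm (fun x => (fun y => u y - φ y) (L x + c)) r μ' := by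
          refine eLpNorm_le_mul_eLpNorm_of_ae_le_mul (Eventually.of_forall fun x => ?_) r
          rw [← map_sub]
          exact B.le_opNorm _
      _ ≤ ENNReal.ofReal ‖B‖ * (C ^ (1 / r).toReal * δ) := by
          gcongr
          exact (eLpNorm_comp_le ha.measurable hmap.le
            (hu1.continuous.aestronglyMeasurable.sub h.aesm) r).trans (mul_le_mul_right hu4 _)
      _ ≤ _ := by
          refine le_trans ?_ hδ'
          rw [← mul_assoc]
          gcongr
          exact le_self_add
  · calc eLpNorm (fun x => fderiv ℝ (fun x => B (u (L x + c))) x - T (Φ (L x + c))) r μ'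
        ≤ ENNReal.ofReal ‖T‖ * eLpNorm (fun x => (fun y => fderiv ℝ u y - Φ y) (L x + c)) r μ' := by
          refine eLpNorm_le_mul_eLpNorm_of_ae_le_mul (Eventually.of_forall fun x => ?_) r
          have h1 : HasFDerivAt (fun x => B (u (L x + c))) (T (fderiv ℝ u (L x + c))) x :=
            (B.hasFDerivAt.comp x (((hu1.differentiable (by simp) _).hasFDerivAt).comp x
              (L.hasFDerivAt.add_const c)))
          rw [h1.fderiv, ← map_sub]
          exact T.le_opNorm _
      _ ≤ ENNReal.ofReal ‖T‖ * (C ^ (1 / r).toReal * δ) := by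
          gcongr
          exact (eLpNorm_comp_le ha.measurable hmap.le
            ((aestronglyMeasurable_fderiv μ u).sub h.aesm_grad) r).trans (mul_le_mul_right hu5 _)
      _ ≤ _ := by
          refine le_trans ?_ hδ'
          rw [← mul_assoc]
          gcongr
          exact le_add_self

end W1Zero
end GrowthQC

/-! ### Replacing the second variable by its norm -/

namespace GrowthQC

section Norm

variable {Z : Type*} [NormedAddCommGroup Z] [InnerProductSpace ℝ Z] [FiniteDimensional ℝ Z]
  [MeasurableSpace Z] [BorelSpace Z]

/-- In polar coordinates the law of `‖z‖` has density proportional to `t ^ (d - 1)`, which is at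
most `R ^ (d - 1)` on the ball. This is why composition with the norm is bounded in `L^r`. -/
theorem exists_map_norm_restrict_ball_le [Nontrivial Z] (ν : Measure Z) [ν.IsAddHaarMeasure]
    {R : ℝ} (hR : 0 ≤ R) :
    ∃ C : ℝ≥0∞, C ≠ ⊤ ∧ (ν.restrict (Metric.ball 0 R)).map (‖·‖) ≤ C • volume := by
  let d := Module.finrank ℝ Z
  refine ⟨ENNReal.ofReal (d * (ν.real (Metric.ball 0 1) * R ^ (d - 1))), by finiteness, ?_⟩
  refine Measure.le_intro fun s hs _ => ?_
  rw [Measure.map_apply measurable_norm hs, Measure.restrict_apply (measurable_norm hs),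
    Measure.smul_apply, smul_eq_mul]
  set t : Set ℝ := s ∩ Set.Ico 0 R with ht
  have htm : MeasurableSet t := hs.inter measurableSet_Ico
  have hset : (‖·‖) ⁻¹' s ∩ Metric.ball (0 : Z) R = (‖·‖) ⁻¹' t := by
    ext z; simp [ht]
  have hfin : ν ((‖·‖) ⁻¹' t) ≠ ⊤ := by
    rw [← hset]
    exact measure_inter_ne_top_of_right_ne_top measure_ball_lt_top.ne
  have htfin : volume t ≠ ⊤ := measure_inter_ne_top_of_right_ne_top (by simp)
  have key := integral_fun_norm_addHaar ν (t.indicator fun _ => (1 : ℝ))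
  have hl : ∫ x : Z, t.indicator (fun _ => (1 : ℝ)) ‖x‖ ∂ν = ν.real ((‖·‖) ⁻¹' t) := by
    rw [← integral_indicator_one (measurable_norm htm)]
    rfl
  have hrr : ∫ y in Set.Ioi (0 : ℝ), y ^ (d - 1) • t.indicator (fun _ => (1 : ℝ)) y ≤
      R ^ (d - 1) * volume.real t := by
    have h1 : ∫ y in Set.Ioi (0 : ℝ), R ^ (d - 1) * t.indicator (fun _ => (1 : ℝ)) y ≤
        R ^ (d - 1) * volume.real t := by
      rw [integral_const_mul]
      gcongr
      rw [setIntegral_indicator htm, setIntegral_const, smul_eq_mul, mul_one]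
      exact measureReal_mono Set.inter_subset_right htfin
    refine le_trans (integral_mono_of_nonneg ?_ ?_ ?_) h1
    · refine (ae_restrict_mem measurableSet_Ioi).mono fun y hy => ?_
      have hy' : (0 : ℝ) < y := hy
      exact mul_nonneg (by positivity) (Set.indicator_nonneg (fun _ _ => zero_le_one) _)
    · refine Integrable.const_mul ?_ _
      exact ((integrable_indicator_iff htm).2 (integrableOn_const htfin)).integrableOn
    · refine (ae_restrict_mem measurableSet_Ioi).mono fun y hy => ?_
      have hy' : (0 : ℝ) < y := hy
      by_cases hyt : y ∈ t
      · simp only [Set.indicator_of_mem hyt, smul_eq_mul]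
        have := hyt.2.2
        gcongr
      · simp [Set.indicator_of_notMem hyt]
  have hle : ν.real ((‖·‖) ⁻¹' t) ≤
      d * (ν.real (Metric.ball 0 1) * R ^ (d - 1)) * volume.real t := by
    rw [← hl, key]
    simp only [nsmul_eq_mul, smul_eq_mul]
    rw [mul_assoc, mul_assoc]
    gcongr
    exact hrr
  rw [hset, ← ENNReal.ofReal_toReal hfin]
  refine (ENNReal.ofReal_le_ofReal hle).trans ?_
  rw [ENNReal.ofReal_mul (by positivity), measureReal_def (s := t), ENNReal.ofReal_toReal htfin]
  gcongr
  exact Set.inter_subset_left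

variable {Y : Type*} [NormedAddCommGroup Y] [NormedSpace ℝ Y] [FiniteDimensional ℝ Y]
  [MeasurableSpace Y] [BorelSpace Y]

theorem exists_map_prod_norm_le [Nontrivial Z] (ν : Measure Y) [ν.IsAddHaarMeasure] (ζ : Measure Z)
    [ζ.IsAddHaarMeasure] :
    ∃ C : ℝ≥0∞, C ≠ ⊤ ∧ ((ν.prod ζ).restrict (Set.univ ×ˢ Metric.ball 0 2)).map
      (fun x : Y × Z => (x.1, ‖x.2‖)) ≤ C • (ν.prod volume) := by
  obtain ⟨C, hC, hmap⟩ := exists_map_norm_restrict_ball_le ζ (R := 2) (by norm_num)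
  refine ⟨C, hC, ?_⟩
  rw [← Measure.prod_restrict, Measure.restrict_univ,
    show (fun x : Y × Z => (x.1, ‖x.2‖)) = Prod.map id (‖·‖) from rfl,
    ← Measure.map_prod_map _ _ measurable_id measurable_norm,
    Measure.map_id, ← Measure.prod_smul_right]
  exact Measure.prod_mono le_rfl hmap

theorem comp_prod_norm_bound {G : Type*} [NormedAddCommGroup G] {ν : Measure Y}
    [ν.IsAddHaarMeasure] {ζ : Measure Z} [ζ.IsAddHaarMeasure] {C : ℝ≥0∞}
    (hmap : ((ν.prod ζ).restrict (Set.univ ×ˢ Metric.ball 0 2)).map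
      (fun x : Y × Z => (x.1, ‖x.2‖)) ≤ C • (ν.prod volume)) {f : Y × ℝ → G}
    (hf : AEStronglyMeasurable f (ν.prod volume)) (hf0 : ∀ x, 2 ≤ ‖x‖ → f x = 0) (r : ℝ≥0∞) :
    AEStronglyMeasurable (fun x : Y × Z => f (x.1, ‖x.2‖)) (ν.prod ζ) ∧
      eLpNorm (fun x : Y × Z => f (x.1, ‖x.2‖)) r (ν.prod ζ) ≤
        C ^ (1 / r).toReal * eLpNorm f r (ν.prod volume) := by
  have hQ : Measurable (fun x : Y × Z => (x.1, ‖x.2‖)) := by fun_prop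
  have hS : MeasurableSet (Set.univ ×ˢ Metric.ball 0 2 : Set (Y × Z)) :=
    MeasurableSet.univ.prod measurableSet_ball
  have hqm : Measure.QuasiMeasurePreserving (fun x : Y × Z => (x.1, ‖x.2‖))
      ((ν.prod ζ).restrict (Set.univ ×ˢ Metric.ball 0 2)) (ν.prod volume) :=
    ⟨hQ, (Measure.absolutelyContinuous_of_le hmap).trans Measure.smul_absolutelyContinuous⟩
  have h1 : (Set.univ ×ˢ Metric.ball 0 2 : Set (Y × Z)).indicator (fun x => f (x.1, ‖x.2‖)) =
      fun x => f (x.1, ‖x.2‖) :=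
    Set.indicator_eq_self.2 fun x hx => by
      by_contra h2
      have h3 : 2 ≤ ‖x.2‖ := by simpa using h2
      refine hx (hf0 _ (h3.trans ?_))
      simp [Prod.norm_def]
  rw [← h1]
  constructor
  · rw [aestronglyMeasurable_indicator_iff hS]
    exact hf.comp_quasiMeasurePreserving hqm
  · rw [eLpNorm_indicator_eq_eLpNorm_restrict hS]
    exact eLpNorm_comp_le hQ hmap hf r

end Norm

namespace W1Zero

variable {Y : Type*} [NormedAddCommGroup Y] [NormedSpace ℝ Y] [FiniteDimensional ℝ Y]
  [MeasurableSpace Y] [BorelSpace Y]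
  {Z : Type*} [NormedAddCommGroup Z] [InnerProductSpace ℝ Z] [FiniteDimensional ℝ Z]
  [MeasurableSpace Z] [BorelSpace Z]
  {F : Type*} [NormedAddCommGroup F] [NormedSpace ℝ F] [FiniteDimensional ℝ F]

/-- Composition with `(y, z) ↦ (y, ‖z‖)`. -/
theorem comp_norm [Nontrivial Z] {ν : Measure Y} [ν.IsAddHaarMeasure] (ζ : Measure Z)
    [ζ.IsAddHaarMeasure] {r : ℝ≥0∞} (hr1 : 1 ≤ r) (hr : r ≠ ⊤) {φ : Y × ℝ → F}
    {Φ : Y × ℝ → Y × ℝ →L[ℝ] F} (h : W1Zero (ν.prod volume) Set.univ r φ Φ)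
    (hφ : ∀ x, 1 < ‖x‖ → φ x = 0) (hΦ : ∀ x, 1 < ‖x‖ → Φ x = 0) :
    W1Zero (ν.prod ζ) Set.univ r (fun x => φ (x.1, ‖x.2‖))
      (fun x => Φ (x.1, ‖x.2‖) ∘L fderiv ℝ (fun x : Y × Z => (x.1, ‖x.2‖)) x) := by
  have hr0 : r ≠ 0 := (zero_lt_one.trans_le hr1).ne'
  obtain ⟨C, hC, hmap⟩ := exists_map_prod_norm_le ν ζ
  let Q : Y × Z → Y × ℝ := fun x => (x.1, ‖x.2‖)
  have hQL : LipschitzWith 1 Q := by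
    have := LipschitzWith.prodMk (LipschitzWith.prod_fst (α := Y) (β := Z))
      (lipschitzWith_one_norm.comp (LipschitzWith.prod_snd (α := Y) (β := Z)))
    simpa using this
  have hQn : ∀ x, ‖Q x‖ = ‖x‖ := fun x => by simp [Q, Prod.norm_def]
  have hQd : ∀ᵐ x ∂(ν.prod ζ), DifferentiableAt ℝ Q x := hQL.ae_differentiableAt
  have hQ1 : ∀ x, ‖fderiv ℝ Q x‖ ≤ 1 := fun x => by
    simpa using norm_fderiv_le_of_lipschitz ℝ hQL (x₀ := x)
  have hcl : Continuous fun p : (Y × ℝ →L[ℝ] F) × (Y × Z →L[ℝ] Y × ℝ) => p.1 ∘L p.2 :=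
    continuous_fst.clm_comp continuous_snd
  -- The comparison of measures holds only for `‖z‖ < 2`, so the approximating functions have to be
  -- supported there.
  have hΩ := h.of_univ (Ω := Metric.ball 0 2) hr1 (isCompact_closedBall 0 1) Metric.isOpen_ball
    (Metric.closedBall_subset_ball (by norm_num)) (fun x hx => hφ x (by simpa using hx))
    (fun x hx => hΦ x (by simpa using hx))
  refine of_approx hr1 (comp_prod_norm_bound hmap h.aesm (fun x hx => hφ x (by linarith)) r).1
    (hcl.comp_aestronglyMeasurable (((comp_prod_norm_bound hmap h.aesm_grad
      (fun x hx => hΦ x (by linarith)) r).1).prodMk (aestronglyMeasurable_fderiv _ Q)))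
    fun ε hε => ?_
  have hD : C ^ (1 / r).toReal ≠ ⊤ := ENNReal.rpow_ne_top_of_nonneg ENNReal.toReal_nonneg hC
  obtain ⟨δ, hδ, hδ'⟩ := exists_ne_zero_mul_le hD hε
  obtain ⟨u, hu1, hu2, hu3, hu4, hu5⟩ := hΩ.approx δ hδ
  have hu0 : ∀ x, 2 ≤ ‖x‖ → u x = 0 := fun x hx => by
    by_contra h1
    have := hu3 (subset_tsupport u h1)
    simp at this
    linarith
  have hu'0 : ∀ x, 2 ≤ ‖x‖ → fderiv ℝ u x = 0 := fun x hx => by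
    by_contra h1
    have := hu3 (support_fderiv_subset ℝ h1)
    simp at this
    linarith
  obtain ⟨K, hK⟩ := ContDiff.lipschitzWith_of_hasCompactSupport hu2 hu1 (by simp)
  have hc : HasCompactSupport (u ∘ Q) := by
    refine HasCompactSupport.intro (isCompact_closedBall (0 : Y × Z) 2) fun x hx => ?_
    refine hu0 _ ?_
    rw [hQn]
    exact le_of_lt (by simpa using hx)
  -- The norm is not smooth at `0`, so `u ∘ Q` is only Lipschitz. That suffices, because `of_approx`
  -- accepts approximation by any maps already known to be in the space.
  refine ⟨u ∘ Q, _, of_lipschitzWith hr0 hr (hK.comp hQL) hc, ?_, ?_⟩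
  · exact ((comp_prod_norm_bound hmap (hu1.continuous.aestronglyMeasurable.sub h.aesm)
      (fun x hx => by simp [hu0 x hx, hφ x (by linarith)]) r).2.trans
      (mul_le_mul_right hu4 _)).trans hδ'
  · refine le_trans ?_ (((comp_prod_norm_bound hmap
      ((aestronglyMeasurable_fderiv _ u).sub h.aesm_grad)
      (fun x hx => by simp [hu'0 x hx, hΦ x (by linarith)]) r).2.trans
      (mul_le_mul_right hu5 _)).trans hδ')
    refine eLpNorm_mono_ae ?_
    filter_upwards [hQd] with x hx
    have h1 : fderiv ℝ (u ∘ Q) x = fderiv ℝ u (Q x) ∘L fderiv ℝ Q x :=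
      fderiv_comp x (hu1.differentiable (by simp) _) hx
    rw [h1]
    change ‖fderiv ℝ u (Q x) ∘L fderiv ℝ Q x - Φ (Q x) ∘L fderiv ℝ Q x‖ ≤ _
    rw [← ContinuousLinearMap.sub_comp]
    exact (ContinuousLinearMap.opNorm_comp_le _ _).trans
      (mul_le_of_le_one_right (norm_nonneg _) (hQ1 x))

end W1Zero
end GrowthQC

/-! ### The radial projection and its corrections: supports and weighted Lipschitz bounds -/

namespace GrowthQC

section Radial

variable {Y Z : Type*} [NormedAddCommGroup Y] [NormedSpace ℝ Y] [NormedAddCommGroup Z]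

/-- The first component of the radial projection of the punctured unit ball of `Y × Z` onto its
boundary, extended by the first projection. -/
noncomputable def radial (x : Y × Z) : Y := max 1 ‖x‖⁻¹ • x.1

/-- The displacement of the radial projection. -/
noncomputable def radialGap (x : Y × Z) : Y := radial x - x.1

theorem radial_of_one_le {x : Y × Z} (hx : 1 ≤ ‖x‖) : radial x = x.1 := by
  rw [radial, max_eq_left (inv_le_one_of_one_le₀ hx), one_smul]

theorem radial_of_le_one {x : Y × Z} (hx0 : 0 < ‖x‖) (hx : ‖x‖ ≤ 1) :
    radial x = ‖x‖⁻¹ • x.1 := by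
  rw [radial, max_eq_right ((one_le_inv₀ hx0).2 hx)]

theorem radialGap_of_one_le {x : Y × Z} (hx : 1 ≤ ‖x‖) : radialGap x = 0 := by
  rw [radialGap, radial_of_one_le hx, sub_self]

theorem radial_eq (x : Y × Z) : radial x = x.1 + radialGap x := by simp [radialGap]

theorem norm_radialGap_le (x : Y × Z) : ‖radialGap x‖ ≤ 1 := by
  rcases le_total 1 ‖x‖ with h | h
  · simp [radialGap_of_one_le h]
  rcases (norm_nonneg x).eq_or_lt' with h0 | h0
  · have : x = 0 := by simpa using h0
    simp [this, radialGap, radial]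
  · rw [radialGap, radial_of_le_one h0 h]
    have h1 : ‖x‖⁻¹ • x.1 - x.1 = (‖x‖⁻¹ - 1) • x.1 := by module
    have h2 : 0 ≤ ‖x‖⁻¹ - 1 := by linarith [(one_le_inv₀ h0).2 h]
    rw [h1, norm_smul, Real.norm_of_nonneg h2]
    calc (‖x‖⁻¹ - 1) * ‖x.1‖ ≤ (‖x‖⁻¹ - 1) * ‖x‖ :=
          mul_le_mul_of_nonneg_left (norm_fst_le x) h2
      _ = 1 - ‖x‖ := by field_simp
      _ ≤ 1 := by linarith

/-- `radial` is the first projection times the scalar `max 1 ‖x‖⁻¹`, and the increments of `‖x‖⁻¹`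
are `|‖x‖ - ‖x'‖| / (‖x‖ ‖x'‖)`. This is the quantitative form of a gradient of order `1 / min(1,
‖x‖)`. -/
theorem norm_radial_sub_mul_le (x x' : Y × Z) :
    ‖radial x - radial x'‖ * min 1 (min ‖x‖ ‖x'‖) ≤ 2 * ‖x - x'‖ := by
  rcases (norm_nonneg x).eq_or_lt' with h0 | h0
  · rw [h0, min_eq_left (norm_nonneg x'), min_eq_right zero_le_one, mul_zero]; positivity
  rcases (norm_nonneg x').eq_or_lt' with h0' | h0'
  · rw [h0', min_eq_right (norm_nonneg x), min_eq_right zero_le_one, mul_zero]; positivity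
  set c := min 1 (min ‖x‖ ‖x'‖) with hc
  have hc0 : 0 < c := lt_min zero_lt_one (lt_min h0 h0')
  have hc1 : c ≤ 1 := min_le_left _ _
  have hcx : c ≤ ‖x‖ := (min_le_right _ _).trans (min_le_left _ _)
  have h1 : radial x - radial x' = max 1 ‖x‖⁻¹ • (x - x').1 +
      (max 1 ‖x‖⁻¹ - max 1 ‖x'‖⁻¹) • x'.1 := by
    simp only [radial, Prod.fst_sub]; module
  have h2 : max 1 ‖x‖⁻¹ * c ≤ 1 := by
    rw [max_mul_of_nonneg _ _ hc0.le]
    refine max_le (by linarith) ?_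
    rw [inv_mul_le_iff₀ h0]; linarith
  have h3 : |max 1 ‖x‖⁻¹ - max 1 ‖x'‖⁻¹| * ‖x'‖ * c ≤ ‖x - x'‖ := by
    have h4 : |max 1 ‖x‖⁻¹ - max 1 ‖x'‖⁻¹| ≤ |‖x‖⁻¹ - ‖x'‖⁻¹| :=
      (abs_max_sub_max_le_max _ _ _ _).trans (max_le (by simp) le_rfl)
    have h5 : |‖x‖⁻¹ - ‖x'‖⁻¹| = |‖x‖ - ‖x'‖| / (‖x‖ * ‖x'‖) := by
      rw [inv_sub_inv h0.ne' h0'.ne', abs_div, abs_of_pos (mul_pos h0 h0'), abs_sub_comm]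
    calc |max 1 ‖x‖⁻¹ - max 1 ‖x'‖⁻¹| * ‖x'‖ * c
        ≤ |‖x‖ - ‖x'‖| / (‖x‖ * ‖x'‖) * ‖x'‖ * ‖x‖ := by
          rw [← h5]; gcongr
      _ = |‖x‖ - ‖x'‖| := by field_simp
      _ ≤ ‖x - x'‖ := abs_norm_sub_norm_le x x'
  calc ‖radial x - radial x'‖ * c
      ≤ (max 1 ‖x‖⁻¹ * ‖x - x'‖ + |max 1 ‖x‖⁻¹ - max 1 ‖x'‖⁻¹| * ‖x'‖) * c := by
        gcongr
        rw [h1]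
        refine (norm_add_le _ _).trans (add_le_add ?_ ?_)
        · rw [norm_smul, Real.norm_of_nonneg (by positivity)]
          gcongr
          exact norm_fst_le (x - x')
        · rw [norm_smul, Real.norm_eq_abs]
          gcongr
          exact norm_fst_le x'
    _ = (max 1 ‖x‖⁻¹ * c) * ‖x - x'‖ + |max 1 ‖x‖⁻¹ - max 1 ‖x'‖⁻¹| * ‖x'‖ * c := by ring
    _ ≤ 1 * ‖x - x'‖ + ‖x - x'‖ := by gcongr
    _ = _ := by ring

theorem norm_radialGap_sub_mul_le (x x' : Y × Z) :
    ‖radialGap x - radialGap x'‖ * min 1 (min ‖x‖ ‖x'‖) ≤ 3 * ‖x - x'‖ := by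
  have h1 : radialGap x - radialGap x' = (radial x - radial x') - (x - x').1 := by
    simp only [radialGap, Prod.fst_sub]; abel
  have hc0 : 0 ≤ min 1 (min ‖x‖ ‖x'‖) := by positivity
  have h2 : ‖(x - x').1‖ * min 1 (min ‖x‖ ‖x'‖) ≤ ‖x - x'‖ :=
    (mul_le_of_le_one_right (norm_nonneg _) (min_le_left _ _)).trans (norm_fst_le _)
  calc _ ≤ (‖radial x - radial x'‖ + ‖(x - x').1‖) * min 1 (min ‖x‖ ‖x'‖) := by
        rw [h1]; gcongr; exact norm_sub_le _ _
    _ ≤ 3 * ‖x - x'‖ := by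
        rw [add_mul]; linarith [norm_radial_sub_mul_le x x']

/-- The part of the correction in the unit cell that sharpens the radial projection. -/
noncomputable def sharpen (x : Y × ℝ) : Y :=
  if 0 < x.2 then radial (x.1, 2 * x.2) - radial x else 0

/-- The part of the correction in the unit cell that projects the subcell with centre `a / 2`
onto its boundary. -/
noncomputable def project (a : Y) (x : Y × ℝ) : Y :=
  if 0 < x.2 then
    (1 / 2 : ℝ) • radialGap ((2 : ℝ) • radial (x.1, 2 * x.2) - a, max 0 (2 * x.2 - 1))
  else 0

theorem norm_le_norm_double {y : Y} {t : ℝ} : ‖(y, t)‖ ≤ ‖(y, 2 * t)‖ := by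
  simp only [Prod.norm_def, norm_mul]
  refine max_le_max le_rfl ?_
  have := norm_nonneg t
  norm_num
  linarith [abs_nonneg t]

/-- In this region doubling the height does not change the sup norm, so both projections agree.
Hence switching `sharpen` off for `t ≤ 0` creates no jump away from the origin. -/
theorem sharpen_eq_zero_of_le {x : Y × ℝ} (h : 2 * x.2 ≤ ‖x.1‖) : sharpen x = 0 := by
  by_cases ht : 0 < x.2
  · have h1 : ‖((x.1, 2 * x.2) : Y × ℝ)‖ = ‖x.1‖ := by
      rw [Prod.norm_def]
      exact max_eq_left (by simpa [abs_of_pos ht] using h)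
    have h2 : ‖x‖ = ‖x.1‖ := by
      rw [Prod.norm_def]
      refine max_eq_left ?_
      rw [Real.norm_of_nonneg ht.le]; linarith
    rw [sharpen, if_pos ht, radial, radial, h1, h2, sub_self]
  · rw [sharpen, if_neg ht]

theorem sharpen_eq_zero_of_one_le {x : Y × ℝ} (h : 1 ≤ ‖x‖) : sharpen x = 0 := by
  rw [sharpen, radial_of_one_le h, radial_of_one_le (h.trans norm_le_norm_double)]
  simp

theorem norm_sharpen_le (x : Y × ℝ) : ‖sharpen x‖ ≤ 2 := by
  rw [sharpen]
  split_ifs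
  · rw [radial_eq, radial_eq, add_sub_add_left_eq_sub]
    refine (norm_sub_le _ _).trans ?_
    linarith [norm_radialGap_le x, norm_radialGap_le ((x.1, 2 * x.2) : Y × ℝ)]
  · simp

theorem norm_radial_double_sub_mul_le (x x' : Y × ℝ) :
    ‖radial (x.1, 2 * x.2) - radial (x'.1, 2 * x'.2)‖ * min 1 (min ‖x‖ ‖x'‖) ≤
      4 * ‖x - x'‖ := by
  have h1 := norm_radial_sub_mul_le (x.1, 2 * x.2) (x'.1, 2 * x'.2)
  have h2 : ‖((x.1, 2 * x.2) : Y × ℝ) - (x'.1, 2 * x'.2)‖ ≤ 2 * ‖x - x'‖ := by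
    rw [Prod.norm_def]
    refine max_le ?_ ?_
    · have := norm_fst_le (x - x')
      simp only [Prod.fst_sub] at this ⊢
      linarith [norm_nonneg (x - x')]
    · have := norm_snd_le (x - x')
      simp only [Prod.snd_sub] at this ⊢
      rw [← mul_sub, norm_mul, Real.norm_ofNat]
      linarith
  have h3 : min 1 (min ‖x‖ ‖x'‖) ≤
      min 1 (min ‖((x.1, 2 * x.2) : Y × ℝ)‖ ‖((x'.1, 2 * x'.2) : Y × ℝ)‖) :=
    min_le_min le_rfl (min_le_min norm_le_norm_double norm_le_norm_double)
  have h4 := mul_le_mul_of_nonneg_left h3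
    (norm_nonneg (radial (x.1, 2 * x.2) - radial (x'.1, 2 * x'.2)))
  linarith

/-- For two points of positive height this is the bound for the two radial maps. If only `x` has
positive height, either `sharpen x = 0` or `‖y‖ ≤ 2t ≤ 2 ‖x - x'‖`, so the weight absorbs the jump.
-/
theorem norm_sharpen_sub_mul_le (x x' : Y × ℝ) :
    ‖sharpen x - sharpen x'‖ * min (min 1 ‖x.1‖) (min 1 ‖x'.1‖) ≤ 6 * ‖x - x'‖ := by
  wlog h : x'.2 ≤ x.2 generalizing x x'
  · rw [norm_sub_rev, norm_sub_rev x, min_comm]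
    exact this x' x (le_of_not_ge h)
  by_cases ht : 0 < x.2
  · by_cases ht' : 0 < x'.2
    · have h1 : min (min 1 ‖x.1‖) (min 1 ‖x'.1‖) ≤ min 1 (min ‖x‖ ‖x'‖) := by
        refine le_min ((min_le_left _ _).trans (min_le_left _ _)) (le_min ?_ ?_)
        · exact (min_le_left _ _).trans ((min_le_right _ _).trans (norm_fst_le x))
        · exact (min_le_right _ _).trans ((min_le_right _ _).trans (norm_fst_le x'))
      have h2 : sharpen x - sharpen x' = (radial (x.1, 2 * x.2) - radial (x'.1, 2 * x'.2)) -
          (radial x - radial x') := by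
        rw [sharpen, sharpen, if_pos ht, if_pos ht']; abel
      calc _ ≤ (‖radial (x.1, 2 * x.2) - radial (x'.1, 2 * x'.2)‖ + ‖radial x - radial x'‖) *
            min 1 (min ‖x‖ ‖x'‖) := by
            rw [h2]; gcongr; exact norm_sub_le _ _
        _ ≤ 6 * ‖x - x'‖ := by
            rw [add_mul]
            linarith [norm_radial_double_sub_mul_le x x', norm_radial_sub_mul_le x x']
    · have h0 : sharpen x' = 0 := by rw [sharpen, if_neg ht']
      rw [h0, sub_zero]
      rcases le_total (2 * x.2) ‖x.1‖ with h2 | h2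
      · rw [sharpen_eq_zero_of_le h2, norm_zero, zero_mul]; positivity
      · have h3 : min (min 1 ‖x.1‖) (min 1 ‖x'.1‖) ≤ 2 * ‖x - x'‖ := by
          refine (min_le_left _ _).trans ((min_le_right _ _).trans (h2.trans ?_))
          have := norm_snd_le (x - x')
          rw [Prod.snd_sub, Real.norm_eq_abs] at this
          have h4 := le_abs_self (x.2 - x'.2)
          push Not at ht'
          linarith
        calc _ ≤ 2 * (2 * ‖x - x'‖) := by
              gcongr
              exact norm_sharpen_le x
          _ ≤ _ := by linarith [norm_nonneg (x - x')]
  · rw [sharpen, sharpen, if_neg ht, if_neg (by linarith)]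
    simp

theorem norm_project_le (a : Y) (x : Y × ℝ) : ‖project a x‖ ≤ 1 / 2 := by
  rw [project]
  split_ifs
  · rw [norm_smul, Real.norm_of_nonneg (by norm_num)]
    linarith [norm_radialGap_le ((2 : ℝ) • radial (x.1, 2 * x.2) - a, max 0 (2 * x.2 - 1))]
  · simp

variable {a : Y}

theorem one_le_norm_two_smul_sub (ha : ‖a‖ ≤ 1) {v : Y} (hv : 1 ≤ ‖v‖) :
    1 ≤ ‖(2 : ℝ) • v - a‖ := by
  have := norm_sub_norm_le ((2 : ℝ) • v) a
  rw [norm_smul, Real.norm_ofNat] at this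
  linarith

theorem one_le_norm_radial_double {x : Y × ℝ} (ht : 0 < x.2) (h : 2 * x.2 ≤ ‖x.1‖) :
    1 ≤ ‖radial (x.1, 2 * x.2)‖ := by
  have h1 : ‖((x.1, 2 * x.2) : Y × ℝ)‖ = ‖x.1‖ := by
    rw [Prod.norm_def]
    exact max_eq_left (by simpa [abs_of_pos ht] using h)
  rcases le_total 1 ‖x.1‖ with h2 | h2
  · rw [radial_of_one_le (by rw [h1]; exact h2)]; exact h2
  · have h3 : 0 < ‖x.1‖ := by linarith
    rw [radial_of_le_one (by rw [h1]; exact h3) (by rw [h1]; exact h2), h1, norm_smul, norm_inv,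
      norm_norm, inv_mul_cancel₀ h3.ne']

/-- Here the projected point `v` has norm at least `1`, so `2v - a` lies outside the open unit ball,
where `radialGap` vanishes. -/
theorem project_eq_zero_of_le (ha : ‖a‖ ≤ 1) {x : Y × ℝ} (h : 2 * x.2 ≤ ‖x.1‖) :
    project a x = 0 := by
  by_cases ht : 0 < x.2
  · rw [project, if_pos ht, radialGap_of_one_le, smul_zero]
    exact (one_le_norm_two_smul_sub ha (one_le_norm_radial_double ht h)).trans (norm_fst_le
      ((2 : ℝ) • radial (x.1, 2 * x.2) - a, max 0 (2 * x.2 - 1)))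
  · rw [project, if_neg ht]

theorem project_eq_zero_of_one_le (ha : ‖a‖ ≤ 1) {x : Y × ℝ} (h : 1 ≤ ‖x‖) :
    project a x = 0 := by
  by_cases ht : 0 < x.2
  · rw [project, if_pos ht, radialGap_of_one_le, smul_zero]
    rw [Prod.norm_def, le_max_iff] at h
    rcases h with h | h
    · have h1 : radial ((x.1, 2 * x.2) : Y × ℝ) = x.1 :=
        radial_of_one_le (h.trans (norm_fst_le ((x.1, 2 * x.2) : Y × ℝ)))
      rw [h1]
      exact (one_le_norm_two_smul_sub ha h).trans (norm_fst_le
        ((2 : ℝ) • x.1 - a, max 0 (2 * x.2 - 1)))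
    · rw [Real.norm_of_nonneg ht.le] at h
      have h2 : 1 ≤ ‖max 0 (2 * x.2 - 1)‖ :=
        (le_max_of_le_right (by linarith)).trans (le_abs_self _)
      exact h2.trans (norm_snd_le ((2 : ℝ) • radial (x.1, 2 * x.2) - a, max 0 (2 * x.2 - 1)))
  · rw [project, if_neg ht]

/-- `project` is a composition, so its gradient is of order one over the product of two weights: the
distance of `x` from the origin, where the inner projection is singular, and the distance of the
inner image from the singularity of the outer one. Both are accounted for by the distance to the
single line `y = ta`. -/
theorem weight_le (ha : ‖a‖ ≤ 1) {x : Y × ℝ} (ht : 0 < x.2) :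
    min 1 ‖x.1 - x.2 • a‖ ≤ 3 * min 1 ‖x‖ *
      min 1 ‖((2 : ℝ) • radial (x.1, 2 * x.2) - a, max 0 (2 * x.2 - 1))‖ := by
  set ζ := ‖((2 : ℝ) • radial (x.1, 2 * x.2) - a, max 0 (2 * x.2 - 1))‖ with hζ
  have hta : ‖x.2 • a‖ ≤ x.2 := by
    rw [norm_smul, Real.norm_of_nonneg ht.le]
    exact mul_le_of_le_one_right ht.le ha
  have hya : ‖x.1 - x.2 • a‖ ≤ ‖x.1‖ + x.2 := (norm_sub_le _ _).trans (by linarith)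
  have hx1 : ‖x.1‖ ≤ ‖x‖ := norm_fst_le x
  have hx2 : x.2 ≤ ‖x‖ := (le_abs_self _).trans (norm_snd_le x)
  have hη1 : min 1 ‖x.1 - x.2 • a‖ ≤ 1 := min_le_left _ _
  have hη2 : min 1 ‖x.1 - x.2 • a‖ ≤ ‖x.1 - x.2 • a‖ := min_le_right _ _
  have hζ1 : ‖(2 : ℝ) • radial (x.1, 2 * x.2) - a‖ ≤ ζ := norm_fst_le
    ((2 : ℝ) • radial (x.1, 2 * x.2) - a, max 0 (2 * x.2 - 1))
  have hζ2 : ‖max 0 (2 * x.2 - 1)‖ ≤ ζ := norm_snd_le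
    ((2 : ℝ) • radial (x.1, 2 * x.2) - a, max 0 (2 * x.2 - 1))
  rcases le_total (1 / 2) x.2 with h | h
  · have h1 : radial ((x.1, 2 * x.2) : Y × ℝ) = x.1 := by
      refine radial_of_one_le (le_trans ?_ (norm_snd_le ((x.1, 2 * x.2) : Y × ℝ)))
      rw [Real.norm_of_nonneg (by linarith)]; linarith
    rw [h1] at hζ1
    have h2 : 2 * x.2 - 1 ≤ ζ := (le_max_right _ _).trans ((le_abs_self _).trans hζ2)
    have h3 : x.1 - x.2 • a = (1 / 2 : ℝ) • ((2 : ℝ) • x.1 - a) - (x.2 - 1 / 2) • a := by module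
    have h4 : ‖x.1 - x.2 • a‖ ≤ ζ := by
      rw [h3]
      refine (norm_sub_le _ _).trans ?_
      rw [norm_smul, norm_smul, Real.norm_of_nonneg (by norm_num),
        Real.norm_of_nonneg (by linarith)]
      nlinarith [norm_nonneg a]
    have h5 : min 1 ‖x.1 - x.2 • a‖ ≤ min 1 ζ := min_le_min le_rfl h4
    have h6 : 1 / 2 ≤ min 1 ‖x‖ := le_min (by norm_num) (by linarith)
    have h7 : 0 ≤ min 1 ζ := by positivity
    nlinarith
  · rcases le_total (2 * x.2) ‖x.1‖ with h2 | h2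
    · have h3 : min 1 ζ = 1 := min_eq_left
        ((one_le_norm_two_smul_sub ha (one_le_norm_radial_double ht h2)).trans hζ1)
      rw [h3, mul_one]
      rcases le_total 1 ‖x‖ with h4 | h4
      · rw [min_eq_left h4]; linarith
      · rw [min_eq_right h4]; linarith
    · have h1 : ‖((x.1, 2 * x.2) : Y × ℝ)‖ = 2 * x.2 := by
        rw [Prod.norm_def]
        rw [max_eq_right] <;> simp [abs_of_pos ht, h2]
      have h3 : radial ((x.1, 2 * x.2) : Y × ℝ) = (2 * x.2)⁻¹ • x.1 := by
        rw [radial_of_le_one (by rw [h1]; linarith) (by rw [h1]; linarith), h1]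
      -- Below height `1/2` and inside the cone `‖y‖ ≤ 2t` the inner projection is `y / (2t)`; the
      -- factorisation of the weight is then exact, with `t` as the first factor.
      have h4 : (2 : ℝ) • ((2 * x.2)⁻¹ • x.1) - a = x.2⁻¹ • (x.1 - x.2 • a) := by
        rw [smul_sub, smul_smul, smul_smul, inv_mul_cancel₀ ht.ne', one_smul, mul_inv,
          mul_inv_cancel_left₀ (by norm_num : (2 : ℝ) ≠ 0)]
      rw [h3, h4, norm_smul, norm_inv, Real.norm_of_nonneg ht.le, inv_mul_le_iff₀ ht] at hζ1
      have h5 : x.2 ≤ min 1 ‖x‖ := le_min (by linarith) hx2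
      have h6 : 0 ≤ ζ := norm_nonneg _
      rcases le_total 1 ζ with h7 | h7
      · rw [min_eq_left h7]; linarith
      · rw [min_eq_right h7]; nlinarith

theorem norm_project_mul_le (ha : ‖a‖ ≤ 1) {x x' : Y × ℝ} (ht : 0 < x.2) (ht' : x'.2 ≤ 0) :
    ‖project a x‖ * min 1 ‖x.1 - x.2 • a‖ ≤ 90 * ‖x - x'‖ := by
  rcases le_total (2 * x.2) ‖x.1‖ with h2 | h2
  · rw [project_eq_zero_of_le ha h2, norm_zero, zero_mul]; positivity
  · have h3 : x.2 ≤ ‖x - x'‖ := by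
      have := norm_snd_le (x - x')
      rw [Prod.snd_sub, Real.norm_eq_abs] at this
      linarith [le_abs_self (x.2 - x'.2)]
    have hta : ‖x.2 • a‖ ≤ x.2 := by
      rw [norm_smul, Real.norm_of_nonneg ht.le]
      exact mul_le_of_le_one_right ht.le ha
    have h4 : min 1 ‖x.1 - x.2 • a‖ ≤ 3 * ‖x - x'‖ :=
      (min_le_right _ _).trans ((norm_sub_le _ _).trans (by linarith))
    calc _ ≤ 1 / 2 * (3 * ‖x - x'‖) := by
          gcongr
          exact norm_project_le a x
      _ ≤ _ := by linarith [norm_nonneg (x - x')]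

/-- At positive heights with comparable norms this is the chain rule, with `weight_le` distributing
the weight over the two projections. If the norms are not comparable, or only one height is
positive, then either the difference vanishes or the weight at one point is at most a multiple of
`‖x - x'‖`, and boundedness suffices. -/
theorem norm_project_sub_mul_le (ha : ‖a‖ ≤ 1) (x x' : Y × ℝ) :
    ‖project a x - project a x'‖ * min (min 1 ‖x.1 - x.2 • a‖) (min 1 ‖x'.1 - x'.2 • a‖) ≤
      90 * ‖x - x'‖ := by
  by_cases ht : 0 < x.2 <;> by_cases ht' : 0 < x'.2
  · wlog h : ‖x‖ ≤ ‖x'‖ generalizing x x'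
    · rw [norm_sub_rev, norm_sub_rev x, min_comm]
      exact this x' x ht' ht (le_of_not_ge h)
    have hw := weight_le ha ht
    have hw' := weight_le ha ht'
    set η := min 1 ‖x.1 - x.2 • a‖
    set η' := min 1 ‖x'.1 - x'.2 • a‖
    set z := ((2 : ℝ) • radial (x.1, 2 * x.2) - a, max 0 (2 * x.2 - 1)) with hz
    set z' := ((2 : ℝ) • radial (x'.1, 2 * x'.2) - a, max 0 (2 * x'.2 - 1)) with hz'
    have hη0 : 0 ≤ η := by positivity
    have hη0' : 0 ≤ η' := by positivity
    have h1 : ‖project a x - project a x'‖ = 1 / 2 * ‖radialGap z - radialGap z'‖ := by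
      rw [project, project, if_pos ht, if_pos ht', ← smul_sub, norm_smul,
        Real.norm_of_nonneg (by norm_num)]
    set c := min 1 ‖x‖ with hc
    have hc0 : 0 ≤ c := by positivity
    have hc1 : c ≤ 1 := min_le_left _ _
    have hζ0 : 0 ≤ min 1 ‖z‖ := by positivity
    have hζ0' : 0 ≤ min 1 ‖z'‖ := by positivity
    rcases le_total ‖x'‖ (2 * ‖x‖) with h2 | h2
    · have h3 : min 1 ‖x'‖ ≤ 2 * c := by
        rcases le_total 1 ‖x‖ with h4 | h4
        · rw [hc, min_eq_left h4]; linarith [min_le_left 1 ‖x'‖]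
        · rw [hc, min_eq_right h4]; exact (min_le_right _ _).trans h2
      have h4 : min η η' ≤ 6 * c * min 1 (min ‖z‖ ‖z'‖) := by
        have h5 : min 1 (min ‖z‖ ‖z'‖) = min (min 1 ‖z‖) (min 1 ‖z'‖) := by
          rw [min_min_min_comm, min_self]
        rw [h5]
        rcases le_total (min 1 ‖z‖) (min 1 ‖z'‖) with h6 | h6
        · rw [min_eq_left h6]
          refine (min_le_left _ _).trans (hw.trans ?_)
          nlinarith [mul_nonneg hc0 hζ0]
        · rw [min_eq_right h6]
          refine (min_le_right _ _).trans (hw'.trans ?_)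
          nlinarith [mul_le_mul_of_nonneg_right h3 hζ0']
      have h5 := norm_radialGap_sub_mul_le z z'
      have h6 : c * ‖z - z'‖ ≤ 10 * ‖x - x'‖ := by
        have h7 : ‖z - z'‖ ≤ 2 * ‖radial (x.1, 2 * x.2) - radial (x'.1, 2 * x'.2)‖ +
            2 * ‖x - x'‖ := by
          rw [Prod.norm_def]
          refine max_le ?_ ?_
          · have : (z - z').1 = (2 : ℝ) • (radial (x.1, 2 * x.2) - radial (x'.1, 2 * x'.2)) := by
              simp only [hz, hz', Prod.fst_sub]; module
            rw [this, norm_smul, Real.norm_ofNat]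
            linarith [norm_nonneg (x - x')]
          · have h8 : |max 0 (2 * x.2 - 1) - max 0 (2 * x'.2 - 1)| ≤
                |(2 * x.2 - 1) - (2 * x'.2 - 1)| :=
              (abs_max_sub_max_le_max _ _ _ _).trans (max_le (by simp) le_rfl)
            have h9 : |(2 * x.2 - 1) - (2 * x'.2 - 1)| = 2 * |x.2 - x'.2| := by
              rw [sub_sub_sub_cancel_right, ← mul_sub, abs_mul, abs_of_pos (by norm_num)]
            have h10 : |x.2 - x'.2| ≤ ‖x - x'‖ := norm_snd_le (x - x')
            have h11 : ‖(z - z').2‖ = |max 0 (2 * x.2 - 1) - max 0 (2 * x'.2 - 1)| := rfl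
            rw [h11]
            linarith [norm_nonneg (radial (x.1, 2 * x.2) - radial (x'.1, 2 * x'.2))]
        have h8 := norm_radial_double_sub_mul_le x x'
        rw [min_eq_left h] at h8
        nlinarith [norm_nonneg (x - x')]
      rw [h1]
      -- The constant `90` is `9 · 10`: the outer projection with its weights contributes `9`, the
      -- inner map together with the height `10`.
      calc 1 / 2 * ‖radialGap z - radialGap z'‖ * min η η'
          ≤ 1 / 2 * ‖radialGap z - radialGap z'‖ * (6 * c * min 1 (min ‖z‖ ‖z'‖)) := by gcongr
        _ = 3 * c * (‖radialGap z - radialGap z'‖ * min 1 (min ‖z‖ ‖z'‖)) := by ring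
        _ ≤ 3 * c * (3 * ‖z - z'‖) := by gcongr
        _ = 9 * (c * ‖z - z'‖) := by ring
        _ ≤ _ := by linarith
    · have h3 : ‖x‖ ≤ ‖x - x'‖ := by
        have := norm_sub_norm_le x' x
        rw [norm_sub_rev] at this
        linarith
      have h4 : min η η' ≤ 3 * ‖x - x'‖ := by
        have h5 : c ≤ ‖x‖ := min_le_right _ _
        have h6 : min 1 ‖z‖ ≤ 1 := min_le_left _ _
        refine (min_le_left _ _).trans (hw.trans ?_)
        nlinarith
      have h5 : ‖project a x - project a x'‖ ≤ 1 := by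
        refine (norm_sub_le _ _).trans ?_
        linarith [norm_project_le a x, norm_project_le a x']
      calc _ ≤ 1 * (3 * ‖x - x'‖) := by gcongr
        _ ≤ _ := by linarith [norm_nonneg (x - x')]
  · have h0 : project a x' = 0 := by rw [project, if_neg ht']
    rw [h0, sub_zero]
    exact (mul_le_mul_of_nonneg_left (min_le_left _ _) (norm_nonneg _)).trans
      (norm_project_mul_le ha ht (not_lt.1 ht'))
  · have h0 : project a x = 0 := by rw [project, if_neg ht]
    rw [h0, zero_sub, norm_neg, norm_sub_rev x x']
    exact (mul_le_mul_of_nonneg_left (min_le_right _ _) (norm_nonneg _)).trans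
      (norm_project_mul_le ha ht' (not_lt.1 ht))
  · rw [project, project, if_neg ht, if_neg ht']
    simp

end Radial

end GrowthQC

/-! ### Integrability of the inverse distance to a graph -/

namespace GrowthQC

section Weight

variable {Y : Type*} [NormedAddCommGroup Y] [NormedSpace ℝ Y] [FiniteDimensional ℝ Y]
  [MeasurableSpace Y] [BorelSpace Y]
  {Z : Type*} [NormedAddCommGroup Z] [NormedSpace ℝ Z] [FiniteDimensional ℝ Z]
  [MeasurableSpace Z] [BorelSpace Z]

theorem integrable_indicator_ball_inv_rpow (ν : Measure Y) [ν.IsAddHaarMeasure] {r : ℝ}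
    (hr : 1 ≤ r) (hrY : r < Module.finrank ℝ Y) (R : ℝ) :
    Integrable ((Metric.ball (0 : Y) R).indicator fun y => (min 1 ‖y‖)⁻¹ ^ r) ν := by
  rw [integrable_indicator_iff measurableSet_ball]
  have hd : 1 ≤ Module.finrank ℝ Y := by
    have : (1 : ℝ) < Module.finrank ℝ Y := hr.trans_lt hrY
    exact_mod_cast this.le
  refine integrableOn_ball_of_norm_le_rpow hd (C := (max 1 R) ^ r) hrY ?_ ?_
  · refine (ae_restrict_mem measurableSet_ball).mono fun y hy => ?_
    have hy' : ‖y‖ < R := by simpa using hy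
    rw [Real.norm_of_nonneg (by positivity)]
    rcases (norm_nonneg y).eq_or_lt' with h0 | h0
    · rw [h0, min_eq_right zero_le_one, inv_zero, Real.zero_rpow (by linarith)]
      positivity
    · rw [Real.rpow_neg h0.le, ← Real.inv_rpow h0.le, ← Real.mul_rpow (by positivity)
        (by positivity)]
      refine Real.rpow_le_rpow (by positivity) ?_ (by linarith)
      rw [← div_eq_mul_inv, le_div_iff₀ h0, inv_mul_le_iff₀ (lt_min zero_lt_one h0)]
      rcases le_total 1 ‖y‖ with h1 | h1
      · rw [min_eq_left h1, one_mul]; exact hy'.le.trans (le_max_right _ _)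
      · rw [min_eq_right h1]; exact le_mul_of_one_le_right h0.le (le_max_left _ _)
  · have : Measurable fun y : Y => (min 1 ‖y‖)⁻¹ ^ r := by fun_prop
    exact this.aestronglyMeasurable

/-- The map `(y, z) ↦ (y - A z, z)`. -/
noncomputable def shear (A : Z →L[ℝ] Y) : (Y × Z) ≃L[ℝ] (Y × Z) :=
  ContinuousLinearEquiv.equivOfInverse
    ((ContinuousLinearMap.fst ℝ Y Z - A ∘L ContinuousLinearMap.snd ℝ Y Z).prod
      (ContinuousLinearMap.snd ℝ Y Z))
    ((ContinuousLinearMap.fst ℝ Y Z + A ∘L ContinuousLinearMap.snd ℝ Y Z).prod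
      (ContinuousLinearMap.snd ℝ Y Z))
    (fun x => by simp) (fun x => by simp)

theorem shear_apply (A : Z →L[ℝ] Y) (x : Y × Z) : shear A x = (x.1 - A x.2, x.2) := rfl

/-- A shear straightens the graph to `{0} × Z`. After that the weight depends on `y` alone, and
Fubini reduces the claim to local integrability of `‖y‖^{-r}`, which is where `r < dim Y` is needed.
-/
theorem memLp_weight (ν : Measure Y) [ν.IsAddHaarMeasure] (ζ : Measure Z) [ζ.IsAddHaarMeasure]
    {r : ℝ} (hr : 1 ≤ r) (hrY : r < Module.finrank ℝ Y) (A : Z →L[ℝ] Y) :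
    MemLp ((Metric.closedBall (0 : Y × Z) 1).indicator fun x => (min 1 ‖x.1 - A x.2‖)⁻¹)
      (ENNReal.ofReal r) (ν.prod ζ) := by
  have hr0 : ENNReal.ofReal r ≠ 0 := by simp; linarith
  have hrr : (ENNReal.ofReal r).toReal = r := ENNReal.toReal_ofReal (by linarith)
  have hint := (integrable_indicator_ball_inv_rpow ν hr hrY (2 + ‖A‖)).mul_prod
    (g := (Metric.closedBall (0 : Z) 1).indicator fun _ => (1 : ℝ)) (ν := ζ)
    ((integrable_indicator_iff measurableSet_closedBall).2
      (integrableOn_const (isCompact_closedBall _ _).measure_lt_top.ne))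
  let f : Y × Z → ℝ := fun x => (Metric.ball (0 : Y) (2 + ‖A‖)).indicator
      (fun y => (min 1 ‖y‖)⁻¹) x.1 * (Metric.closedBall (0 : Z) 1).indicator (fun _ => (1 : ℝ)) x.2
  have hfm : Measurable f := by
    have h1 : Measurable fun y : Y => (min 1 ‖y‖)⁻¹ := by fun_prop
    exact ((h1.indicator measurableSet_ball).comp measurable_fst).mul
      ((measurable_const.indicator measurableSet_closedBall).comp measurable_snd)
  have hf : MemLp f (ENNReal.ofReal r) (ν.prod ζ) := by
    rw [← integrable_norm_rpow_iff hfm.aestronglyMeasurable hr0 ENNReal.ofReal_ne_top, hrr]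
    refine hint.congr (Eventually.of_forall fun x => ?_)
    by_cases h1 : x.1 ∈ Metric.ball (0 : Y) (2 + ‖A‖) <;>
      by_cases h2 : x.2 ∈ Metric.closedBall (0 : Z) 1
    · simp only [f, Set.indicator_of_mem h1, Set.indicator_of_mem h2, mul_one]
      rw [Real.norm_of_nonneg (by positivity)]
    all_goals
      have : r ≠ 0 := by linarith
      simp [f, h1, h2, Real.zero_rpow this]
  obtain ⟨C, -, hC, hmap⟩ := exists_map_affine_eq (ν.prod ζ) (ν.prod ζ) (shear A) 0
  have hsm : Measurable fun x => shear A x + 0 := by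
    exact ((shear A).continuous.add continuous_const).measurable
  have h1 := eLpNorm_comp_le hsm hmap.le
    hf.1 (ENNReal.ofReal r)
  have hm : Measurable ((Metric.closedBall (0 : Y × Z) 1).indicator
      fun x => (min 1 ‖x.1 - A x.2‖)⁻¹) := by
    refine Measurable.indicator ?_ measurableSet_closedBall
    fun_prop
  have h2 := h1.trans_lt (ENNReal.mul_lt_top
    (ENNReal.rpow_lt_top_of_nonneg ENNReal.toReal_nonneg hC) hf.2)
  refine ⟨hm.aestronglyMeasurable, (eLpNorm_mono fun x => ?_).trans_lt h2⟩
  by_cases hx : x ∈ Metric.closedBall (0 : Y × Z) 1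
  · have hx' : ‖x‖ ≤ 1 := by simpa using hx
    have h2 : ‖x.1‖ ≤ 1 := (norm_fst_le x).trans hx'
    have h3 : ‖x.2‖ ≤ 1 := (norm_snd_le x).trans hx'
    have h4 : ‖x.1 - A x.2‖ < 2 + ‖A‖ := by
      have := A.le_opNorm x.2
      have h5 := mul_le_of_le_one_right (norm_nonneg A) h3
      linarith [norm_sub_le x.1 (A x.2)]
    rw [Set.indicator_of_mem hx]
    simp only [f, shear_apply, add_zero]
    rw [Set.indicator_of_mem (by simpa using h4), Set.indicator_of_mem (by simpa using h3), mul_one]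
  · rw [Set.indicator_of_notMem hx, norm_zero]; positivity

theorem ae_weight_pos [Nontrivial Y] (ν : Measure Y) [ν.IsAddHaarMeasure] (ζ : Measure Z)
    [ζ.IsAddHaarMeasure] (A : Z →L[ℝ] Y) : ∀ᵐ x ∂(ν.prod ζ), 0 < min 1 ‖x.1 - A x.2‖ := by
  let l : Y × Z →L[ℝ] Y := ContinuousLinearMap.fst ℝ Y Z - A ∘L ContinuousLinearMap.snd ℝ Y Z
  have h1 : (ν.prod ζ) (LinearMap.ker (l : Y × Z →ₗ[ℝ] Y) : Set (Y × Z)) = 0 := by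
    refine Measure.addHaar_submodule _ _ fun h => ?_
    obtain ⟨y, hy⟩ := exists_ne (0 : Y)
    have h2 : ((y, 0) : Y × Z) ∈ LinearMap.ker (l : Y × Z →ₗ[ℝ] Y) := h ▸ Submodule.mem_top
    exact hy (by simpa [l] using h2)
  have h2 : ∀ᵐ x ∂(ν.prod ζ), x ∉ (LinearMap.ker (l : Y × Z →ₗ[ℝ] Y) : Set (Y × Z)) :=
    measure_eq_zero_iff_ae_notMem.1 h1
  filter_upwards [h2] with x hx
  refine lt_min zero_lt_one (norm_pos_iff.2 fun h => hx ?_)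
  simpa [l] using h

theorem lipschitzWith_weight (A : Z →L[ℝ] Y) :
    ∃ κ, LipschitzWith κ fun x : Y × Z => min 1 ‖x.1 - A x.2‖ := by
  let l : Y × Z →L[ℝ] Y := ContinuousLinearMap.fst ℝ Y Z - A ∘L ContinuousLinearMap.snd ℝ Y Z
  have h1 : LipschitzWith _ fun x : Y × Z => ‖l x‖ := lipschitzWith_one_norm.comp l.lipschitz
  exact ⟨_, h1.const_min 1⟩

/-- Functions with a singularity along the graph of a linear map. -/
theorem W1Zero.of_graph_weight (ν : Measure Y) [ν.IsAddHaarMeasure] (ζ : Measure Z)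
    [ζ.IsAddHaarMeasure] {F : Type*} [NormedAddCommGroup F] [NormedSpace ℝ F]
    [FiniteDimensional ℝ F] {r : ℝ} (hr : 1 ≤ r) (hrY : r < Module.finrank ℝ Y) (A : Z →L[ℝ] Y)
    {w : Y × Z → F} {C M : ℝ} (hM : ∀ x, ‖w x‖ ≤ M)
    (hw : ∀ x x', ‖w x - w x'‖ * min (min 1 ‖x.1 - A x.2‖) (min 1 ‖x'.1 - A x'.2‖) ≤
      C * ‖x - x'‖)
    (hsupp : ∀ x, 1 < ‖x‖ → w x = 0) :
    W1Zero (ν.prod ζ) Set.univ (ENNReal.ofReal r) w (fderiv ℝ w) ∧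
      ∀ᵐ x ∂(ν.prod ζ), DifferentiableAt ℝ w x := by
  have : Nontrivial Y := by
    have : (0 : ℝ) < Module.finrank ℝ Y := by linarith
    exact Module.nontrivial_of_finrank_pos (R := ℝ) (by exact_mod_cast this)
  obtain ⟨κ, hκ⟩ := lipschitzWith_weight A
  exact W1Zero.of_weight (by simpa using hr) ENNReal.ofReal_ne_top hκ hM hw hsupp
    (ae_weight_pos ν ζ A) (memLp_weight ν ζ hr hrY A)

/-- The natural weight is `‖x‖`, but the smaller `‖y‖` already has an `L^r` inverse on the ball and
puts this map into the same framework as the other two, with `A = 0`. -/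
theorem w1Zero_radialGap (ν : Measure Y) [ν.IsAddHaarMeasure] (ζ : Measure Z)
    [ζ.IsAddHaarMeasure] {r : ℝ} (hr : 1 ≤ r) (hrY : r < Module.finrank ℝ Y) :
    W1Zero (ν.prod ζ) Set.univ (ENNReal.ofReal r) (radialGap : Y × Z → Y) (fderiv ℝ radialGap) ∧
      ∀ᵐ x ∂(ν.prod ζ), DifferentiableAt ℝ (radialGap : Y × Z → Y) x := by
  refine W1Zero.of_graph_weight ν ζ hr hrY (0 : Z →L[ℝ] Y) norm_radialGap_le (C := 3) ?_
    fun x hx => radialGap_of_one_le hx.le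
  intro x x'
  refine (mul_le_mul_of_nonneg_left ?_ (norm_nonneg _)).trans (norm_radialGap_sub_mul_le x x')
  simp only [zero_apply, sub_zero]
  refine le_min ((min_le_left _ _).trans (min_le_left _ _)) (le_min ?_ ?_)
  · exact (min_le_left _ _).trans ((min_le_right _ _).trans (norm_fst_le x))
  · exact (min_le_right _ _).trans ((min_le_right _ _).trans (norm_fst_le x'))

theorem w1Zero_sharpen (ν : Measure Y) [ν.IsAddHaarMeasure] {r : ℝ} (hr : 1 ≤ r)
    (hrY : r < Module.finrank ℝ Y) :
    W1Zero (ν.prod volume) Set.univ (ENNReal.ofReal r) (sharpen : Y × ℝ → Y) (fderiv ℝ sharpen) ∧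
      ∀ᵐ x ∂(ν.prod volume), DifferentiableAt ℝ (sharpen : Y × ℝ → Y) x := by
  refine W1Zero.of_graph_weight ν volume hr hrY (0 : ℝ →L[ℝ] Y) norm_sharpen_le (C := 6) ?_
    fun x hx => sharpen_eq_zero_of_one_le hx.le
  intro x x'
  simpa using norm_sharpen_sub_mul_le x x'

theorem w1Zero_project (ν : Measure Y) [ν.IsAddHaarMeasure] {r : ℝ} (hr : 1 ≤ r)
    (hrY : r < Module.finrank ℝ Y) {a : Y} (ha : ‖a‖ ≤ 1) :
    W1Zero (ν.prod volume) Set.univ (ENNReal.ofReal r) (project a) (fderiv ℝ (project a)) ∧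
      ∀ᵐ x ∂(ν.prod volume), DifferentiableAt ℝ (project a) x := by
  refine W1Zero.of_graph_weight ν volume hr hrY (ContinuousLinearMap.toSpanSingleton ℝ a)
    (norm_project_le a) (C := 90) ?_ fun x hx => project_eq_zero_of_one_le ha hx.le
  intro x x'
  simpa using norm_project_sub_mul_le ha x x'

end Weight

end GrowthQC

/-! ### Dyadic subcells and self-similar series -/

namespace GrowthQC

section Cells

variable {m : ℕ}

instance : (volume : Measure ((Fin m → ℝ) × ℝ)).IsAddHaarMeasure := by
  rw [Measure.volume_eq_prod]; infer_instance

/-- The vector with entries `±1` prescribed by `σ`. -/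
def signVec (σ : Fin m → Bool) : Fin m → ℝ := fun i => if σ i then 1 else -1

theorem abs_signVec (σ : Fin m → Bool) (i : Fin m) : |signVec σ i| = 1 := by
  rw [signVec]; split_ifs <;> simp

theorem norm_signVec_le (σ : Fin m → Bool) : ‖signVec σ‖ ≤ 1 :=
  (pi_norm_le_iff_of_nonneg zero_le_one).2 fun i => (abs_signVec σ i).le

/-- The affine map from the upper subcell with index `σ` onto the unit cell. -/
def subcell (σ : Fin m → Bool) (x : (Fin m → ℝ) × ℝ) : (Fin m → ℝ) × ℝ :=
  ((2 : ℝ) • x.1 - signVec σ, 2 * x.2 - 1)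

/-- The open unit cell. -/
def unitCell (m : ℕ) : Set ((Fin m → ℝ) × ℝ) := {x | ‖x.1‖ < 1 ∧ 0 < x.2 ∧ x.2 < 1}

/-- The sum of the copies of `f` on the upper subcells. -/
def transfer {G : Type*} [AddCommMonoid G] (f : (Fin m → ℝ) × ℝ → G) (x : (Fin m → ℝ) × ℝ) : G :=
  ∑ σ : Fin m → Bool, f (subcell σ x)

theorem isOpen_unitCell : IsOpen (unitCell m) := by
  have h1 : IsOpen {x : (Fin m → ℝ) × ℝ | ‖x.1‖ < 1} := isOpen_lt (by fun_prop) continuous_const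
  have h2 : IsOpen {x : (Fin m → ℝ) × ℝ | 0 < x.2} := isOpen_lt continuous_const (by fun_prop)
  have h3 : IsOpen {x : (Fin m → ℝ) × ℝ | x.2 < 1} := isOpen_lt (by fun_prop) continuous_const
  exact h1.inter (h2.inter h3)

theorem norm_lt_one_of_mem_unitCell {x : (Fin m → ℝ) × ℝ} (hx : x ∈ unitCell m) : ‖x‖ < 1 := by
  rw [Prod.norm_def, Real.norm_of_nonneg hx.2.1.le]
  exact max_lt hx.1 hx.2.2

theorem abs_two_mul_sub_lt {σ : Fin m → Bool} {y : Fin m → ℝ} (h : ‖(2 : ℝ) • y - signVec σ‖ < 1)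
    (i : Fin m) : |2 * y i - signVec σ i| < 1 := by
  have := (norm_le_pi_norm ((2 : ℝ) • y - signVec σ) i).trans_lt h
  simpa using this

/-- In the open subcube of index `σ` the signs of the coordinates of `y` are those of `σ`.
Consequently at most one term of `transfer` is nonzero. -/
theorem sign_unique {σ σ' : Fin m → Bool} {y : Fin m → ℝ} (h : ‖(2 : ℝ) • y - signVec σ‖ < 1)
    (h' : ‖(2 : ℝ) • y - signVec σ'‖ < 1) : σ = σ' := by
  ext1 i
  have h1 := abs_lt.1 (abs_two_mul_sub_lt h i)
  have h2 := abs_lt.1 (abs_two_mul_sub_lt h' i)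
  simp only [signVec] at h1 h2
  cases h3 : σ i <;> cases h4 : σ' i <;> simp [h3, h4] at h1 h2 ⊢ <;> linarith

theorem mem_of_subcell_mem {σ : Fin m → Bool} {x : (Fin m → ℝ) × ℝ}
    (h : subcell σ x ∈ unitCell m) : x ∈ unitCell m ∧ 1 / 2 < x.2 := by
  obtain ⟨h1, h2, h3⟩ := h
  simp only [subcell] at h1 h2 h3
  refine ⟨⟨?_, by linarith, by linarith⟩, by linarith⟩
  have h4 : (2 : ℝ) • x.1 = ((2 : ℝ) • x.1 - signVec σ) + signVec σ := by abel
  have h5 : ‖(2 : ℝ) • x.1‖ ≤ ‖(2 : ℝ) • x.1 - signVec σ‖ + ‖signVec σ‖ := by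
    conv_lhs => rw [h4]
    exact norm_add_le _ _
  rw [norm_smul, Real.norm_ofNat] at h5
  linarith [norm_signVec_le σ]

theorem measurable_subcell (σ : Fin m → Bool) : Measurable (subcell σ) := by
  unfold subcell; fun_prop

theorem map_subcell (σ : Fin m → Bool) :
    (volume : Measure ((Fin m → ℝ) × ℝ)).map (subcell σ) =
      ENNReal.ofReal ((2 ^ (m + 1))⁻¹) • volume := by
  have h1 : subcell σ = (fun x => x + ((-signVec σ, -1) : (Fin m → ℝ) × ℝ)) ∘
      fun x => (2 : ℝ) • x := by
    ext x <;> simp [subcell, sub_eq_add_neg]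
  rw [h1, ← Measure.map_map (measurable_add_const _) (measurable_const_smul _),
    Measure.map_addHaar_smul _ two_ne_zero, Measure.map_smul, map_add_right_eq_self]
  congr 2
  simp [abs_of_pos]

theorem quasiMeasurePreserving_subcell (σ : Fin m → Bool) :
    Measure.QuasiMeasurePreserving (subcell σ) := by
  refine ⟨measurable_subcell σ, ?_⟩
  rw [map_subcell]
  exact Measure.smul_absolutelyContinuous

section Transfer

variable {G : Type*} [NormedAddCommGroup G]

theorem transfer_eq_of_mem {f : (Fin m → ℝ) × ℝ → G} (hf : ∀ x ∉ unitCell m, f x = 0)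
    {σ : Fin m → Bool} {x : (Fin m → ℝ) × ℝ} (hx : subcell σ x ∈ unitCell m) :
    transfer f x = f (subcell σ x) := by
  refine Finset.sum_eq_single σ (fun σ' _ hne => hf _ fun h => hne ?_) (by simp)
  exact sign_unique h.1 hx.1

theorem transfer_eq_zero {f : (Fin m → ℝ) × ℝ → G} (hf : ∀ x ∉ unitCell m, f x = 0)
    {x : (Fin m → ℝ) × ℝ} (hx : ∀ σ, subcell σ x ∉ unitCell m) : transfer f x = 0 :=
  Finset.sum_eq_zero fun σ _ => hf _ (hx σ)

/-- Each generation lives in the upper half of the previous one, hence generation `j` in the layer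
`1 - 2^{-j} < t < 1`. Every pointwise series over the generations is therefore a finite sum. -/
theorem transfer_iterate_eq_zero {f : (Fin m → ℝ) × ℝ → G} (hf : ∀ x ∉ unitCell m, f x = 0)
    (j : ℕ) : ∀ x, (x ∉ unitCell m ∨ x.2 ≤ 1 - (1 / 2) ^ j) → transfer^[j] f x = 0 := by
  induction j with
  | zero =>
    rintro x (hx | hx)
    · exact hf x hx
    · exact hf x fun h => by simp at hx; exact absurd h.2.1 (not_lt.2 hx)
  | succ j ih =>
    intro x hx
    rw [Function.iterate_succ_apply']
    refine Finset.sum_eq_zero fun σ _ => ih _ ?_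
    by_contra! h
    rcases hx with hx | hx
    · exact hx (mem_of_subcell_mem h.1).1
    · have := h.2
      simp only [subcell] at this
      rw [pow_succ] at hx
      linarith

theorem aestronglyMeasurable_transfer {f : (Fin m → ℝ) × ℝ → G}
    (hf : AEStronglyMeasurable f volume) : AEStronglyMeasurable (transfer f) volume :=
  Finset.aestronglyMeasurable_fun_sum _ fun σ _ =>
    hf.comp_quasiMeasurePreserving (quasiMeasurePreserving_subcell σ)

theorem aestronglyMeasurable_transfer_iterate {f : (Fin m → ℝ) × ℝ → G}
    (hf : AEStronglyMeasurable f volume) (j : ℕ) :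
    AEStronglyMeasurable (transfer^[j] f) volume := by
  induction j with
  | zero => exact hf
  | succ j ih =>
    rw [Function.iterate_succ']
    exact aestronglyMeasurable_transfer ih

/-- The copies are disjoint, so `r`-th powers add; there are `2^m` of them and each change of
variables contributes `2^{-(m+1)}`. The product `1/2` makes the gradients summable although
rescaling does not damp them. -/
theorem eLpNorm_transfer_le {f : (Fin m → ℝ) × ℝ → G} (hf : AEStronglyMeasurable f volume)
    (hf0 : ∀ x ∉ unitCell m, f x = 0) {r : ℝ≥0∞} (hr0 : r ≠ 0) (hr : r ≠ ⊤) :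
    eLpNorm (transfer f) r volume ≤ (2⁻¹ : ℝ≥0∞) ^ (1 / r.toReal) * eLpNorm f r volume := by
  have hrpos : 0 < r.toReal := ENNReal.toReal_pos hr0 hr
  rw [eLpNorm_eq_lintegral_rpow_enorm_toReal hr0 hr, eLpNorm_eq_lintegral_rpow_enorm_toReal hr0 hr,
    ← ENNReal.mul_rpow_of_nonneg _ _ (by positivity)]
  refine ENNReal.rpow_le_rpow ?_ (by positivity)
  have h1 : ∀ x, ‖transfer f x‖ₑ ^ r.toReal ≤ ∑ σ, ‖f (subcell σ x)‖ₑ ^ r.toReal := by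
    intro x
    by_cases h : ∃ σ, subcell σ x ∈ unitCell m
    · obtain ⟨σ, hσ⟩ := h
      rw [transfer_eq_of_mem hf0 hσ]
      exact Finset.single_le_sum (f := fun σ => ‖f (subcell σ x)‖ₑ ^ r.toReal)
        (fun _ _ => zero_le) (Finset.mem_univ σ)
    · push Not at h
      rw [transfer_eq_zero hf0 h, enorm_zero, ENNReal.zero_rpow_of_pos hrpos]
      exact zero_le
  have h2 : ∀ σ : Fin m → Bool, ∫⁻ x, ‖f (subcell σ x)‖ₑ ^ r.toReal =
      ENNReal.ofReal ((2 ^ (m + 1))⁻¹) * ∫⁻ x, ‖f x‖ₑ ^ r.toReal := by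
    intro σ
    have h3 : AEMeasurable (fun x => ‖f x‖ₑ ^ r.toReal)
        ((volume : Measure ((Fin m → ℝ) × ℝ)).map (subcell σ)) := by
      rw [map_subcell]
      exact (hf.enorm.pow_const _).smul_measure _
    rw [← lintegral_map' h3 (measurable_subcell σ).aemeasurable, map_subcell,
      lintegral_smul_measure, smul_eq_mul]
  calc ∫⁻ x, ‖transfer f x‖ₑ ^ r.toReal ≤ ∫⁻ x, ∑ σ, ‖f (subcell σ x)‖ₑ ^ r.toReal :=
        lintegral_mono h1
    _ = ∑ σ : Fin m → Bool, ∫⁻ x, ‖f (subcell σ x)‖ₑ ^ r.toReal := by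
        refine lintegral_finsetSum' _ fun σ _ => ?_
        exact (hf.comp_quasiMeasurePreserving (quasiMeasurePreserving_subcell σ)).enorm.pow_const _
    _ = 2⁻¹ * ∫⁻ x, ‖f x‖ₑ ^ r.toReal := by
        simp only [h2, Finset.sum_const, Finset.card_univ, Fintype.card_fun, Fintype.card_bool,
          Fintype.card_fin, nsmul_eq_mul]
        rw [← mul_assoc]
        congr 1
        rw [← ENNReal.ofReal_natCast, ← ENNReal.ofReal_mul (by positivity)]
        push_cast
        rw [pow_succ, mul_inv, mul_inv_cancel_left₀ (by positivity),
          ENNReal.ofReal_inv_of_pos (by norm_num), ENNReal.ofReal_ofNat]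
    _ ≤ _ := le_rfl

theorem tsum_eLpNorm_transfer_iterate_ne_top {f : (Fin m → ℝ) × ℝ → G} {r : ℝ≥0∞} (hr0 : r ≠ 0)
    (hr : r ≠ ⊤) (hf : MemLp f r volume) (hf0 : ∀ x ∉ unitCell m, f x = 0) :
    ∑' j, eLpNorm (transfer^[j] f) r volume ≠ ⊤ := by
  have hrpos : 0 < r.toReal := ENNReal.toReal_pos hr0 hr
  set θ : ℝ≥0∞ := (2⁻¹ : ℝ≥0∞) ^ (1 / r.toReal)
  have hθ : θ < 1 := ENNReal.rpow_lt_one (by simp) (by positivity)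
  have h1 : ∀ j, eLpNorm (transfer^[j] f) r volume ≤ θ ^ j * eLpNorm f r volume := by
    intro j
    induction j with
    | zero => simp
    | succ j ih =>
      rw [Function.iterate_succ', pow_succ', mul_assoc]
      exact (eLpNorm_transfer_le (aestronglyMeasurable_transfer_iterate hf.1 j)
        (fun x hx => transfer_iterate_eq_zero hf0 j x (Or.inl hx)) hr0 hr).trans
        (mul_le_mul_right ih _)
  refine ne_top_of_le_ne_top ?_ (ENNReal.tsum_le_tsum h1)
  rw [ENNReal.tsum_mul_right, ENNReal.tsum_geometric]
  exact ENNReal.mul_ne_top (ENNReal.inv_ne_top.2 (tsub_pos_of_lt hθ).ne') hf.2.ne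

theorem exists_forall_transfer_iterate_eq_zero {f : (Fin m → ℝ) × ℝ → G}
    (hf : ∀ x ∉ unitCell m, f x = 0) (x : (Fin m → ℝ) × ℝ) :
    ∃ J, ∀ j ∉ Finset.range J, transfer^[j] f x = 0 := by
  by_cases hx : x ∈ unitCell m
  · obtain ⟨J, hJ⟩ := exists_pow_lt_of_lt_one (sub_pos.2 hx.2.2) (show (1 / 2 : ℝ) < 1 by norm_num)
    refine ⟨J, fun j hj => transfer_iterate_eq_zero hf j x (Or.inr ?_)⟩
    have h1 : (1 / 2 : ℝ) ^ j ≤ (1 / 2) ^ J :=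
      pow_le_pow_of_le_one (by norm_num) (by norm_num) (by simpa using hj)
    linarith
  · exact ⟨0, fun j _ => transfer_iterate_eq_zero hf j x (Or.inl hx)⟩

end Transfer

section Refine

variable {F : Type*} [NormedAddCommGroup F] [NormedSpace ℝ F] [FiniteDimensional ℝ F]

/-- The sum of the rescaled copies of `f` on the subcells of all generations. -/
noncomputable def refine (f : (Fin m → ℝ) × ℝ → F) (x : (Fin m → ℝ) × ℝ) : F :=
  ∑' j, (1 / 2 : ℝ) ^ j • transfer^[j] f x

/-- The gradient of `refine`, in terms of the gradient of the given function. -/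
noncomputable def refineGrad (f : (Fin m → ℝ) × ℝ → F) (x : (Fin m → ℝ) × ℝ) : F :=
  ∑' j, transfer^[j] f x

theorem refineGrad_eq_zero {f : (Fin m → ℝ) × ℝ → F} (hf : ∀ x ∉ unitCell m, f x = 0)
    {x : (Fin m → ℝ) × ℝ} (hx : x ∉ unitCell m) : refineGrad f x = 0 := by
  rw [refineGrad]
  simp only [transfer_iterate_eq_zero hf _ x (Or.inl hx), tsum_zero]

theorem refine_eq_zero {f : (Fin m → ℝ) × ℝ → F} (hf : ∀ x ∉ unitCell m, f x = 0)
    {x : (Fin m → ℝ) × ℝ} (hx : x ∉ unitCell m) : refine f x = 0 := by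
  rw [refine]
  simp only [transfer_iterate_eq_zero hf _ x (Or.inl hx), smul_zero, tsum_zero]

theorem summable_transfer_iterate {f : (Fin m → ℝ) × ℝ → F} (hf : ∀ x ∉ unitCell m, f x = 0)
    (x : (Fin m → ℝ) × ℝ) : Summable fun j => transfer^[j] f x := by
  obtain ⟨J, hJ⟩ := exists_forall_transfer_iterate_eq_zero hf x
  exact (hasSum_sum_of_ne_finset_zero hJ).summable

/-- Self-similarity: in the upper subcells the later generations form a copy of the whole series.
This drives the induction on height in the rank argument. -/
theorem refineGrad_eq_add_transfer {f : (Fin m → ℝ) × ℝ → F} (hf : ∀ x ∉ unitCell m, f x = 0)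
    (x : (Fin m → ℝ) × ℝ) : refineGrad f x = f x + transfer (refineGrad f) x := by
  rw [refineGrad, (summable_transfer_iterate hf x).tsum_eq_zero_add]
  congr 1
  simp only [transfer, refineGrad, Function.iterate_succ_apply']
  exact Summable.tsum_finsetSum fun σ _ => summable_transfer_iterate hf _

/-- The factor `1/2` in front of the function cancels the factor `2` that differentiating `subcell`
produces. -/
theorem w1Zero_transfer {r : ℝ≥0∞} (hr1 : 1 ≤ r) {φ : (Fin m → ℝ) × ℝ → F}
    {Φ : (Fin m → ℝ) × ℝ → (Fin m → ℝ) × ℝ →L[ℝ] F} (h : W1Zero volume Set.univ r φ Φ) :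
    W1Zero volume Set.univ r (fun x => (1 / 2 : ℝ) • transfer φ x) (transfer Φ) := by
  let D : ((Fin m → ℝ) × ℝ) ≃L[ℝ] ((Fin m → ℝ) × ℝ) :=
    ContinuousLinearEquiv.smulLeft (Units.mk0 (2 : ℝ) two_ne_zero)
  have h1 := W1Zero.sum hr1 (Finset.univ : Finset (Fin m → Bool)) fun σ _ =>
    h.comp_affine volume D
      ((-signVec σ, -1) : (Fin m → ℝ) × ℝ) ((1 / 2 : ℝ) • ContinuousLinearMap.id ℝ F)
  have h2 : ∀ (σ : Fin m → Bool) (x : (Fin m → ℝ) × ℝ),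
      D x +
        ((-signVec σ, -1) : (Fin m → ℝ) × ℝ) = subcell σ x := by
    intro σ x
    change (2 : ℝ) • x + _ = _
    ext <;> simp [subcell, sub_eq_add_neg]
  refine h1.congr (Eventually.of_forall fun x => ?_) (Eventually.of_forall fun x => ?_)
  · simp only [Finset.sum_apply, h2, transfer, Finset.smul_sum]
    rfl
  · simp only [Finset.sum_apply, h2, transfer]
    refine Finset.sum_congr rfl fun σ _ => ?_
    refine ContinuousLinearMap.ext fun v => ?_
    change (1 / 2 : ℝ) • Φ (subcell σ x) ((2 : ℝ) • v) = _
    rw [map_smul, smul_smul]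
    norm_num

theorem w1Zero_refine {r : ℝ≥0∞} (hr1 : 1 ≤ r) (hr : r ≠ ⊤) {φ : (Fin m → ℝ) × ℝ → F}
    {Φ : (Fin m → ℝ) × ℝ → (Fin m → ℝ) × ℝ →L[ℝ] F} (h : W1Zero volume Set.univ r φ Φ)
    (hφ : ∀ x ∉ unitCell m, φ x = 0) (hΦ : ∀ x ∉ unitCell m, Φ x = 0) :
    W1Zero volume Set.univ r (refine φ) (refineGrad Φ) := by
  have hr0 : r ≠ 0 := (zero_lt_one.trans_le hr1).ne'
  have hW : ∀ j, W1Zero volume Set.univ r (fun x => (1 / 2 : ℝ) ^ j • transfer^[j] φ x)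
      (transfer^[j] Φ) := by
    intro j
    induction j with
    | zero => simpa using h
    | succ j ih =>
      have h1 := w1Zero_transfer hr1 ih
      rw [Function.iterate_succ', Function.iterate_succ']
      refine h1.congr (Eventually.of_forall fun x => ?_) (Eventually.of_forall fun x => rfl)
      simp only [transfer, Function.comp_apply, pow_succ', ← Finset.smul_sum, smul_smul]
  refine W1Zero.of_series hr1 hW ?_ (tsum_eLpNorm_transfer_iterate_ne_top hr0 hr h.memLp.2 hΦ)
    (Eventually.of_forall fun x => ?_) (Eventually.of_forall fun x => ?_)
  · refine ne_top_of_le_ne_top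
      (tsum_eLpNorm_transfer_iterate_ne_top hr0 hr h.memLp.1 hφ)
      (ENNReal.tsum_le_tsum fun j => eLpNorm_mono fun x => ?_)
    rw [norm_smul, Real.norm_of_nonneg (by positivity)]
    exact mul_le_of_le_one_left (norm_nonneg _) (pow_le_one₀ (by norm_num) (by norm_num))
  · obtain ⟨J, hJ⟩ := exists_forall_transfer_iterate_eq_zero hφ x
    have h1 : ∀ j ∉ Finset.range J, (1 / 2 : ℝ) ^ j • transfer^[j] φ x = 0 := fun j hj => by
      rw [hJ j hj, smul_zero]
    exact (hasSum_sum_of_ne_finset_zero h1).summable.hasSum.tendsto_sum_nat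
  · exact (summable_transfer_iterate hΦ x).hasSum.tendsto_sum_nat

end Refine

end Cells

end GrowthQC

/-! ### Loss of rank on the cell -/

namespace GrowthQC

/-- A map one of whose coordinates lies in a finite set at every point near `x` has a derivative
at `x` that is not onto. -/
theorem not_surjective_of_eventually_mem {X : Type*} [NormedAddCommGroup X] [NormedSpace ℝ X]
    {ι : Type*} [Fintype ι] {G : X → ι → ℝ} {G' : X →L[ℝ] ι → ℝ} {x : X}
    (hG : HasFDerivAt G G' x) {S : Set ℝ} (hS : S.Finite) (h : ∀ᶠ x' in 𝓝 x, ∃ i, G x' i ∈ S) :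
    ¬ Function.Surjective G' := by
  intro hsurj
  -- Along the direction `u` every coordinate has derivative `1`, hence avoids the finite set `S` at
  -- all nearby points other than `x`.
  obtain ⟨u, hu⟩ := hsurj fun _ => 1
  have hl : HasDerivAt (fun s : ℝ => x + s • u) u 0 := by
    simpa using ((hasDerivAt_id (0 : ℝ)).smul_const u).const_add x
  have hG0 : HasFDerivAt G G' (x + (0 : ℝ) • u) := by simpa using hG
  have h1 : HasDerivAt (fun s : ℝ => G (x + s • u)) (fun _ => 1) 0 := by
    have := hG0.comp_hasDerivAt (0 : ℝ) hl
    rwa [hu] at this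
  have h2 : ∀ᶠ s in 𝓝[≠] (0 : ℝ), ∀ i, ∀ c ∈ S, G (x + s • u) i ≠ c :=
    eventually_all.2 fun i => (hS.eventually_all).2 fun c _ =>
      (hasDerivAt_pi.1 h1 i).eventually_ne one_ne_zero
  have h3 : ∀ᶠ s in 𝓝[≠] (0 : ℝ), ∃ i, G (x + s • u) i ∈ S := by
    have h4 : Tendsto (fun s : ℝ => x + s • u) (𝓝 0) (𝓝 x) := by
      simpa using hl.continuousAt.tendsto
    exact (h4.mono_left nhdsWithin_le_nhds).eventually h
  obtain ⟨s, hs2, i, hs3⟩ := (h2.and h3).exists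
  exact hs2 i _ hs3 rfl

section Skeleton

variable {m : ℕ}

theorem exists_abs_eq_norm [NeZero m] (y : Fin m → ℝ) : ∃ i, |y i| = ‖y‖ := by
  obtain ⟨i, -, hi⟩ := Finset.exists_mem_eq_sup' (Finset.univ_nonempty (α := Fin m))
    fun i => ‖y i‖
  refine ⟨i, ?_⟩
  rw [Pi.norm_def, ← Real.norm_eq_abs]
  refine le_antisymm (by simpa [Pi.norm_def] using norm_le_pi_norm y i) ?_
  rw [← Pi.norm_def]
  refine (pi_norm_le_iff_of_nonneg (norm_nonneg _)).2 fun j => ?_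
  rw [← hi]
  exact Finset.le_sup' (fun i => ‖y i‖) (Finset.mem_univ j)

theorem norm_signVec [NeZero m] (σ : Fin m → Bool) : ‖signVec σ‖ = 1 := by
  obtain ⟨i, hi⟩ := exists_abs_eq_norm (signVec σ)
  rw [← hi, abs_signVec]

/-- A closed subcube does not meet the other open ones, so only one summand of a sum of subcube
projections is active, on common faces included. -/
theorem one_le_norm_two_smul_sub_signVec {σ σ' : Fin m → Bool} (h : σ ≠ σ') {y : Fin m → ℝ}
    (hy : ‖(2 : ℝ) • y - signVec σ‖ ≤ 1) : 1 ≤ ‖(2 : ℝ) • y - signVec σ'‖ := by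
  obtain ⟨i, hi⟩ := Function.ne_iff.1 h
  refine le_trans ?_ (norm_le_pi_norm ((2 : ℝ) • y - signVec σ') i)
  have h1 := (norm_le_pi_norm ((2 : ℝ) • y - signVec σ) i).trans hy
  simp only [Pi.sub_apply, Pi.smul_apply, smul_eq_mul, Real.norm_eq_abs, signVec, abs_le] at h1 ⊢
  rw [le_abs]
  cases h3 : σ i <;> cases h4 : σ' i <;> simp [h3, h4] at h1 hi ⊢
  · right; linarith
  · left; linarith

theorem exists_norm_two_smul_sub_signVec_le {y : Fin m → ℝ} (hy : ‖y‖ ≤ 1) :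
    ∃ σ, ‖(2 : ℝ) • y - signVec σ‖ ≤ 1 := by
  refine ⟨fun i => decide (0 ≤ y i), (pi_norm_le_iff_of_nonneg zero_le_one).2 fun i => ?_⟩
  have h1 := abs_le.1 ((norm_le_pi_norm y i).trans hy)
  simp only [Pi.sub_apply, Pi.smul_apply, smul_eq_mul, Real.norm_eq_abs, signVec, abs_le,
    decide_eq_true_eq]
  split_ifs with h <;> constructor <;> linarith

theorem exists_norm_two_smul_sub_signVec_lt {y : Fin m → ℝ} (hy : ‖y‖ < 1) (h0 : ∀ i, y i ≠ 0) :
    ∃ σ, ‖(2 : ℝ) • y - signVec σ‖ < 1 := by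
  refine ⟨fun i => decide (0 ≤ y i), (pi_norm_lt_iff zero_lt_one).2 fun i => ?_⟩
  have h1 := abs_lt.1 ((norm_le_pi_norm y i).trans_lt hy)
  simp only [Pi.sub_apply, Pi.smul_apply, smul_eq_mul, Real.norm_eq_abs, signVec, abs_lt,
    decide_eq_true_eq]
  split_ifs with h
  · have := h.lt_of_ne' (h0 i)
    constructor <;> linarith
  · constructor <;> linarith

/-- The radial projections in the `2^m` subcubes of the unit cube put a coordinate into
`{-1, 0, 1}`. -/
theorem exists_coord_mem [NeZero m] {Z : Type*} [NormedAddCommGroup Z] {v : Fin m → ℝ}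
    (hv : ‖v‖ ≤ 1) (hne : ∀ σ, (2 : ℝ) • v ≠ signVec σ) :
    ∃ i, (v + ∑ σ, (1 / 2 : ℝ) • radialGap ((2 : ℝ) • v - signVec σ, (0 : Z))) i ∈
      ({-1, 0, 1} : Set ℝ) := by
  obtain ⟨σ, hσ⟩ := exists_norm_two_smul_sub_signVec_le hv
  set a := (2 : ℝ) • v - signVec σ with ha
  have hn : ‖((a, 0) : (Fin m → ℝ) × Z)‖ = ‖a‖ := by simp [Prod.norm_def]
  have h0 : 0 < ‖a‖ := norm_pos_iff.2 (sub_ne_zero.2 (hne σ))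
  have h1 : ∑ σ', (1 / 2 : ℝ) • radialGap ((2 : ℝ) • v - signVec σ', (0 : Z)) =
      (1 / 2 : ℝ) • radialGap (a, (0 : Z)) := by
    refine Finset.sum_eq_single σ (fun σ' _ hne => ?_) (by simp)
    rw [radialGap_of_one_le, smul_zero]
    exact (one_le_norm_two_smul_sub_signVec hne.symm hσ).trans
      (norm_fst_le ((2 : ℝ) • v - signVec σ', (0 : Z)))
  have h2 : v + (1 / 2 : ℝ) • radialGap (a, (0 : Z)) =
      (1 / 2 : ℝ) • (signVec σ + ‖a‖⁻¹ • a) := by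
    rw [radialGap, radial_of_le_one (by rwa [hn]) (by rwa [hn]), hn]
    have : v = (1 / 2 : ℝ) • (a + signVec σ) := by rw [ha]; module
    rw [this]; module
  obtain ⟨i, hi⟩ := exists_abs_eq_norm a
  refine ⟨i, ?_⟩
  rw [h1, h2]
  have h3 : |‖a‖⁻¹ * a i| = 1 := by
    rw [abs_mul, abs_inv, abs_norm, hi, inv_mul_cancel₀ h0.ne']
  simp only [Pi.smul_apply, Pi.add_apply, smul_eq_mul, Set.mem_insert_iff, Set.mem_singleton_iff]
  rcases eq_or_eq_neg_of_abs_eq h3 with h3 | h3 <;>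
    rcases eq_or_eq_neg_of_abs_eq (abs_signVec σ i) with h4 | h4 <;> rw [h3, h4] <;> norm_num

/-- The correction of the radial projection in the unit cell. -/
noncomputable def correction (x : (Fin m → ℝ) × ℝ) : Fin m → ℝ :=
  sharpen x + ∑ σ : Fin m → Bool, project (signVec σ) x

theorem correction_eq_zero {x : (Fin m → ℝ) × ℝ} (hx : 1 ≤ ‖x‖ ∨ x.2 ≤ 0) :
    correction x = 0 := by
  rcases hx with hx | hx
  · simp only [correction, sharpen_eq_zero_of_one_le hx,
      project_eq_zero_of_one_le (norm_signVec_le _) hx, Finset.sum_const_zero, add_zero]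
  · simp [correction, sharpen, project, hx.not_gt]

theorem one_le_norm_or_of_notMem {x : (Fin m → ℝ) × ℝ} (hx : x ∉ unitCell m) :
    1 ≤ ‖x‖ ∨ x.2 ≤ 0 := by
  by_contra! h
  exact hx ⟨(norm_fst_le x).trans_lt h.1, h.2,
    (le_abs_self _).trans_lt ((norm_snd_le x).trans_lt h.1)⟩

/-- The term `sharpen` telescopes with the radial projection and replaces it by the one at doubled
height. -/
theorem fst_add_radialGap_add_correction {x : (Fin m → ℝ) × ℝ} (hx : 0 < x.2) :
    x.1 + radialGap x + correction x = radial (x.1, 2 * x.2) + ∑ σ : Fin m → Bool,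
      (1 / 2 : ℝ) • radialGap ((2 : ℝ) • radial (x.1, 2 * x.2) - signVec σ,
        max 0 (2 * x.2 - 1)) := by
  simp only [correction, sharpen, project, if_pos hx]
  rw [← radial_eq]; abel

/-- The excluded lines `y = tσ` are exactly the points that the first projection sends to the centre
of a subcube, where the second projection is undefined. -/
theorem exists_coord_mem_lower [NeZero m] {x : (Fin m → ℝ) × ℝ} (hx : x ∈ unitCell m)
    (ht : x.2 < 1 / 2) (hne : ∀ σ, x.1 ≠ x.2 • signVec σ) :
    ∃ i, (x.1 + radialGap x + correction x) i ∈ ({-1, 0, 1} : Set ℝ) := by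
  have h2 : 0 < 2 * x.2 := by linarith [hx.2.1]
  set s := ‖((x.1, 2 * x.2) : (Fin m → ℝ) × ℝ)‖ with hs
  have hsm : s = max ‖x.1‖ (2 * x.2) := by rw [hs, Prod.norm_def, Real.norm_of_nonneg h2.le]
  have hs0 : 0 < s := by rw [hsm]; exact lt_max_of_lt_right h2
  have hs1 : s ≤ 1 := by rw [hsm]; exact max_le hx.1.le (by linarith)
  have hv : radial (x.1, 2 * x.2) = s⁻¹ • x.1 := radial_of_le_one hs0 hs1
  rw [fst_add_radialGap_add_correction hx.2.1, max_eq_left (by linarith), hv]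
  refine exists_coord_mem ?_ fun σ h => ?_
  · rw [norm_smul, norm_inv, Real.norm_of_nonneg hs0.le, inv_mul_le_iff₀ hs0, mul_one, hsm]
    exact le_max_left _ _
  · have h3 : x.1 = (s / 2) • signVec σ := by
      rw [← h, smul_smul, smul_smul]
      field_simp
      simp
    have h4 : ‖x.1‖ = s / 2 := by
      rw [h3, norm_smul, norm_signVec, mul_one, Real.norm_of_nonneg (by positivity)]
    have h5 : s = 2 * x.2 := by
      rcases max_choice ‖x.1‖ (2 * x.2) with h6 | h6
      · rw [hsm, h6] at h4
        have : ‖x.1‖ = 0 := by linarith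
        rw [hsm, h6] at hs0
        linarith
      · rw [hsm, h6]
    refine hne σ ?_
    conv_lhs => rw [h3, h5]
    congr 1; ring

/-- Above height `1/2` the projection at doubled height is the identity, and what remains is a
half-size copy of the original radial projection. The correction of the next generation can then act
on this copy. -/
theorem fst_add_radialGap_add_correction_upper {σ : Fin m → Bool} {x : (Fin m → ℝ) × ℝ}
    (hx : subcell σ x ∈ unitCell m) :
    x.1 + radialGap x + correction x = x.1 + (1 / 2 : ℝ) • radialGap (subcell σ x) := by
  have h1 := mem_of_subcell_mem hx
  have hr : radial ((x.1, 2 * x.2) : (Fin m → ℝ) × ℝ) = x.1 := by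
    refine radial_of_one_le (le_trans ?_ (norm_snd_le ((x.1, 2 * x.2) : (Fin m → ℝ) × ℝ)))
    rw [Real.norm_of_nonneg (by linarith)]; linarith
  rw [fst_add_radialGap_add_correction h1.1.2.1, hr, max_eq_right (by linarith)]
  congr 1
  refine Finset.sum_eq_single σ (fun σ' _ hne => ?_) (by simp)
  rw [radialGap_of_one_le, smul_zero]
  exact (one_le_norm_two_smul_sub_signVec hne.symm hx.1.le).trans
    (norm_fst_le ((2 : ℝ) • x.1 - signVec σ', 2 * x.2 - 1))

end Skeleton

section Correction

variable {m : ℕ}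

theorem neZero_of_lt_natCast {r : ℝ} (hr : 1 ≤ r) (hrm : r < m) : NeZero m := by
  refine ⟨fun h => ?_⟩
  rw [h, Nat.cast_zero] at hrm
  linarith

theorem w1Zero_fderiv_correction {r : ℝ} (hr : 1 ≤ r) (hrm : r < m) :
    W1Zero volume Set.univ (ENNReal.ofReal r) (correction (m := m)) (fderiv ℝ correction) ∧
      ∀ᵐ x, DifferentiableAt ℝ (correction (m := m)) x := by
  have hrY : r < Module.finrank ℝ (Fin m → ℝ) := by simpa using hrm
  have h1 := w1Zero_sharpen (volume : Measure (Fin m → ℝ)) hr hrY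
  have h2 := fun σ : Fin m → Bool => w1Zero_project (volume : Measure (Fin m → ℝ)) hr hrY
    (norm_signVec_le σ)
  rw [← Measure.volume_eq_prod] at h1 h2
  have hr1 : 1 ≤ ENNReal.ofReal r := by simpa using hr
  have h3 : ∀ᵐ x, ∀ σ : Fin m → Bool, DifferentiableAt ℝ (project (signVec σ)) x :=
    ae_all_iff.2 fun σ => (h2 σ).2
  refine ⟨(h1.1.add hr1 (W1Zero.sum hr1 Finset.univ fun σ _ => (h2 σ).1)).congr ?_ ?_, ?_⟩
  · exact Eventually.of_forall fun x => by simp [correction]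
  · filter_upwards [h1.2, h3] with x hx1 hx2
    have h4 : HasFDerivAt (correction (m := m)) (fderiv ℝ sharpen x +
        ∑ σ, fderiv ℝ (project (signVec σ)) x) x :=
      hx1.hasFDerivAt.add (HasFDerivAt.fun_sum fun σ _ => (hx2 σ).hasFDerivAt)
    simp [h4.fderiv]
  · filter_upwards [h1.2, h3] with x hx1 hx2
    exact hx1.add (DifferentiableAt.fun_sum fun σ _ => hx2 σ)

theorem ae_snd_ne (c : ℝ) : ∀ᵐ x : (Fin m → ℝ) × ℝ, x.2 ≠ c := by
  have : ∀ᵐ t : ℝ, t ≠ c := by simp [ae_iff]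
  rw [Measure.volume_eq_prod]
  exact Measure.quasiMeasurePreserving_snd.ae this

theorem ae_coord_ne_zero : ∀ᵐ x : (Fin m → ℝ) × ℝ, ∀ i, x.1 i ≠ 0 := by
  rw [Measure.volume_eq_prod]
  refine ae_all_iff.2 fun i => ?_
  have h1 : ∀ᵐ t : ℝ, t ≠ 0 := by simp [ae_iff]
  have h2 : ∀ᵐ y : Fin m → ℝ, y i ≠ 0 :=
    (Measure.quasiMeasurePreserving_eval (fun _ : Fin m => (volume : Measure ℝ)) i).ae h1
  exact Measure.quasiMeasurePreserving_fst.ae h2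

/-- The gradient of the correction, set to zero off the unit cell. -/
noncomputable def correctionGrad : (Fin m → ℝ) × ℝ → (Fin m → ℝ) × ℝ →L[ℝ] Fin m → ℝ :=
  (unitCell m).indicator (fderiv ℝ correction)

/-- Off the cell the correction vanishes near every point, except possibly on the null sets `‖x‖ =
1` and `t = 0`. Setting the gradient to zero there is thus harmless, and makes `transfer` applicable
without exceptional sets. -/
theorem w1Zero_correction {r : ℝ} (hr : 1 ≤ r) (hrm : r < m) :
    W1Zero volume Set.univ (ENNReal.ofReal r) (correction (m := m)) correctionGrad := by
  refine (w1Zero_fderiv_correction hr hrm).1.congr (Eventually.of_forall fun _ => rfl) ?_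
  have h1 : ∀ᵐ x : (Fin m → ℝ) × ℝ, ‖x‖ ≠ 1 := by
    rw [ae_iff]
    have : {x : (Fin m → ℝ) × ℝ | ¬ ‖x‖ ≠ 1} = Metric.sphere 0 1 := by ext; simp
    rw [this]
    exact Measure.addHaar_sphere _ _ _
  filter_upwards [h1, ae_snd_ne 0] with x hx1 hx2
  rw [correctionGrad]
  by_cases hx : x ∈ unitCell m
  · rw [Set.indicator_of_mem hx]
  rw [Set.indicator_of_notMem hx]
  have h2 : correction =ᶠ[𝓝 x] fun _ => (0 : Fin m → ℝ) := by
    rcases one_le_norm_or_of_notMem hx with h | h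
    · filter_upwards [continuous_norm.continuousAt.eventually_const_lt (h.lt_of_ne' hx1)] with z hz
      exact correction_eq_zero (Or.inl hz.le)
    · filter_upwards [continuous_snd.continuousAt.eventually_lt_const (h.lt_of_ne hx2)] with z hz
      exact correction_eq_zero (Or.inr hz.le)
  rw [h2.fderiv_eq]
  simp

theorem correction_eq_zero_of_notMem : ∀ x ∉ unitCell m, correction x = 0 := fun _ hx =>
  correction_eq_zero (one_le_norm_or_of_notMem hx)

theorem correctionGrad_eq_zero_of_notMem : ∀ x ∉ unitCell m, correctionGrad x = 0 := fun _ hx =>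
  Set.indicator_of_notMem hx _

theorem hasFDerivAt_subcell (σ : Fin m → Bool) (x : (Fin m → ℝ) × ℝ) :
    HasFDerivAt (subcell σ) ((2 : ℝ) • ContinuousLinearMap.id ℝ ((Fin m → ℝ) × ℝ)) x := by
  have h : subcell σ = fun x => (2 : ℝ) • x - ((signVec σ, 1) : (Fin m → ℝ) × ℝ) := by
    ext x <;> simp [subcell]
  rw [h]
  exact ((hasFDerivAt_id x).const_smul (2 : ℝ)).sub_const _

/-- The gradient of the projection of the unit cell to its skeleton, in all generations. -/
noncomputable def cellGrad (x : (Fin m → ℝ) × ℝ) : (Fin m → ℝ) × ℝ →L[ℝ] Fin m → ℝ :=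
  ContinuousLinearMap.fst ℝ (Fin m → ℝ) ℝ + fderiv ℝ radialGap x + refineGrad correctionGrad x

/-- Induction on the number of layers. In the lower half the map itself has a coordinate in `{-1, 0,
1}`; in the upper half `cellGrad` takes the value it has at the rescaled point, which lies one layer
lower. -/
theorem ae_not_surjective_cellGrad_of_lt {r : ℝ} (hr : 1 ≤ r) (hrm : r < m) (J : ℕ) :
    ∀ᵐ x : (Fin m → ℝ) × ℝ, x ∈ unitCell m → x.2 < 1 - (1 / 2) ^ J →
      ¬ Function.Surjective (cellGrad x) := by
  have : NeZero m := neZero_of_lt_natCast hr hrm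
  have hrY : r < Module.finrank ℝ (Fin m → ℝ) := by simpa using hrm
  have hd := (w1Zero_radialGap (volume : Measure (Fin m → ℝ)) (volume : Measure ℝ) hr hrY).2
  have hne : ∀ᵐ x : (Fin m → ℝ) × ℝ, ∀ σ : Fin m → Bool, x.1 ≠ x.2 • signVec σ := by
    rw [Measure.volume_eq_prod]
    refine ae_all_iff.2 fun σ => ?_
    filter_upwards [ae_weight_pos volume volume (ContinuousLinearMap.toSpanSingleton ℝ (signVec σ))]
      with x hx h
    rw [ContinuousLinearMap.toSpanSingleton_apply, ← h, sub_self, norm_zero,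
      min_eq_right zero_le_one] at hx
    exact lt_irrefl _ hx
  rw [← Measure.volume_eq_prod] at hd
  have hfst : ∀ x : (Fin m → ℝ) × ℝ, HasFDerivAt (fun x : (Fin m → ℝ) × ℝ => x.1)
    (ContinuousLinearMap.fst ℝ (Fin m → ℝ) ℝ) x := fun x => hasFDerivAt_fst
  induction J with
  | zero => exact Eventually.of_forall fun x hx h => absurd hx.2.1 (by simp at h; exact h.not_gt)
  | succ J ih =>
    have ih' : ∀ᵐ x, ∀ σ, subcell σ x ∈ unitCell m → (subcell σ x).2 < 1 - (1 / 2) ^ J →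
        ¬ Function.Surjective (cellGrad (subcell σ x)) :=
      ae_all_iff.2 fun σ => (quasiMeasurePreserving_subcell σ).ae ih
    have hd' : ∀ᵐ x, ∀ σ, DifferentiableAt ℝ radialGap (subcell σ x) :=
      ae_all_iff.2 fun σ => (quasiMeasurePreserving_subcell σ).ae hd
    filter_upwards [ih', hd, hd', hne, (w1Zero_fderiv_correction hr hrm).2, ae_snd_ne (1 / 2),
      ae_coord_ne_zero] with x hih hdx hdx' hnex hb hx2 hx1 hx hxJ
    have hG := ((hfst x).add hdx.hasFDerivAt).add hb.hasFDerivAt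
    have hE : refineGrad correctionGrad x =
        fderiv ℝ correction x + transfer (refineGrad correctionGrad) x := by
      rw [refineGrad_eq_add_transfer correctionGrad_eq_zero_of_notMem, correctionGrad,
        Set.indicator_of_mem hx]
    have hE0 : ∀ x ∉ unitCell m, refineGrad (correctionGrad (m := m)) x = 0 := fun x hx =>
      refineGrad_eq_zero correctionGrad_eq_zero_of_notMem hx
    rcases lt_or_gt_of_ne hx2 with h | h
    · have h1 : transfer (refineGrad correctionGrad) x = 0 :=
        transfer_eq_zero hE0 fun σ hσ => (mem_of_subcell_mem hσ).2.not_gt h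
      have h2 : cellGrad x = ContinuousLinearMap.fst ℝ (Fin m → ℝ) ℝ + fderiv ℝ radialGap x +
          fderiv ℝ correction x := by
        rw [cellGrad, hE, h1, add_zero]
      rw [h2]
      refine not_surjective_of_eventually_mem hG (S := {-1, 0, 1}) (Set.toFinite _) ?_
      have h3 : ∀ᶠ z : (Fin m → ℝ) × ℝ in 𝓝 x, ∀ σ, z.1 ≠ z.2 • signVec σ :=
        eventually_all.2 fun σ => 
          ((isOpen_ne_fun continuous_fst (by fun_prop)).mem_nhds (hnex σ))
      filter_upwards [h3, isOpen_unitCell.mem_nhds hx,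
        continuous_snd.continuousAt.eventually_lt_const h] with z hz1 hz2 hz3
      exact exists_coord_mem_lower hz2 hz3 hz1
    -- Upper half: almost every point lies in one open subcell, since no coordinate of `y` vanishes.
    -- The map with its first correction is locally a rescaled radial projection, and comparing
    -- derivatives gives `cellGrad x = cellGrad (subcell σ x)`.
    · obtain ⟨σ, hσ⟩ := exists_norm_two_smul_sub_signVec_lt hx.1 hx1
      have hmem : subcell σ x ∈ unitCell m := ⟨hσ, by simp only [subcell]; linarith,
        by simp only [subcell]; linarith [hx.2.2]⟩
      have h1 : HasFDerivAt (fun x : (Fin m → ℝ) × ℝ =>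
          x.1 + (1 / 2 : ℝ) • radialGap (subcell σ x))
          (ContinuousLinearMap.fst ℝ (Fin m → ℝ) ℝ + fderiv ℝ radialGap (subcell σ x)) x := by
        have h2 := (hfst x).add
          ((((hdx' σ).hasFDerivAt).comp x (hasFDerivAt_subcell σ x)).const_smul (1 / 2 : ℝ))
        have h3 : (1 / 2 : ℝ) • (fderiv ℝ radialGap (subcell σ x) ∘L
            ((2 : ℝ) • ContinuousLinearMap.id ℝ ((Fin m → ℝ) × ℝ))) =
            fderiv ℝ radialGap (subcell σ x) := by
          refine ContinuousLinearMap.ext fun v => ?_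
          simp
        rwa [h3] at h2
      have h2 : (fun x : (Fin m → ℝ) × ℝ => x.1 + radialGap x + correction x) =ᶠ[𝓝 x]
          fun x => x.1 + (1 / 2 : ℝ) • radialGap (subcell σ x) := by
        have h3 : ∀ᶠ z in 𝓝 x, subcell σ z ∈ unitCell m :=
          (hasFDerivAt_subcell σ x).continuousAt.eventually_mem (isOpen_unitCell.mem_nhds hmem)
        filter_upwards [h3] with z hz
        exact fst_add_radialGap_add_correction_upper hz
      have h3 := hG.unique (h1.congr_of_eventuallyEq h2)
      have h4 : cellGrad x = cellGrad (subcell σ x) := by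
        rw [cellGrad, hE, transfer_eq_of_mem hE0 hmem, ← add_assoc, h3, cellGrad]
      rw [h4]
      refine hih σ hmem ?_
      simp only [subcell]
      rw [pow_succ] at hxJ
      linarith

theorem ae_not_surjective_cellGrad {r : ℝ} (hr : 1 ≤ r) (hrm : r < m) :
    ∀ᵐ x : (Fin m → ℝ) × ℝ, x ∈ unitCell m → ¬ Function.Surjective (cellGrad x) := by
  filter_upwards [ae_all_iff.2 (ae_not_surjective_cellGrad_of_lt hr hrm)] with x hx hx'
  obtain ⟨J, hJ⟩ := exists_pow_lt_of_lt_one (sub_pos.2 hx'.2.2) (show (1 / 2 : ℝ) < 1 by norm_num)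
  exact hx J hx' (by linarith)

end Correction

end GrowthQC

/-! ### The skeleton map on `ℝᵐ × Z` -/

namespace GrowthQC

section SkeletonMap

variable {m : ℕ}

theorem fderiv_radialGap_eq_zero {Y Z : Type*} [NormedAddCommGroup Y] [NormedSpace ℝ Y]
    [NormedAddCommGroup Z] [NormedSpace ℝ Z] {x : Y × Z} (hx : 1 < ‖x‖) :
    fderiv ℝ (radialGap : Y × Z → Y) x = 0 := by
  have h : (radialGap : Y × Z → Y) =ᶠ[𝓝 x] fun _ => 0 := by
    filter_upwards [continuous_norm.continuousAt.eventually_const_lt hx] with z hz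
    exact radialGap_of_one_le hz.le
  rw [h.fderiv_eq]
  simp

theorem notMem_unitCell {x : (Fin m → ℝ) × ℝ} (hx : 1 < ‖x‖) : x ∉ unitCell m := fun h =>
  (norm_lt_one_of_mem_unitCell h).not_gt hx

variable {Z : Type*} [NormedAddCommGroup Z] [InnerProductSpace ℝ Z] [FiniteDimensional ℝ Z]
  [MeasurableSpace Z] [BorelSpace Z]

/-- The radial projection alone suffices: the whole boundary of the ball is the boundary of the
cube, on which a coordinate is `±1`. -/
theorem exists_skeletonMap_of_subsingleton [Subsingleton Z] (ζ : Measure Z) [ζ.IsAddHaarMeasure]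
    {r : ℝ} (hr : 1 ≤ r) (hrm : r < m) :
    ∃ (φ : (Fin m → ℝ) × Z → Fin m → ℝ) (Φ : (Fin m → ℝ) × Z → (Fin m → ℝ) × Z →L[ℝ] Fin m → ℝ),
      W1Zero ((volume : Measure (Fin m → ℝ)).prod ζ) Set.univ (ENNReal.ofReal r) φ Φ ∧
      (∀ x, 1 < ‖x‖ → φ x = 0) ∧ (∀ x, 1 < ‖x‖ → Φ x = 0) ∧
      ∀ᵐ x ∂((volume : Measure (Fin m → ℝ)).prod ζ), ‖x‖ < 1 →
        ¬ Function.Surjective (ContinuousLinearMap.fst ℝ (Fin m → ℝ) Z + Φ x) := by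
  have : NeZero m := neZero_of_lt_natCast hr hrm
  have hrY : r < Module.finrank ℝ (Fin m → ℝ) := by simpa using hrm
  have hd := w1Zero_radialGap (volume : Measure (Fin m → ℝ)) ζ hr hrY
  refine ⟨radialGap, fderiv ℝ radialGap, hd.1, fun x hx => radialGap_of_one_le hx.le,
    fun x hx => fderiv_radialGap_eq_zero hx, ?_⟩
  filter_upwards [hd.2, ae_weight_pos volume ζ (0 : Z →L[ℝ] Fin m → ℝ)] with x hdx hx0 hx1
  have hx2 : x.1 ≠ 0 := fun h => by simp [h] at hx0
  have hfst : HasFDerivAt (fun x : (Fin m → ℝ) × Z => x.1)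
    (ContinuousLinearMap.fst ℝ (Fin m → ℝ) Z) x := hasFDerivAt_fst
  refine not_surjective_of_eventually_mem (hfst.add hdx.hasFDerivAt) (S := {-1, 1})
    (Set.toFinite _) ?_
  filter_upwards [continuous_norm.continuousAt.eventually_lt_const hx1,
    continuous_fst.continuousAt.eventually_ne hx2] with z hz1 hz2
  have hn : ‖z‖ = ‖z.1‖ := by
    rw [Prod.norm_def, Subsingleton.elim z.2 0, norm_zero]
    exact max_eq_left (norm_nonneg _)
  have h0 : 0 < ‖z.1‖ := norm_pos_iff.2 hz2
  obtain ⟨i, hi⟩ := exists_abs_eq_norm z.1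
  refine ⟨i, ?_⟩
  rw [Pi.add_apply, ← radial_eq, radial_of_le_one (by rwa [hn]) hz1.le, hn]
  have h3 : |‖z.1‖⁻¹ * z.1 i| = 1 := by
    rw [abs_mul, abs_inv, abs_norm, hi, inv_mul_cancel₀ h0.ne']
  rcases eq_or_eq_neg_of_abs_eq h3 with h4 | h4 <;> simp [h4]

/-- The map is the radial projection with the corrections of all generations on `ℝᵐ × ℝ`, composed
with `(y, z) ↦ (y, ‖z‖)`. Nontriviality of `Z` makes `z = 0` a null set and the law of `‖z‖`
absolutely continuous. -/
theorem exists_skeletonMap_of_nontrivial [Nontrivial Z] (ζ : Measure Z) [ζ.IsAddHaarMeasure]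
    {r : ℝ} (hr : 1 ≤ r) (hrm : r < m) :
    ∃ (φ : (Fin m → ℝ) × Z → Fin m → ℝ) (Φ : (Fin m → ℝ) × Z → (Fin m → ℝ) × Z →L[ℝ] Fin m → ℝ),
      W1Zero ((volume : Measure (Fin m → ℝ)).prod ζ) Set.univ (ENNReal.ofReal r) φ Φ ∧
      (∀ x, 1 < ‖x‖ → φ x = 0) ∧ (∀ x, 1 < ‖x‖ → Φ x = 0) ∧
      ∀ᵐ x ∂((volume : Measure (Fin m → ℝ)).prod ζ), ‖x‖ < 1 →
        ¬ Function.Surjective (ContinuousLinearMap.fst ℝ (Fin m → ℝ) Z + Φ x) := by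
  have hrY : r < Module.finrank ℝ (Fin m → ℝ) := by simpa using hrm
  have hr1 : 1 ≤ ENNReal.ofReal r := by simpa using hr
  have hd := (w1Zero_radialGap (volume : Measure (Fin m → ℝ)) (volume : Measure ℝ) hr hrY).1
  have hE := w1Zero_refine hr1 ENNReal.ofReal_ne_top (w1Zero_correction hr hrm)
    correction_eq_zero_of_notMem correctionGrad_eq_zero_of_notMem
  rw [Measure.volume_eq_prod] at hE
  have hφ : ∀ x : (Fin m → ℝ) × ℝ, 1 < ‖x‖ →
      (radialGap + refine correction : (Fin m → ℝ) × ℝ → Fin m → ℝ) x = 0 :=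
    fun x hx => by
      rw [Pi.add_apply, radialGap_of_one_le hx.le,
        refine_eq_zero correction_eq_zero_of_notMem (notMem_unitCell hx), add_zero]
  have hΦ : ∀ x : (Fin m → ℝ) × ℝ, 1 < ‖x‖ →
      (fderiv ℝ radialGap + refineGrad correctionGrad :
        (Fin m → ℝ) × ℝ → (Fin m → ℝ) × ℝ →L[ℝ] Fin m → ℝ) x = 0 := fun x hx => by
    rw [Pi.add_apply, fderiv_radialGap_eq_zero hx,
      refineGrad_eq_zero correctionGrad_eq_zero_of_notMem (notMem_unitCell hx), add_zero]
  have hW := (hd.add hr1 hE).comp_norm ζ hr1 ENNReal.ofReal_ne_top hφ hΦ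
  let Q : (Fin m → ℝ) × Z → (Fin m → ℝ) × ℝ := fun x => (x.1, ‖x.2‖)
  have hQn : ∀ x, ‖Q x‖ = ‖x‖ := fun x => by simp [Q, Prod.norm_def]
  refine ⟨_, _, hW, fun x hx => hφ _ (by rwa [← hQn] at hx), fun x hx => ?_, ?_⟩
  · rw [hΦ _ (by rwa [← hQn] at hx), ContinuousLinearMap.zero_comp]
  have hQL : LipschitzWith 1 Q := by
    have := LipschitzWith.prodMk (LipschitzWith.prod_fst (α := Fin m → ℝ) (β := Z))
      (lipschitzWith_one_norm.comp (LipschitzWith.prod_snd (α := Fin m → ℝ) (β := Z)))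
    simpa using this
  have hQd : ∀ᵐ x ∂((volume : Measure (Fin m → ℝ)).prod ζ), DifferentiableAt ℝ Q x :=
    hQL.ae_differentiableAt
  obtain ⟨C, -, hmap⟩ := exists_map_prod_norm_le (volume : Measure (Fin m → ℝ)) ζ
  have hqm : Measure.QuasiMeasurePreserving Q
      (((volume : Measure (Fin m → ℝ)).prod ζ).restrict (Set.univ ×ˢ Metric.ball 0 2)) volume :=
    ⟨hQL.continuous.measurable, (Measure.absolutelyContinuous_of_le hmap).trans
      Measure.smul_absolutelyContinuous⟩
  have hns := (ae_restrict_iff' (MeasurableSet.univ.prod measurableSet_ball)).1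
    (hqm.ae (ae_not_surjective_cellGrad hr hrm))
  have hz : ∀ᵐ x ∂((volume : Measure (Fin m → ℝ)).prod ζ), x.2 ≠ 0 := by
    have : ∀ᵐ z ∂ζ, z ≠ 0 := by simp [ae_iff]
    exact Measure.quasiMeasurePreserving_snd.ae this
  filter_upwards [hQd, hns, hz] with x hQx hx hx0 hx1 hsurj
  have h1 : (ContinuousLinearMap.fst ℝ (Fin m → ℝ) ℝ) ∘L fderiv ℝ Q x =
      ContinuousLinearMap.fst ℝ (Fin m → ℝ) Z := by
    have h2 : HasFDerivAt (fun x : (Fin m → ℝ) × Z => (Q x).1)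
        ((ContinuousLinearMap.fst ℝ (Fin m → ℝ) ℝ) ∘L fderiv ℝ Q x) x :=
      (ContinuousLinearMap.fst ℝ (Fin m → ℝ) ℝ).hasFDerivAt.comp x hQx.hasFDerivAt
    exact h2.unique hasFDerivAt_fst
  have hn := hx1
  rw [Prod.norm_def, max_lt_iff] at hn
  refine hx ⟨Set.mem_univ _, by simpa using hn.2.trans one_lt_two⟩
    ⟨hn.1, norm_pos_iff.2 hx0, hn.2⟩ ?_
  -- The gradient on `ℝᵐ × Z` is `cellGrad (Q x)` composed with the derivative of `Q`; if it were
  -- onto, so would be its outer factor.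
  refine Function.Surjective.of_comp (g := fderiv ℝ Q x) ?_
  have h3 : cellGrad (Q x) ∘L fderiv ℝ Q x = ContinuousLinearMap.fst ℝ (Fin m → ℝ) Z +
      (fderiv ℝ radialGap + refineGrad correctionGrad :
        (Fin m → ℝ) × ℝ → (Fin m → ℝ) × ℝ →L[ℝ] Fin m → ℝ) (x.1, ‖x.2‖) ∘L
        fderiv ℝ (fun x : (Fin m → ℝ) × Z => (x.1, ‖x.2‖)) x := by
    rw [cellGrad, add_assoc, ContinuousLinearMap.add_comp, h1]
    rfl
  rw [← ContinuousLinearMap.coe_comp, h3]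
  exact hsurj

/-- For `1 ≤ r < m` the projection `ℝᵐ × Z → ℝᵐ` can be modified in the unit ball by a map in
`W^{1,r}_0` so that its gradient has rank less than `m` there. -/
theorem exists_skeletonMap (ζ : Measure Z) [ζ.IsAddHaarMeasure] {r : ℝ} (hr : 1 ≤ r)
    (hrm : r < m) :
    ∃ (φ : (Fin m → ℝ) × Z → Fin m → ℝ) (Φ : (Fin m → ℝ) × Z → (Fin m → ℝ) × Z →L[ℝ] Fin m → ℝ),
      W1Zero ((volume : Measure (Fin m → ℝ)).prod ζ) Set.univ (ENNReal.ofReal r) φ Φ ∧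
      (∀ x, 1 < ‖x‖ → φ x = 0) ∧ (∀ x, 1 < ‖x‖ → Φ x = 0) ∧
      ∀ᵐ x ∂((volume : Measure (Fin m → ℝ)).prod ζ), ‖x‖ < 1 →
        ¬ Function.Surjective (ContinuousLinearMap.fst ℝ (Fin m → ℝ) Z + Φ x) := by
  rcases subsingleton_or_nontrivial Z with h | h
  · exact exists_skeletonMap_of_subsingleton ζ hr hrm
  · exact exists_skeletonMap_of_nontrivial ζ hr hrm

end SkeletonMap

end GrowthQC

/-! ### Matrices, adapted coordinates and the Sobolev spaces of the statement -/

namespace GrowthQC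

section Matrices

variable {n N : ℕ}

/-- The matrix of a linear map in the standard bases. -/
noncomputable def toMat (B : E n →L[ℝ] E N) : Mat N n :=
  Matrix.of fun i j => B (EuclideanSpace.single j 1) i

/-- The linear map with a given matrix in the standard bases. -/
noncomputable def ofMat (ξ : Mat N n) : E n →L[ℝ] E N :=
  LinearMap.toContinuousLinearMap (Matrix.toEuclideanLin ξ)

theorem toMat_ofMat (ξ : Mat N n) : toMat (ofMat ξ) = ξ := by
  ext i j
  simp [toMat, ofMat]

theorem toMat_apply (B : E n →L[ℝ] E N) (i : Fin N) (j : Fin n) :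
    toMat B i j = B (EuclideanSpace.single j 1) i := rfl

theorem toMat_add (B B' : E n →L[ℝ] E N) : toMat (B + B') = toMat B + toMat B' := rfl

theorem toMat_zero : toMat (0 : E n →L[ℝ] E N) = 0 := rfl

theorem continuous_toMat : Continuous (toMat : (E n →L[ℝ] E N) → Mat N n) :=
  continuous_matrix fun i j => by
    simp only [toMat_apply]
    fun_prop

theorem abs_toMat_le (B : E n →L[ℝ] E N) (i : Fin N) (j : Fin n) : |toMat B i j| ≤ ‖B‖ := by
  rw [toMat_apply, ← Real.norm_eq_abs]
  refine (PiLp.norm_apply_le _ i).trans ((B.le_opNorm _).trans ?_)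
  simp

theorem matNorm_le_of_abs_le {ξ : Mat N n} {c : ℝ} (hc : 0 ≤ c) (h : ∀ i j, |ξ i j| ≤ c) :
    matNorm ξ ≤ √(N * n) * c := by
  rw [matNorm]
  refine Real.sqrt_le_iff.2 ⟨by positivity, ?_⟩
  rw [mul_pow, Real.sq_sqrt (by positivity)]
  calc ∑ i, ∑ j, ξ i j ^ 2 ≤ ∑ _i : Fin N, ∑ _j : Fin n, c ^ 2 := by
        refine Finset.sum_le_sum fun i _ => Finset.sum_le_sum fun j _ => ?_
        exact sq_le_sq' (by linarith [neg_abs_le (ξ i j), h i j]) ((le_abs_self _).trans (h i j))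
    _ = _ := by simp; ring

theorem matNorm_toMat_le (B : E n →L[ℝ] E N) : matNorm (toMat B) ≤ √(N * n) * ‖B‖ :=
  matNorm_le_of_abs_le (norm_nonneg B) (abs_toMat_le B)

theorem norm_ofMat_le (ξ : Mat N n) : ‖ofMat ξ‖ ≤ matNorm ξ := by
  refine ContinuousLinearMap.opNorm_le_bound _ (Real.sqrt_nonneg _) fun x => ?_
  rw [matNorm, EuclideanSpace.norm_eq, EuclideanSpace.norm_eq, ← Real.sqrt_mul (by positivity)]
  refine Real.sqrt_le_sqrt ?_
  rw [Finset.sum_mul]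
  refine Finset.sum_le_sum fun i _ => ?_
  have h1 : ofMat ξ x i = ∑ j, ξ i j * x j := by
    simp [ofMat, Matrix.toLpLin_apply, Matrix.mulVec, dotProduct]
  simp only [h1, Real.norm_eq_abs, sq_abs]
  exact Finset.sum_mul_sq_le_sq_mul_sq _ _ _

theorem matNorm_nonneg (ξ : Mat N n) : 0 ≤ matNorm ξ := Real.sqrt_nonneg _

theorem rank_toMat (B : E n →L[ℝ] E N) :
    (toMat B).rank = Module.finrank ℝ (LinearMap.range (B : E n →ₗ[ℝ] E N)) := by
  rw [Matrix.rank_eq_finrank_range_toLin (toMat B) (EuclideanSpace.basisFun (Fin N) ℝ).toBasis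
    (EuclideanSpace.basisFun (Fin n) ℝ).toBasis]
  have h : Matrix.toLin (EuclideanSpace.basisFun (Fin n) ℝ).toBasis
      (EuclideanSpace.basisFun (Fin N) ℝ).toBasis (toMat B) = (B : E n →ₗ[ℝ] E N) := by
    refine (EuclideanSpace.basisFun (Fin n) ℝ).toBasis.ext fun j => ?_
    rw [Matrix.toLin_self]
    ext i
    simp [toMat_apply, Pi.single_apply]
  rw [h]

theorem rank_toMat_lt {m : ℕ} {X : Type*} [NormedAddCommGroup X] [NormedSpace ℝ X]
    (A : (Fin m → ℝ) →L[ℝ] E N) {S : X →L[ℝ] Fin m → ℝ} (hS : ¬ Function.Surjective S)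
    (T : E n →L[ℝ] X) : (toMat (A ∘L S ∘L T)).rank < m := by
  rw [rank_toMat]
  have h1 : LinearMap.range ((A ∘L S ∘L T : E n →L[ℝ] E N) : E n →ₗ[ℝ] E N) ≤
      (LinearMap.range (S : X →ₗ[ℝ] Fin m → ℝ)).map (A : (Fin m → ℝ) →ₗ[ℝ] E N) := by
    rintro _ ⟨x, rfl⟩
    exact ⟨S (T x), ⟨T x, rfl⟩, rfl⟩
  refine (Submodule.finrank_mono h1).trans_lt ((Submodule.finrank_map_le _ _).trans_lt ?_)
  have h2 : LinearMap.range (S : X →ₗ[ℝ] Fin m → ℝ) ≠ ⊤ :=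
    fun h => hS (LinearMap.range_eq_top.1 h)
  simpa using Submodule.finrank_lt h2

/-- Coordinates adapted to a linear map of rank `m`, with uniform bounds. -/
theorem exists_adapted_coordinates (n m : ℕ) : ∃ C : ℝ, 0 ≤ C ∧
    ∀ {F : Type} [NormedAddCommGroup F] [NormedSpace ℝ F] (B : E n →L[ℝ] F),
      Module.finrank ℝ (LinearMap.range (B : E n →ₗ[ℝ] F)) = m →
      ∃ (T : E n ≃L[ℝ] (Fin m → ℝ) × E (n - m)) (A : (Fin m → ℝ) →L[ℝ] F),
        B = A ∘L ContinuousLinearMap.fst ℝ (Fin m → ℝ) (E (n - m)) ∘L (T : E n →L[ℝ] _) ∧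
        ‖A‖ * ‖(T : E n →L[ℝ] (Fin m → ℝ) × E (n - m))‖ ≤ C * ‖B‖ := by
  -- Only this change from the Euclidean norm to the sup norm affects the constant; the remaining
  -- coordinate change is an isometry. Thus `C` depends on `n` and `m` alone.
  let P : WithLp 2 (E m × E (n - m)) ≃L[ℝ] (Fin m → ℝ) × E (n - m) :=
    (WithLp.prodContinuousLinearEquiv 2 ℝ (E m) (E (n - m))).trans
      ((EuclideanSpace.equiv (Fin m) ℝ).prodCongr (ContinuousLinearEquiv.refl ℝ (E (n - m))))
  let P1 : E m →L[ℝ] Fin m → ℝ := (EuclideanSpace.equiv (Fin m) ℝ : E m →L[ℝ] Fin m → ℝ)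
  let P2 : (Fin m → ℝ) →L[ℝ] E m := ((EuclideanSpace.equiv (Fin m) ℝ).symm : _ →L[ℝ] E m)
  let P0 : WithLp 2 (E m × E (n - m)) →L[ℝ] (Fin m → ℝ) × E (n - m) := P
  refine ⟨‖P2‖ * ‖P0‖, by positivity, ?_⟩
  intro F _ _ B hB
  let K : Submodule ℝ (E n) := LinearMap.ker (B : E n →ₗ[ℝ] F)
  have hK : Module.finrank ℝ K = n - m := by
    have := LinearMap.finrank_range_add_finrank_ker (B : E n →ₗ[ℝ] F)
    rw [hB, finrank_euclideanSpace_fin] at this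
    change m + Module.finrank ℝ K = n at this
    omega
  have hK' : Module.finrank ℝ Kᗮ = m := by
    have h1 := LinearMap.finrank_range_add_finrank_ker (B : E n →ₗ[ℝ] F)
    have h2 := K.finrank_add_finrank_orthogonal
    rw [hB] at h1
    change m + Module.finrank ℝ K = _ at h1
    omega
  let b : OrthonormalBasis (Fin m) ℝ Kᗮ := (stdOrthonormalBasis ℝ Kᗮ).reindex (finCongr hK')
  let c : OrthonormalBasis (Fin (n - m)) ℝ K := (stdOrthonormalBasis ℝ K).reindex (finCongr hK)
  have hmn : n = m + (n - m) := by
    have h2 := K.finrank_add_finrank_orthogonal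
    rw [hK, hK', finrank_euclideanSpace_fin] at h2
    omega
  have hb : ∀ v, ‖(b.repr.symm v : E n)‖ = ‖v‖ := fun v => b.repr.symm.norm_map v
  have hc : ∀ v, ‖(c.repr.symm v : E n)‖ = ‖v‖ := fun v => c.repr.symm.norm_map v
  -- Orthonormal coordinates on the orthogonal complement of the kernel and on the kernel; `B` sees
  -- only the former.
  let V : WithLp 2 (E m × E (n - m)) →ₗᵢ[ℝ] E n :=
    { toLinearMap :=
        { toFun := fun w => (b.repr.symm w.fst : E n) + (c.repr.symm w.snd : E n)
          map_add' := fun w w' => by simp; abel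
          map_smul' := fun a w => by simp }
      norm_map' := fun w => by
        change ‖(b.repr.symm w.fst : E n) + (c.repr.symm w.snd : E n)‖ = _
        have h1 : inner ℝ (b.repr.symm w.fst : E n) (c.repr.symm w.snd : E n) = 0 :=
          Submodule.inner_left_of_mem_orthogonal (c.repr.symm w.snd).2 (b.repr.symm w.fst).2
        have h2 := norm_add_sq_eq_norm_sq_add_norm_sq_of_inner_eq_zero _ _ h1
        rw [← pow_left_inj₀ (norm_nonneg _) (norm_nonneg _) two_ne_zero, pow_two, h2,
          WithLp.prod_norm_sq_eq_of_L2, ← pow_two, ← pow_two, hb, hc] }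
  have hdim : Module.finrank ℝ (WithLp 2 (E m × E (n - m))) = Module.finrank ℝ (E n) := by
    rw [(WithLp.linearEquiv 2 ℝ (E m × E (n - m))).finrank_eq, Module.finrank_prod,
      finrank_euclideanSpace_fin, finrank_euclideanSpace_fin, finrank_euclideanSpace_fin]
    omega
  let U : WithLp 2 (E m × E (n - m)) ≃ₗᵢ[ℝ] E n := V.toLinearIsometryEquiv hdim
  have hU : ∀ w, U w = (b.repr.symm w.fst : E n) + (c.repr.symm w.snd : E n) := fun w => rfl
  let T : E n ≃L[ℝ] (Fin m → ℝ) × E (n - m) := U.symm.toContinuousLinearEquiv.trans P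
  let A : (Fin m → ℝ) →L[ℝ] F := B ∘L Kᗮ.subtypeL ∘L
    (b.repr.symm.toContinuousLinearEquiv : E m →L[ℝ] Kᗮ) ∘L P2
  refine ⟨T, A, ?_, ?_⟩
  · refine ContinuousLinearMap.ext fun x => ?_
    obtain ⟨w, rfl⟩ := U.surjective x
    have h1 : (T (U w)).1 = P1 w.fst := by simp [T, P, P1]
    have h2 : B (c.repr.symm w.snd : E n) = 0 := (c.repr.symm w.snd).2
    change B (U w) = A (T (U w)).1
    rw [h1, hU, map_add, h2, add_zero]
    change _ = B (b.repr.symm (P2 (P1 w.fst)) : E n)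
    simp [P1, P2]
  · have h1 : ‖A‖ ≤ ‖B‖ * ‖P2‖ := by
      refine ContinuousLinearMap.opNorm_le_bound _ (by positivity) fun y => ?_
      change ‖B (b.repr.symm (P2 y) : E n)‖ ≤ _
      refine (B.le_opNorm _).trans ?_
      rw [hb, mul_assoc]
      gcongr
      exact P2.le_opNorm y
    have h2 : ‖(T : E n →L[ℝ] (Fin m → ℝ) × E (n - m))‖ ≤
        ‖P0‖ := by
      refine ContinuousLinearMap.opNorm_le_bound _ (by positivity) fun x => ?_
      change ‖P0 (U.symm x)‖ ≤ _
      refine (ContinuousLinearMap.le_opNorm _ _).trans ?_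
      rw [LinearIsometryEquiv.norm_map]
    calc _ ≤ (‖B‖ * ‖P2‖) * ‖P0‖ := by gcongr
      _ = _ := by ring

end Matrices

section Sobolev

variable {n N : ℕ}

theorem eLpNorm_restrict_le {G : Type*} [NormedAddCommGroup G] {Ω : Set (E n)} {p r : ℝ≥0∞}
    (hpr : p ≤ r) {g : E n → G} (hg : AEStronglyMeasurable g volume) :
    eLpNorm g p (volume.restrict Ω) ≤
      eLpNorm g r volume * volume Ω ^ (1 / p.toReal - 1 / r.toReal) := by
  refine (eLpNorm_le_eLpNorm_mul_rpow_measure_univ hpr hg.restrict).trans ?_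
  rw [Measure.restrict_apply_univ]
  gcongr
  exact Measure.restrict_le_self

/-- Hölder's inequality on a set of finite measure. It passes the identity defining weak derivatives
from smooth functions to their limits. -/
theorem tendsto_setIntegral_mul {Ω : Set (E n)} {p : ℝ≥0∞} (hp : 1 ≤ p) (hΩ : volume Ω ≠ ⊤)
    {g : E n → ℝ} (hg : MemLp g p (volume.restrict Ω)) {G : ℕ → E n → ℝ}
    (hG : ∀ k, MemLp (G k) p (volume.restrict Ω))
    (hlim : Tendsto (fun k => eLpNorm (fun x => G k x - g x) p (volume.restrict Ω)) atTop (𝓝 0))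
    {η : E n → ℝ} (hη : Continuous η) (hηc : HasCompactSupport η) :
    Tendsto (fun k => ∫ x in Ω, G k x * η x) atTop (𝓝 (∫ x in Ω, g x * η x)) := by
  have hfin : IsFiniteMeasure (volume.restrict Ω) := ⟨by simpa using hΩ.lt_top⟩
  obtain ⟨C, hC⟩ := hηc.exists_bound_of_continuous hη
  have hint : ∀ {v : E n → ℝ}, MemLp v p (volume.restrict Ω) →
      Integrable (fun x => v x * η x) (volume.restrict Ω) := fun hv =>
    (hv.integrable hp).mul_bdd (c := C) hη.aestronglyMeasurable (Eventually.of_forall hC)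
  refine tendsto_integral_of_L1' _ (hint hg).1 (Eventually.of_forall fun k => hint (hG k)) ?_
  set D : ℝ≥0∞ := ENNReal.ofReal C * volume Ω ^ (1 / (1 : ℝ≥0∞).toReal - 1 / p.toReal)
  have hD : D ≠ ⊤ := by
    refine ENNReal.mul_ne_top ENNReal.ofReal_ne_top (ENNReal.rpow_ne_top_of_nonneg ?_ hΩ)
    rw [sub_nonneg]
    rcases eq_or_ne p ⊤ with rfl | hp'
    · simp
    · simp only [ENNReal.toReal_one, div_one]
      have : 1 ≤ p.toReal := by
        rw [← ENNReal.toReal_one]; exact ENNReal.toReal_mono hp' hp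
      exact div_le_one_of_le₀ this (by positivity)
  have h1 : Tendsto (fun k => D * eLpNorm (fun x => G k x - g x) p (volume.restrict Ω)) atTop
      (𝓝 0) := by
    simpa using ENNReal.Tendsto.const_mul hlim (Or.inr hD)
  refine tendsto_of_tendsto_of_tendsto_of_le_of_le tendsto_const_nhds h1 (fun _ => zero_le)
    fun k => ?_
  have h2 : eLpNorm ((fun x => G k x * η x) - fun x => g x * η x) 1 (volume.restrict Ω) ≤
      ENNReal.ofReal C * eLpNorm (fun x => G k x - g x) 1 (volume.restrict Ω) := by
    refine eLpNorm_le_mul_eLpNorm_of_ae_le_mul (Eventually.of_forall fun x => ?_) 1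
    rw [Pi.sub_apply, ← sub_mul, norm_mul, mul_comm]
    gcongr
    exact hC x
  refine h2.trans ?_
  have h3 : eLpNorm (fun x => G k x - g x) 1 (volume.restrict Ω) ≤ _ :=
    eLpNorm_le_eLpNorm_mul_rpow_measure_univ hp ((hG k).1.sub hg.1)
  rw [Measure.restrict_apply_univ] at h3
  calc _ ≤ ENNReal.ofReal C * _ := mul_le_mul_right h3 _
    _ = _ := by simp only [D]; ring

theorem IsTestFunction.setIntegral_mul_partialDeriv {Ω : Set (E n)} {ψ u : E n → ℝ}
    (hψ : IsTestFunction Ω ψ) (hu : ContDiff ℝ ∞ u) (hu' : HasCompactSupport u) (j : Fin n) :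
    ∫ x in Ω, u x * partialDeriv j ψ x = - ∫ x in Ω, partialDeriv j u x * ψ x := by
  have h0 : ∀ x, x ∉ Ω → ψ x = 0 := fun x hx => by
    by_contra h
    exact hx (hψ.tsupport_subset (subset_tsupport ψ h))
  have h0' : ∀ x, x ∉ Ω → fderiv ℝ ψ x = 0 := fun x hx => by
    by_contra h
    exact hx (hψ.tsupport_subset (support_fderiv_subset ℝ h))
  rw [setIntegral_eq_integral_of_forall_compl_eq_zero fun x hx => by
      simp [partialDeriv, h0' x hx],
    setIntegral_eq_integral_of_forall_compl_eq_zero fun x hx => by simp [h0 x hx]]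
  have c1 : Continuous (fderiv ℝ u) := hu.continuous_fderiv (by simp)
  have c2 : Continuous (fderiv ℝ ψ) := hψ.contDiff.continuous_fderiv (by simp)
  have c3 := hu.continuous
  have c4 := hψ.contDiff.continuous
  refine integral_mul_fderiv_eq_neg_fderiv_mul_of_integrable ?_ ?_ ?_
    (fun x _ => hu.differentiable (by simp) x) fun x _ => hψ.contDiff.differentiable (by simp) x
  · exact Continuous.integrable_of_hasCompactSupport (by fun_prop)
      hψ.hasCompactSupport.mul_left
  · exact Continuous.integrable_of_hasCompactSupport (by fun_prop) hu'.mul_right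
  · exact Continuous.integrable_of_hasCompactSupport (by fun_prop) hu'.mul_right

theorem partialDeriv_coord {u : E n → E N} {x : E n} (hu : DifferentiableAt ℝ u x) (i : Fin N)
    (j : Fin n) : partialDeriv j (fun y => u y i) x = toMat (fderiv ℝ u x) i j := by
  have h : HasFDerivAt (fun y => u y i) ((EuclideanSpace.proj i : E N →L[ℝ] ℝ) ∘L fderiv ℝ u x) x :=
    (EuclideanSpace.proj i : E N →L[ℝ] ℝ).hasFDerivAt.comp x hu.hasFDerivAt
  rw [partialDeriv, h.fderiv]
  rfl

/-- The bridge from `W1Zero` to the definition in the statement. Finite measure of `Ω` allows the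
exponent to drop from `r` to `p`, and the weak gradient identity is inherited from the approximating
functions. -/
theorem W1Zero.memSobolevZero {Ω : Set (E n)} (hΩ : volume Ω ≠ ⊤) {p : ℝ} (hp : 1 ≤ p)
    {r : ℝ≥0∞} (hpr : ENNReal.ofReal p ≤ r) {φ : E n → E N} {Φ : E n → E n →L[ℝ] E N}
    (h : W1Zero volume Ω r φ Φ) : MemSobolevZero Ω p φ (fun x => toMat (Φ x)) := by
  have hp1 : 1 ≤ ENNReal.ofReal p := by simpa using hp
  have hfin : IsFiniteMeasure (volume.restrict Ω) := ⟨by simpa using hΩ.lt_top⟩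
  have hexp : 0 ≤ 1 / (ENNReal.ofReal p).toReal - 1 / r.toReal := by
    rw [sub_nonneg]
    rcases eq_or_ne r ⊤ with rfl | hr
    · simp
    · have : (ENNReal.ofReal p).toReal ≤ r.toReal := ENNReal.toReal_mono hr hpr
      refine one_div_le_one_div_of_le ?_ this
      rw [ENNReal.toReal_ofReal] <;> linarith
  have happ : ∀ k : ℕ, ((k : ℝ≥0∞) + 1)⁻¹ ≠ 0 := fun k => by simp
  choose u hu1 hu2 hu3 hu4 hu5 using fun k => h.approx _ (happ k)
  have hε : Tendsto (fun k : ℕ => ((k : ℝ≥0∞) + 1)⁻¹ *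
      volume Ω ^ (1 / (ENNReal.ofReal p).toReal - 1 / r.toReal)) atTop (𝓝 0) := by
    have h1 : Tendsto (fun k : ℕ => ((k : ℝ≥0∞) + 1)⁻¹) atTop (𝓝 0) := by
      have := (tendsto_add_atTop_iff_nat 1).2 ENNReal.tendsto_inv_nat_nhds_zero
      simpa using this
    simpa using ENNReal.Tendsto.mul_const h1
      (Or.inr (ENNReal.rpow_ne_top_of_nonneg hexp hΩ))
  have hdu : ∀ k x, DifferentiableAt ℝ (u k) x := fun k x => (hu1 k).differentiable (by simp) x
  have hA : ∀ i, Tendsto (fun k => eLpNorm (fun x => u k x i - φ x i) (ENNReal.ofReal p)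
      (volume.restrict Ω)) atTop (𝓝 0) := fun i => by
    refine tendsto_of_tendsto_of_tendsto_of_le_of_le tendsto_const_nhds hε (fun _ => zero_le)
      fun k => ?_
    refine (eLpNorm_mono (g := fun x => u k x - φ x)
      fun x => PiLp.norm_apply_le (u k x - φ x) i).trans ?_
    refine (eLpNorm_restrict_le hpr ((hu1 k).continuous.aestronglyMeasurable.sub h.aesm)).trans ?_
    gcongr
    exact hu4 k
  have hB : ∀ i j, Tendsto (fun k => eLpNorm (fun x => partialDeriv j (fun y => u k y i) x -
      toMat (Φ x) i j) (ENNReal.ofReal p) (volume.restrict Ω)) atTop (𝓝 0) := fun i j => by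
    refine tendsto_of_tendsto_of_tendsto_of_le_of_le tendsto_const_nhds hε (fun _ => zero_le)
      fun k => ?_
    refine (eLpNorm_mono (g := fun x => fderiv ℝ (u k) x - Φ x) fun x => ?_).trans ?_
    · rw [partialDeriv_coord (hdu k x)]
      exact abs_toMat_le (fderiv ℝ (u k) x - Φ x) i j
    refine (eLpNorm_restrict_le hpr ((aestronglyMeasurable_fderiv _ _).sub h.aesm_grad)).trans ?_
    gcongr
    exact hu5 k
  have hφ : ∀ i, MemLp (fun x => φ x i) (ENNReal.ofReal p) (volume.restrict Ω) := fun i => by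
    refine ((h.memLp.1.restrict Ω).mono_exponent hpr).mono ?_
      (Eventually.of_forall fun x => PiLp.norm_apply_le (φ x) i)
    exact (EuclideanSpace.proj i : E N →L[ℝ] ℝ).continuous.comp_aestronglyMeasurable h.aesm.restrict
  have hΦ : ∀ i j, MemLp (fun x => toMat (Φ x) i j) (ENNReal.ofReal p) (volume.restrict Ω) :=
    fun i j => by
      refine ((h.memLp.2.restrict Ω).mono_exponent hpr).mono ?_
        (Eventually.of_forall fun x => abs_toMat_le (Φ x) i j)
      exact (continuous_toMat.matrix_elem i j).comp_aestronglyMeasurable h.aesm_grad.restrict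
  have hcu : ∀ k i, HasCompactSupport fun y => u k y i := fun k i =>
    (hu2 k).comp_left (g := fun v : E N => v i) rfl
  have hsu : ∀ k i, ContDiff ℝ ∞ fun y => u k y i := fun k i =>
    (EuclideanSpace.proj i : E N →L[ℝ] ℝ).contDiff.comp (hu1 k)
  refine ⟨⟨hφ, hΦ, fun i j ψ hψ => ?_⟩, u, fun k => ⟨hu1 k, hu2 k, hu3 k⟩, hA, hB⟩
  have h1 := tendsto_setIntegral_mul hp1 hΩ (hφ i) (G := fun k x => u k x i)
    (fun k => ((hsu k i).continuous.memLp_of_hasCompactSupport (hcu k i)).restrict Ω) (hA i)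
    (η := partialDeriv j ψ) ((hψ.contDiff.continuous_fderiv (by simp)).clm_apply continuous_const)
    (hψ.hasCompactSupport.fderiv_apply (𝕜 := ℝ) _)
  have h2 := tendsto_setIntegral_mul hp1 hΩ (hΦ i j)
    (G := fun k => partialDeriv j fun y => u k y i)
    (fun k => (Continuous.memLp_of_hasCompactSupport
      (((hsu k i).continuous_fderiv (by simp)).clm_apply continuous_const)
      ((hcu k i).fderiv_apply (𝕜 := ℝ) _)).restrict Ω) (hB i j)
    hψ.contDiff.continuous hψ.hasCompactSupport
  refine tendsto_nhds_unique h1 (h2.neg.congr fun k => ?_)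
  exact (hψ.setIntegral_mul_partialDeriv (hsu k i) (hcu k i) j).symm

theorem extIntegral_eq_of_integrable {Ω : Set (E n)} {g : E n → ℝ}
    (hg : Integrable g (volume.restrict Ω)) :
    extIntegral Ω g = ((∫ x in Ω, g x : ℝ) : EReal) := by
  rw [extIntegral, integral_eq_lintegral_pos_part_sub_lintegral_neg_part hg, EReal.coe_sub,
    EReal.coe_ennreal_toReal, EReal.coe_ennreal_toReal]
  · exact hg.neg.lintegral_lt_top.ne
  · exact hg.lintegral_lt_top.ne

end Sobolev

end GrowthQC

/-! ### Propagation of the growth bound from lower rank -/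

namespace GrowthQC

section Growth

variable {n N m : ℕ}

theorem aestronglyMeasurable_comp_toMat {f : Mat N n → ℝ} (hf : Continuous f)
    {Ω : Set (E n)} {Φ : E n → E n →L[ℝ] E N} (hΦ : AEStronglyMeasurable Φ volume) (ξ : Mat N n) :
    AEStronglyMeasurable (fun x => f (ξ + toMat (Φ x))) (volume.restrict Ω) :=
  ((hf.comp (continuous_const.add continuous_toMat)).comp_aestronglyMeasurable hΦ).restrict

theorem integrable_indicator_one_add_rpow {X G : Type*} [NormedAddCommGroup X] [NormedSpace ℝ X]
    [FiniteDimensional ℝ X] [MeasurableSpace X] [BorelSpace X] {μ : Measure X}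
    [μ.IsAddHaarMeasure] [NormedAddCommGroup G] {q : ℝ} (hq : 1 ≤ q) {r : ℝ≥0∞}
    (hqr : ENNReal.ofReal q ≤ r) {Φ : X → G} (hΦ : MemLp Φ r μ) :
    Integrable ((Metric.ball (0 : X) 1).indicator fun x => (1 + ‖Φ x‖) ^ q) μ := by
  rw [integrable_indicator_iff measurableSet_ball]
  have hfin : IsFiniteMeasure (μ.restrict (Metric.ball (0 : X) 1)) :=
    ⟨by simpa using measure_ball_lt_top⟩
  have h0 : MemLp (fun x => ‖Φ x‖) (ENNReal.ofReal q) (μ.restrict (Metric.ball (0 : X) 1)) :=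
    ((hΦ.restrict _).mono_exponent hqr).norm
  have h1 : MemLp (fun x => 1 + ‖Φ x‖) (ENNReal.ofReal q) (μ.restrict (Metric.ball (0 : X) 1)) :=
    MemLp.add (f := fun _ => (1 : ℝ)) (memLp_const 1) h0
  have h2 := h1.integrable_norm_rpow (by simp; linarith) ENNReal.ofReal_ne_top
  rw [ENNReal.toReal_ofReal (by linarith)] at h2
  refine (h2.congr (Eventually.of_forall fun x => ?_))
  simp only
  rw [Real.norm_of_nonneg (by positivity)]

/-- The growth bound at a matrix of rank `m` in adapted coordinates. -/
theorem le_of_skeletonMap {p q r : ℝ} (hp : 1 ≤ p) (hq : 1 ≤ q) (hpr : p ≤ r) (hqr : q ≤ r)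
    {f : Mat N n → ℝ} (hf : Continuous f) (hbdd : BddBelow (Set.range f)) {L : ℝ} (hL0 : 0 ≤ L)
    (hL : ∀ η : Mat N n, η.rank < m → f η ≤ L * (1 + matNorm η ^ q))
    {φ₀ : (Fin m → ℝ) × E (n - m) → Fin m → ℝ}
    {Φ₀ : (Fin m → ℝ) × E (n - m) → (Fin m → ℝ) × E (n - m) →L[ℝ] Fin m → ℝ}
    (h₀ : W1Zero volume Set.univ (ENNReal.ofReal r) φ₀ Φ₀)
    (hφ₀ : ∀ x, 1 < ‖x‖ → φ₀ x = 0) (hΦ₀ : ∀ x, 1 < ‖x‖ → Φ₀ x = 0)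
    (hns : ∀ᵐ x, ‖x‖ < 1 →
      ¬ Function.Surjective (ContinuousLinearMap.fst ℝ (Fin m → ℝ) (E (n - m)) + Φ₀ x))
    {ξ : Mat N n} (hqc : IsW1QuasiconvexAt p f ξ) {T : E n ≃L[ℝ] (Fin m → ℝ) × E (n - m)}
    {A : (Fin m → ℝ) →L[ℝ] E N}
    (hA : ofMat ξ = A ∘L ContinuousLinearMap.fst ℝ (Fin m → ℝ) (E (n - m)) ∘L (T : E n →L[ℝ] _)) :
    f ξ * volume.real (Metric.ball (0 : (Fin m → ℝ) × E (n - m)) 1) ≤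
      L * (volume.real (Metric.ball (0 : (Fin m → ℝ) × E (n - m)) 1) +
        (√(N * n) * (‖A‖ * ‖(T : E n →L[ℝ] (Fin m → ℝ) × E (n - m))‖)) ^ q *
          ∫ x in Metric.ball 0 1, (1 + ‖Φ₀ x‖) ^ q) := by
  have : (volume : Measure ((Fin m → ℝ) × E (n - m))).IsAddHaarMeasure := by
    rw [Measure.volume_eq_prod]; exact Measure.prod.instIsAddHaarMeasure _ _
  have hr1 : 1 ≤ ENNReal.ofReal r := by simpa using hp.trans hpr
  obtain ⟨Ω, ⟨x₀, hx₀⟩, hΩb, hΩo, -, hΩ⟩ := hqc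
  have hΩfin : volume Ω ≠ ⊤ := hΩb.measure_lt_top.ne
  have hfin : IsFiniteMeasure (volume.restrict Ω) := ⟨by simpa using hΩfin.lt_top⟩
  -- One small copy inside `Ω` is enough and no covering is needed: outside the copy the integrand
  -- equals `f ξ`, which cancels against the right-hand side of the quasiconvexity inequality.
  obtain ⟨δ, hδ, hball⟩ : ∃ δ > 0, Metric.closedBall (T x₀) δ ⊆ T '' Ω :=
    Metric.nhds_basis_closedBall.mem_iff.1
      ((T.toHomeomorph.isOpenMap Ω hΩo).mem_nhds ⟨x₀, hx₀, rfl⟩)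
  let D : ((Fin m → ℝ) × E (n - m)) ≃L[ℝ] ((Fin m → ℝ) × E (n - m)) :=
    ContinuousLinearEquiv.smulLeft (Units.mk0 δ⁻¹ (inv_ne_zero hδ.ne'))
  let S : E n ≃L[ℝ] (Fin m → ℝ) × E (n - m) := T.trans D
  let c : (Fin m → ℝ) × E (n - m) := -(δ⁻¹ • T x₀)
  let s : E n → (Fin m → ℝ) × E (n - m) := fun x => S x + c
  have hs : ∀ x, s x = δ⁻¹ • (T x - T x₀) := fun x => by
    change δ⁻¹ • T x + -(δ⁻¹ • T x₀) = _
    rw [smul_sub, sub_eq_add_neg]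
  have hsn : ∀ x, ‖s x‖ ≤ 1 → x ∈ Ω := fun x hx => by
    rw [hs, norm_smul, norm_inv, Real.norm_of_nonneg hδ.le, inv_mul_le_iff₀ hδ, mul_one] at hx
    obtain ⟨y, hy, hxy⟩ := hball (show T x ∈ Metric.closedBall (T x₀) δ by
      rwa [mem_closedBall_iff_norm])
    rwa [← T.injective hxy]
  have hsc : Continuous s := by fun_prop
  obtain ⟨C, hC0, hC, hmap⟩ := exists_map_affine_eq
    (volume : Measure ((Fin m → ℝ) × E (n - m))) (volume : Measure (E n)) S c
  change (volume : Measure (E n)).map s = _ at hmap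
  have hqm : Measure.QuasiMeasurePreserving s :=
    ⟨hsc.measurable, hmap ▸ Measure.smul_absolutelyContinuous⟩
  let K : Set (E n) := s ⁻¹' Metric.closedBall 0 1
  have hK : IsCompact K := by
    let H : E n ≃ₜ (Fin m → ℝ) × E (n - m) := S.toHomeomorph.trans (Homeomorph.addRight c)
    exact H.isCompact_preimage.2 (isCompact_closedBall 0 1)
  have hKΩ : K ⊆ Ω := fun x hx => hsn x (by simpa [K] using hx)
  have hsK : ∀ x ∉ K, 1 < ‖s x‖ := fun x hx => by simpa [K] using hx
  -- The amplitude `δ` compensates the dilation `δ⁻¹` inside `S`, so the gradient does not depend on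
  -- the size of the copy.
  let Φ : E n → E n →L[ℝ] E N := fun x => ((δ • A) ∘L Φ₀ (s x)) ∘L (S : E n →L[ℝ] _)
  have hW := ((h₀.comp_affine volume S c (δ • A)).of_univ hr1 hK hΩo hKΩ
    (fun x hx => by rw [hφ₀ _ (hsK x hx), map_zero])
    (fun x hx => by
      rw [hΦ₀ _ (hsK x hx), ContinuousLinearMap.comp_zero, ContinuousLinearMap.zero_comp])
    ).memSobolevZero hΩfin hp (ENNReal.ofReal_le_ofReal hpr)
  have hΦeq : ∀ x, Φ x = A ∘L Φ₀ (s x) ∘L (T : E n →L[ℝ] _) := fun x => by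
    refine ContinuousLinearMap.ext fun v => ?_
    change δ • A (Φ₀ (s x) (δ⁻¹ • T v)) = A (Φ₀ (s x) (T v))
    rw [map_smul, map_smul, smul_smul, mul_inv_cancel₀ hδ.ne', one_smul]
  have hmain := hΩ _ _ hW
  set a := √(N * n) * (‖A‖ * ‖(T : E n →L[ℝ] (Fin m → ℝ) × E (n - m))‖) with ha
  -- A majorant of `f (ξ + ∇φ) - f ξ` in the coordinates of the unit ball. Its integral must be
  -- nonnegative by quasiconvexity, and that is the asserted inequality.
  let h : (Fin m → ℝ) × E (n - m) → ℝ := (Metric.ball 0 1).indicator fun y =>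
    (L - f ξ) + L * a ^ q * (1 + ‖Φ₀ y‖) ^ q
  have hJ := integrable_indicator_one_add_rpow hq (ENNReal.ofReal_le_ofReal hqr) h₀.memLp.2
  rw [integrable_indicator_iff measurableSet_ball] at hJ
  have hc1 : IntegrableOn (fun _ => L - f ξ) (Metric.ball (0 : (Fin m → ℝ) × E (n - m)) 1) :=
    integrableOn_const measure_ball_lt_top.ne
  have hh : Integrable h := by
    rw [integrable_indicator_iff measurableSet_ball]
    exact hc1.add (hJ.const_mul _)
  have hhs : Integrable (fun x => h (s x)) := by
    have h1 : Integrable h ((volume : Measure (E n)).map s) := by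
      rw [hmap]
      exact hh.smul_measure hC
    exact h1.comp_measurable hsc.measurable
  have hle : ∀ᵐ x, f (ξ + toMat (Φ x)) - f ξ ≤ h (s x) := by
    -- On the unit sphere neither the loss of rank nor the vanishing of `Φ₀` is known; it is a null
    -- set.
    have h1 : ∀ᵐ y : (Fin m → ℝ) × E (n - m), ‖y‖ < 1 ∨ 1 < ‖y‖ := by
      have h2 : ∀ᵐ y : (Fin m → ℝ) × E (n - m), y ∉ Metric.sphere 0 1 := by
        rw [ae_iff]
        simpa only [not_not, Set.ofPred_mem_eq] using
          Measure.addHaar_sphere_of_ne_zero volume 0 (one_ne_zero (α := ℝ))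
      filter_upwards [h2] with y hy
      exact lt_or_gt_of_ne (by simpa using hy)
    filter_upwards [hqm.ae h1, hqm.ae hns] with x hx1 hx2
    rcases hx1 with hx | hx
    · have h3 : ξ + toMat (Φ x) = toMat (A ∘L
          (ContinuousLinearMap.fst ℝ (Fin m → ℝ) (E (n - m)) + Φ₀ (s x)) ∘L (T : E n →L[ℝ] _)) := by
        rw [ContinuousLinearMap.add_comp, ContinuousLinearMap.comp_add, toMat_add, ← hA,
          toMat_ofMat, hΦeq]
      have h4 : matNorm (ξ + toMat (Φ x)) ≤ a * (1 + ‖Φ₀ (s x)‖) := by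
        rw [h3]
        refine (matNorm_toMat_le _).trans ?_
        rw [ha, mul_assoc, mul_assoc]
        gcongr
        refine (ContinuousLinearMap.opNorm_comp_le _ _).trans ?_
        gcongr
        refine (ContinuousLinearMap.opNorm_comp_le _ _).trans ?_
        rw [mul_comm]
        gcongr
        refine (norm_add_le _ _).trans ?_
        gcongr
        exact ContinuousLinearMap.norm_fst_le ..
      have h5 := hL (ξ + toMat (Φ x)) (by rw [h3]; exact rank_toMat_lt A (hx2 hx) _)
      have h6 : matNorm (ξ + toMat (Φ x)) ^ q ≤ a ^ q * (1 + ‖Φ₀ (s x)‖) ^ q := by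
        rw [← Real.mul_rpow (by positivity) (by positivity)]
        exact Real.rpow_le_rpow (matNorm_nonneg _) h4 (by linarith)
      have h7 : h (s x) = (L - f ξ) + L * a ^ q * (1 + ‖Φ₀ (s x)‖) ^ q :=
        Set.indicator_of_mem (by simpa using hx) _
      rw [h7]
      nlinarith [mul_le_mul_of_nonneg_left h6 hL0]
    · have h3 : h (s x) = 0 := Set.indicator_of_notMem (by simpa using hx.le) _
      rw [h3, hΦeq, hΦ₀ _ hx, ContinuousLinearMap.zero_comp, ContinuousLinearMap.comp_zero,
        toMat_zero, add_zero, sub_self]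
  obtain ⟨b, hb⟩ := hbdd
  have hg : Integrable (fun x => f (ξ + toMat (Φ x))) (volume.restrict Ω) := by
    refine Integrable.mono' (g := fun x => |b| + (|f ξ| + ‖h (s x)‖))
      ((integrable_const _).add ((integrable_const _).add hhs.restrict.norm))
      (aestronglyMeasurable_comp_toMat hf ?_ ξ) ?_
    · exact ((h₀.comp_affine volume S c (δ • A)).aesm_grad)
    · filter_upwards [ae_restrict_of_ae hle] with x hx
      have h1 : b ≤ f (ξ + toMat (Φ x)) := hb ⟨_, rfl⟩
      have h2 := le_abs_self (f ξ)
      have h3 := le_abs_self (h (s x))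
      have h4 := neg_abs_le b
      rw [Real.norm_eq_abs, Real.norm_eq_abs, abs_le]
      constructor
      · linarith [abs_nonneg (f ξ), abs_nonneg (h (s x))]
      · linarith [abs_nonneg b]
  rw [extIntegral_eq_of_integrable hg, EReal.coe_le_coe_iff] at hmain
  have h1 : 0 ≤ ∫ x in Ω, (f (ξ + toMat (Φ x)) - f ξ) := by
    rw [integral_sub hg (integrable_const _), setIntegral_const, smul_eq_mul]
    exact sub_nonneg.2 hmain
  have h2 : 0 ≤ ∫ x in Ω, h (s x) := h1.trans
    (integral_mono_ae (hg.sub (integrable_const _)) hhs.restrict (ae_restrict_of_ae hle))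
  have h3 : ∫ x in Ω, h (s x) = C.toReal * ∫ y, h y := by
    rw [setIntegral_eq_integral_of_forall_compl_eq_zero fun x hx =>
      Set.indicator_of_notMem (fun h' => hx (hsn x (by simpa using (mem_ball_zero_iff.1 h').le))) _]
    rw [← integral_map hsc.measurable.aemeasurable
      (by rw [hmap]; exact (hh.smul_measure hC).aestronglyMeasurable), hmap,
      integral_smul_measure, smul_eq_mul]
  have h4 : ∫ y, h y = (L - f ξ) * volume.real (Metric.ball (0 : (Fin m → ℝ) × E (n - m)) 1) +
      L * a ^ q * ∫ x in Metric.ball 0 1, (1 + ‖Φ₀ x‖) ^ q := by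
    rw [integral_indicator measurableSet_ball, integral_add hc1 (hJ.const_mul _),
      setIntegral_const, integral_const_mul, smul_eq_mul, mul_comm (volume.real _)]
  have h5 : 0 ≤ ∫ y, h y := by
    rw [h3] at h2
    exact nonneg_of_mul_nonneg_right h2 (ENNReal.toReal_pos hC0 hC)
  rw [h4] at h5
  linarith

/-- Growth of order `q` on matrices of rank less than `m` passes to matrices of rank `m`. -/
theorem exists_growth_of_rank_lt {p q : ℝ} (hp : 1 ≤ p) (hq : 1 ≤ q) (hpm : p < m) (hqm : q < m)
    {f : Mat N n → ℝ} (hf : Continuous f) (hbdd : BddBelow (Set.range f))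
    (hqc : ∀ ξ, IsW1QuasiconvexAt p f ξ) {L : ℝ} (hL0 : 0 ≤ L)
    (hL : ∀ η : Mat N n, η.rank < m → f η ≤ L * (1 + matNorm η ^ q)) :
    ∃ L', L ≤ L' ∧ ∀ ξ : Mat N n, ξ.rank = m → f ξ ≤ L' * (1 + matNorm ξ ^ q) := by
  -- The exponent `max p q` makes the map admissible for `W^{1,p}`-quasiconvexity and its gradient
  -- `q`-integrable, and is still below `m`.
  have hr : 1 ≤ max p q := le_max_of_le_left hp
  obtain ⟨φ₀, Φ₀, h₀, hφ₀, hΦ₀, hns⟩ := exists_skeletonMap (m := m)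
    (volume : Measure (E (n - m))) hr (max_lt hpm hqm)
  rw [← Measure.volume_eq_prod] at h₀ hns
  have : (volume : Measure ((Fin m → ℝ) × E (n - m))).IsAddHaarMeasure := by
    rw [Measure.volume_eq_prod]; exact Measure.prod.instIsAddHaarMeasure _ _
  obtain ⟨C, hC, hcoord⟩ := exists_adapted_coordinates n m
  set V := volume.real (Metric.ball (0 : (Fin m → ℝ) × E (n - m)) 1) with hV
  have hV0 : 0 < V := ENNReal.toReal_pos (Metric.measure_ball_pos _ _ one_pos).ne'
    measure_ball_lt_top.ne
  set J := ∫ x in Metric.ball 0 1, (1 + ‖Φ₀ x‖) ^ q with hJ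
  have hJ0 : 0 ≤ J := integral_nonneg fun x => by positivity
  set M := (√(N * n) * C) ^ q * J / V with hM
  have hM0 : 0 ≤ M := by positivity
  refine ⟨L * (1 + M), by nlinarith, fun ξ hξ => ?_⟩
  have hrank : Module.finrank ℝ (LinearMap.range (ofMat ξ : E n →ₗ[ℝ] E N)) = m := by
    rw [← rank_toMat, toMat_ofMat, hξ]
  obtain ⟨T, A, hA, hTA⟩ := hcoord (ofMat ξ) hrank
  have h1 := le_of_skeletonMap hp hq (le_max_left p q) (le_max_right p q) hf hbdd hL0 hL h₀ hφ₀
    hΦ₀ hns (hqc ξ) hA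
  have h2 : (√(N * n) * (‖A‖ * ‖(T : E n →L[ℝ] (Fin m → ℝ) × E (n - m))‖)) ^ q ≤
      (√(N * n) * C) ^ q * matNorm ξ ^ q := by
    rw [← Real.mul_rpow (by positivity) (matNorm_nonneg ξ), mul_assoc]
    refine Real.rpow_le_rpow (by positivity) ?_ (by linarith)
    exact mul_le_mul_of_nonneg_left
      (hTA.trans (mul_le_mul_of_nonneg_left (norm_ofMat_le ξ) hC)) (Real.sqrt_nonneg _)
  have hξ0 : 0 ≤ matNorm ξ ^ q := Real.rpow_nonneg (matNorm_nonneg ξ) q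
  have h3 : f ξ * V ≤ (L * (1 + M * matNorm ξ ^ q)) * V := by
    calc f ξ * V ≤ L * (V + (√(N * n) * C) ^ q * matNorm ξ ^ q * J) := h1.trans (by gcongr)
      _ = _ := by rw [hM]; field_simp
  have h4 := le_of_mul_le_mul_right h3 hV0
  refine h4.trans ?_
  rw [mul_assoc]
  gcongr
  nlinarith

/-- Induction on the rank starting at `k`: both exponents stay below each later rank, and the rank
of an `N × n` matrix never exceeds `n`. -/
theorem exists_growth {k : ℕ} {p q : ℝ} (hp : 1 ≤ p) (hq : 1 ≤ q) (hpk : p < k) (hqk : q < k)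
    {f : Mat N n → ℝ} (hf : Continuous f) (hbdd : BddBelow (Set.range f))
    (hqc : ∀ ξ, IsW1QuasiconvexAt p f ξ) {L : ℝ}
    (hL : ∀ ξ : Mat N n, ξ.rank ≤ k - 1 → f ξ ≤ L * (1 + matNorm ξ ^ q)) :
    ∃ L', L ≤ L' ∧ 0 ≤ L' ∧ ∀ ξ : Mat N n, f ξ ≤ L' * (1 + matNorm ξ ^ q) := by
  have hpos : ∀ ξ : Mat N n, 0 ≤ 1 + matNorm ξ ^ q := fun ξ => by
    have := Real.rpow_nonneg (matNorm_nonneg ξ) q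
    positivity
  have hk1 : (1 : ℝ) < k := hp.trans_lt hpk
  have hk : 1 < k := by exact_mod_cast hk1
  have hind : ∀ j : ℕ, ∃ L', L ≤ L' ∧ 0 ≤ L' ∧
      ∀ ξ : Mat N n, ξ.rank < k + j → f ξ ≤ L' * (1 + matNorm ξ ^ q) := by
    intro j
    induction j with
    | zero =>
      -- `L` may be negative, while the inductive step multiplies upper bounds by the constant and
      -- needs it nonnegative.
      refine ⟨max L 0, le_max_left _ _, le_max_right _ _, fun ξ hξ => ?_⟩
      exact (hL ξ (by omega)).trans (mul_le_mul_of_nonneg_right (le_max_left _ _) (hpos ξ))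
    | succ j ih =>
      obtain ⟨L₁, hLL₁, hL₁, h⟩ := ih
      have hkj : (k : ℝ) ≤ (k + j : ℕ) := by push_cast; linarith [(j.cast_nonneg : (0 : ℝ) ≤ j)]
      obtain ⟨L₂, hL₂, h'⟩ := exists_growth_of_rank_lt hp hq (hpk.trans_le hkj) (hqk.trans_le hkj)
        hf hbdd hqc hL₁ h
      refine ⟨L₂, hLL₁.trans hL₂, hL₁.trans hL₂, fun ξ hξ => ?_⟩
      rcases (show ξ.rank < k + j ∨ ξ.rank = k + j by omega) with h1 | h1
      · exact (h ξ h1).trans (mul_le_mul_of_nonneg_right hL₂ (hpos ξ))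
      · exact h' ξ h1
  obtain ⟨L', h1, h2, h3⟩ := hind n
  refine ⟨L', h1, h2, fun ξ => h3 ξ ?_⟩
  have := ξ.rank_le_width
  omega

end Growth

end GrowthQC

/-! ### From test functions to `W^{1,q}_0` -/

namespace GrowthQC

theorem W1Zero.of_contDiff {X F : Type*} [NormedAddCommGroup X] [NormedSpace ℝ X]
    [FiniteDimensional ℝ X] [MeasurableSpace X] [BorelSpace X] [NormedAddCommGroup F]
    [NormedSpace ℝ F] [FiniteDimensional ℝ F] {μ : Measure X} {Ω : Set X} {r : ℝ≥0∞} {u : X → F}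
    (hu : ContDiff ℝ ∞ u) (hc : HasCompactSupport u) (hs : tsupport u ⊆ Ω) :
    W1Zero μ Ω r u (fderiv ℝ u) :=
  ⟨hu.continuous.aestronglyMeasurable, aestronglyMeasurable_fderiv _ u,
    fun _ _ => ⟨u, hu, hc, hs, by simp,
      (eLpNorm_mono (g := fun _ => (0 : ℝ)) (by simp)).trans (by simp)⟩⟩

section Density

variable {n N : ℕ}

theorem IsTestFunction.memSobolevZero {Ω : Set (E n)} (hΩ : volume Ω ≠ ⊤) {p : ℝ} (hp : 1 ≤ p)
    {u : E n → E N} (hu : IsTestFunction Ω u) :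
    MemSobolevZero Ω p u (fun x => toMat (fderiv ℝ u x)) := by
  have h : W1Zero volume Ω (ENNReal.ofReal p) u (fderiv ℝ u) :=
    W1Zero.of_contDiff hu.contDiff hu.hasCompactSupport hu.tsupport_subset
  exact h.memSobolevZero hΩ hp le_rfl

theorem matNorm_le_sum (ξ : Mat N n) : matNorm ξ ≤ ∑ i, ∑ j, |ξ i j| := by
  rw [matNorm]
  refine Real.sqrt_le_iff.2 ⟨by positivity, ?_⟩
  have h1 : ∀ i, ∑ j, ξ i j ^ 2 ≤ (∑ j, |ξ i j|) ^ 2 := fun i => by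
    simpa only [sq_abs] using
      Finset.sum_sq_le_sq_sum_of_nonneg (s := Finset.univ) fun j _ => abs_nonneg (ξ i j)
  refine (Finset.sum_le_sum fun i _ => h1 i).trans ?_
  exact Finset.sum_sq_le_sq_sum_of_nonneg fun i _ => Finset.sum_nonneg fun j _ => abs_nonneg _

variable {Ω : Set (E n)} {q : ℝ} {f : Mat N n → ℝ}

theorem memLp_sum_abs {Φ : E n → Mat N n} {p : ℝ≥0∞} {μ : Measure (E n)}
    (hΦ : ∀ i j, MemLp (fun x => Φ x i j) p μ) :
    MemLp (fun x => ∑ i, ∑ j, |Φ x i j|) p μ :=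
  memLp_finsetSum _ fun i _ => memLp_finsetSum _ fun j _ => (hΦ i j).abs

theorem aestronglyMeasurable_comp_matrix (hf : Continuous f) {Φ : E n → Mat N n}
    {μ : Measure (E n)} (hΦ : ∀ i j, AEStronglyMeasurable (fun x => Φ x i j) μ) :
    AEStronglyMeasurable (fun x => f (Φ x)) μ := by
  let g : (Fin N → Fin n → ℝ) → ℝ := fun v => f (Matrix.of v)
  have hg : Continuous g := hf
  have h1 : AEMeasurable (fun x i j => Φ x i j) μ :=
    aemeasurable_pi_iff.2 fun i => aemeasurable_pi_iff.2 fun j => (hΦ i j).aemeasurable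
  exact (hg.measurable.comp_aemeasurable h1).aestronglyMeasurable

theorem integrable_rpow_of_memLp {α : Type*} [MeasurableSpace α] {μ : Measure α} (hq : 1 ≤ q)
    {g : α → ℝ} (hg : MemLp g (ENNReal.ofReal q) μ) : Integrable (fun x => |g x| ^ q) μ := by
  have h2 := hg.integrable_norm_rpow (by simp; linarith) ENNReal.ofReal_ne_top
  rwa [ENNReal.toReal_ofReal (by linarith)] at h2

theorem integrable_of_growth (hΩ : volume Ω ≠ ⊤) (hq : 1 ≤ q) (hf : Continuous f) {b L : ℝ}
    (hb : ∀ ξ, b ≤ f ξ) (hL0 : 0 ≤ L) (hL : ∀ ξ, f ξ ≤ L * (1 + matNorm ξ ^ q))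
    {Φ : E n → Mat N n}
    (hΦ : ∀ i j, MemLp (fun x => Φ x i j) (ENNReal.ofReal q) (volume.restrict Ω)) :
    Integrable (fun x => f (Φ x)) (volume.restrict Ω) := by
  have hfin : IsFiniteMeasure (volume.restrict Ω) := ⟨by simpa using hΩ.lt_top⟩
  have h1 := integrable_rpow_of_memLp hq (memLp_sum_abs hΦ)
  refine Integrable.mono' (((integrable_const 1).add h1).const_mul L |>.add (integrable_const |b|))
    (aestronglyMeasurable_comp_matrix hf fun i j => (hΦ i j).1) (Eventually.of_forall fun x => ?_)
  have h2 : matNorm (Φ x) ^ q ≤ |(∑ i, ∑ j, |Φ x i j| : ℝ)| ^ q :=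
    Real.rpow_le_rpow (matNorm_nonneg _) ((matNorm_le_sum _).trans (le_abs_self _)) (by linarith)
  have h3 : 0 ≤ matNorm (Φ x) ^ q := Real.rpow_nonneg (matNorm_nonneg _) q
  have h4 := hb (Φ x)
  have h5 := hL (Φ x)
  have h6 := mul_le_mul_of_nonneg_left h2 hL0
  have h7 := mul_nonneg hL0 h3
  rw [Real.norm_eq_abs, abs_le]
  simp only [Pi.add_apply]
  constructor
  · linarith [neg_abs_le b]
  · linarith [abs_nonneg b]

theorem rpow_add_le {a b q : ℝ} (ha : 0 ≤ a) (hb : 0 ≤ b) (hq : 1 ≤ q) :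
    (a + b) ^ q ≤ 2 ^ (q - 1) * (a ^ q + b ^ q) := by
  have h := NNReal.rpow_add_le_mul_rpow_add_rpow ⟨a, ha⟩ ⟨b, hb⟩ hq
  exact_mod_cast h

theorem tendsto_integral_rpow {α : Type*} [MeasurableSpace α] {μ : Measure α} (hq : 1 ≤ q)
    {g : ℕ → α → ℝ} (hg : ∀ k, MemLp (g k) (ENNReal.ofReal q) μ)
    (hlim : Tendsto (fun k => eLpNorm (g k) (ENNReal.ofReal q) μ) atTop (𝓝 0)) :
    Tendsto (fun k => ∫ x, |g k x| ^ q ∂μ) atTop (𝓝 0) := by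
  have hq0 : 0 < q := by linarith
  have h1 : ∀ k, ∫ x, |g k x| ^ q ∂μ = (eLpNorm (g k) (ENNReal.ofReal q) μ).toReal ^ q := by
    intro k
    have h3 : 0 ≤ ∫ x, |g k x| ^ q ∂μ := integral_nonneg fun x => by positivity
    have h2 := (hg k).eLpNorm_eq_integral_rpow_norm (by simpa using hq0) ENNReal.ofReal_ne_top
    rw [ENNReal.toReal_ofReal hq0.le] at h2
    simp only [Real.norm_eq_abs] at h2
    rw [h2, ENNReal.toReal_ofReal (Real.rpow_nonneg h3 _), Real.rpow_inv_rpow h3 hq0.ne']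
  simp only [h1]
  have h2 := (ENNReal.tendsto_toReal ENNReal.zero_ne_top).comp hlim
  have h3 := h2.rpow_const (p := q) (Or.inr hq0.le)
  simpa [Real.zero_rpow hq0.ne'] using h3

/-- Upper semicontinuity of the integral of an integrand of growth `q` along sequences that
converge in `L^q`. -/
theorem le_integral_of_tendsto (hΩ : volume Ω ≠ ⊤) (hq : 1 ≤ q) (hf : Continuous f) {b L : ℝ}
    (hb : ∀ ξ, b ≤ f ξ) (hL0 : 0 ≤ L) (hL : ∀ ξ, f ξ ≤ L * (1 + matNorm ξ ^ q))
    {Φ : E n → Mat N n} {Ψ : ℕ → E n → Mat N n}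
    (hΦ : ∀ i j, MemLp (fun x => Φ x i j) (ENNReal.ofReal q) (volume.restrict Ω))
    (hΨ : ∀ k i j, MemLp (fun x => Ψ k x i j) (ENNReal.ofReal q) (volume.restrict Ω))
    (hlim : ∀ i j, Tendsto (fun k => eLpNorm (fun x => Ψ k x i j - Φ x i j) (ENNReal.ofReal q)
      (volume.restrict Ω)) atTop (𝓝 0))
    {c : ℝ} (hc : ∀ k, c ≤ ∫ x in Ω, f (Ψ k x)) : c ≤ ∫ x in Ω, f (Φ x) := by
  have hfin : IsFiniteMeasure (volume.restrict Ω) := ⟨by simpa using hΩ.lt_top⟩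
  have hq1 : 1 ≤ ENNReal.ofReal q := by simpa using hq
  set μ := volume.restrict Ω with hμ
  let D : ℕ → E n → ℝ := fun k x => ∑ i, ∑ j, |Ψ k x i j - Φ x i j|
  let S : E n → ℝ := fun x => ∑ i, ∑ j, |Φ x i j|
  have hD0 : ∀ k x, 0 ≤ D k x := fun k x => by positivity
  have hS0 : ∀ x, 0 ≤ S x := fun x => by positivity
  have hdiff : ∀ k i j, MemLp (fun x => Ψ k x i j - Φ x i j) (ENNReal.ofReal q) μ :=
    fun k i j => (hΨ k i j).sub (hΦ i j)
  have hD : ∀ k, MemLp (D k) (ENNReal.ofReal q) μ := fun k =>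
    memLp_sum_abs (Φ := fun x => Ψ k x - Φ x) (hdiff k)
  have hDlim : Tendsto (fun k => eLpNorm (D k) (ENNReal.ofReal q) μ) atTop (𝓝 0) := by
    have h1 : Tendsto (fun k => ∑ i, ∑ j, eLpNorm (fun x => Ψ k x i j - Φ x i j)
        (ENNReal.ofReal q) μ) atTop (𝓝 0) := by
      have := tendsto_finsetSum Finset.univ fun i _ =>
        tendsto_finsetSum Finset.univ fun j _ => hlim i j
      simpa using this
    refine tendsto_of_tendsto_of_tendsto_of_le_of_le tendsto_const_nhds h1 (fun _ => zero_le)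
      fun k => ?_
    have h2 : D k = ∑ i, ∑ j, fun x => |Ψ k x i j - Φ x i j| := by
      ext x; simp [D, Finset.sum_apply]
    rw [h2]
    refine (eLpNorm_sum_le (fun i _ => Finset.aestronglyMeasurable_sum _ fun j _ =>
      (hdiff k i j).abs.1) hq1).trans (Finset.sum_le_sum fun i _ => ?_)
    refine (eLpNorm_sum_le (fun j _ => (hdiff k i j).abs.1) hq1).trans
      (Finset.sum_le_sum fun j _ => ?_)
    exact eLpNorm_mono fun x => by simp
  -- Convergence in `L^q` gives almost everywhere convergence only along a subsequence, which is
  -- enough because `hc` holds for every index.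
  obtain ⟨ns, hns, hae⟩ := (tendstoInMeasure_of_tendsto_eLpNorm (g := fun _ => (0 : ℝ))
    (zero_lt_one.trans_le hq1).ne' (fun k => (hD k).1) aestronglyMeasurable_const
    (by
      refine hDlim.congr fun k => ?_
      congr 1
      ext x
      simp)).exists_seq_tendsto_ae
  set C := L * 2 ^ (q - 1) with hC
  have hC0 : 0 ≤ C := by positivity
  have hSint : Integrable (fun x => |S x| ^ q) μ := integrable_rpow_of_memLp hq (memLp_sum_abs hΦ)
  have hDint : ∀ k, Integrable (fun x => |D k x| ^ q) μ := fun k =>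
    integrable_rpow_of_memLp hq (hD k)
  have hfΦ := integrable_of_growth hΩ hq hf hb hL0 hL hΦ
  have hfΨ := fun k => integrable_of_growth hΩ hq hf hb hL0 hL (hΨ k)
  -- The growth bound makes these functions nonnegative, so Fatou's lemma applies to them. The added
  -- term in `D k` has integral tending to `0` and disappears in the limit.
  let h : ℕ → E n → ℝ := fun k x => L + C * |S x| ^ q + C * |D k x| ^ q - f (Ψ k x)
  let h' : E n → ℝ := fun x => L + C * |S x| ^ q - f (Φ x)
  have hbound : ∀ (k : ℕ) x, f (Ψ k x) ≤ L + C * |S x| ^ q + C * |D k x| ^ q := fun k x => by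
    have h1 : matNorm (Ψ k x) ≤ S x + D k x := by
      refine (matNorm_le_sum _).trans ?_
      simp only [S, D, ← Finset.sum_add_distrib]
      refine Finset.sum_le_sum fun i _ => Finset.sum_le_sum fun j _ => ?_
      have := abs_add_le (Φ x i j) (Ψ k x i j - Φ x i j)
      rwa [add_sub_cancel] at this
    have h2 : matNorm (Ψ k x) ^ q ≤ 2 ^ (q - 1) * (S x ^ q + D k x ^ q) :=
      (Real.rpow_le_rpow (matNorm_nonneg _) h1 (by linarith)).trans
        (rpow_add_le (hS0 x) (hD0 k x) hq)
    rw [abs_of_nonneg (hS0 x), abs_of_nonneg (hD0 k x)]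
    calc f (Ψ k x) ≤ L * (1 + matNorm (Ψ k x) ^ q) := hL _
      _ ≤ L * (1 + 2 ^ (q - 1) * (S x ^ q + D k x ^ q)) := by gcongr
      _ = _ := by rw [hC]; ring
  have hlimae : ∀ᵐ x ∂μ, Tendsto (fun i => h (ns i) x) atTop (𝓝 (h' x)) := by
    filter_upwards [hae] with x hx
    have h1 : Tendsto (fun i => Ψ (ns i) x) atTop (𝓝 (Φ x)) := by
      refine tendsto_pi_nhds.2 fun i => tendsto_pi_nhds.2 fun j => ?_
      rw [tendsto_iff_norm_sub_tendsto_zero]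
      refine squeeze_zero (fun _ => norm_nonneg _) (fun k => ?_) hx
      refine le_trans ?_ (Finset.single_le_sum (f := fun i => ∑ j, |Ψ (ns k) x i j - Φ x i j|)
        (fun i _ => Finset.sum_nonneg fun j _ => abs_nonneg _) (Finset.mem_univ i))
      exact Finset.single_le_sum (f := fun j => |Ψ (ns k) x i j - Φ x i j|)
        (fun j _ => abs_nonneg _) (Finset.mem_univ j)
    have h2 : Tendsto (fun i => |D (ns i) x| ^ q) atTop (𝓝 0) := by
      have := hx.abs.rpow_const (p := q) (Or.inr (by linarith))
      simpa [Real.zero_rpow (show q ≠ 0 by linarith)] using this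
    have h3 := ((tendsto_const_nhds (x := L + C * |S x| ^ q)).add (h2.const_mul C)).sub
      ((hf.tendsto _).comp h1)
    simpa [h, h'] using h3
  have hint : ∀ k, Integrable (h k) μ := fun k =>
    (((integrable_const L).add (hSint.const_mul C)).add ((hDint k).const_mul C)).sub (hfΨ k)
  have hint' : Integrable h' μ := ((integrable_const L).add (hSint.const_mul C)).sub hfΦ
  have hnn : ∀ k x, 0 ≤ h k x := fun k x => sub_nonneg.2 (hbound k x)
  have hnn' : 0 ≤ᵐ[μ] h' := by
    filter_upwards [hlimae] with x hx
    exact ge_of_tendsto' hx fun i => hnn _ x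
  set H := ∫ x, (L + C * |S x| ^ q) ∂μ with hH
  have hH' : ∫ x, h' x ∂μ = H - ∫ x, f (Φ x) ∂μ :=
    integral_sub ((integrable_const L).add (hSint.const_mul C)) hfΦ
  have hHk : ∀ k, ∫ x, h k x ∂μ = H + C * ∫ x, |D k x| ^ q ∂μ - ∫ x, f (Ψ k x) ∂μ := fun k => by
    have e1 : ∫ x, h k x ∂μ = ∫ x, (L + C * |S x| ^ q + C * |D k x| ^ q) ∂μ -
        ∫ x, f (Ψ k x) ∂μ :=
      integral_sub (((integrable_const L).add (hSint.const_mul C)).add ((hDint k).const_mul C))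
        (hfΨ k)
    have e2 : ∫ x, (L + C * |S x| ^ q + C * |D k x| ^ q) ∂μ = H + ∫ x, C * |D k x| ^ q ∂μ :=
      integral_add ((integrable_const L).add (hSint.const_mul C)) ((hDint k).const_mul C)
    rw [e1, e2, integral_const_mul]
  have hDz := (tendsto_integral_rpow hq hD hDlim).comp hns.tendsto_atTop
  have hub : Tendsto (fun i => H + C * ∫ x, |D (ns i) x| ^ q ∂μ - c) atTop (𝓝 (H - c)) := by
    simpa using ((tendsto_const_nhds (x := H)).add (hDz.const_mul C)).sub_const c
  have hle : ∀ i, ∫ x, h (ns i) x ∂μ ≤ H + C * ∫ x, |D (ns i) x| ^ q ∂μ - c := fun i => by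
    rw [hHk]
    linarith [hc (ns i)]
  have hHc : 0 ≤ H - c := ge_of_tendsto' hub fun i => (integral_nonneg (hnn _)).trans (hle i)
  have hfatou : ENNReal.ofReal (H - ∫ x, f (Φ x) ∂μ) ≤ ENNReal.ofReal (H - c) := by
    calc ENNReal.ofReal (H - ∫ x, f (Φ x) ∂μ) = ∫⁻ x, ENNReal.ofReal (h' x) ∂μ := by
          rw [← hH', ofReal_integral_eq_lintegral_ofReal hint' hnn']
      _ = ∫⁻ x, liminf (fun i => ENNReal.ofReal (h (ns i) x)) atTop ∂μ := by
          refine lintegral_congr_ae ?_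
          filter_upwards [hlimae] with x hx
          exact (ENNReal.tendsto_ofReal hx).liminf_eq.symm
      _ ≤ liminf (fun i => ∫⁻ x, ENNReal.ofReal (h (ns i) x) ∂μ) atTop :=
          lintegral_liminf_le' fun i => (hint _).aestronglyMeasurable.aemeasurable.ennreal_ofReal
      _ ≤ liminf (fun i => ENNReal.ofReal (H + C * ∫ x, |D (ns i) x| ^ q ∂μ - c)) atTop := by
          refine liminf_le_liminf (Eventually.of_forall fun i => ?_)
          rw [← ofReal_integral_eq_lintegral_ofReal (hint _) (Eventually.of_forall (hnn _))]
          exact ENNReal.ofReal_le_ofReal (hle i)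
      _ = ENNReal.ofReal (H - c) := (ENNReal.tendsto_ofReal hub).liminf_eq
  have := (ENNReal.ofReal_le_ofReal_iff hHc).1 hfatou
  linarith

/-- The same `Ω` serves for both exponents. Test functions belong to `W^{1,p}_0` and satisfy the
inequality by hypothesis; they are dense in `W^{1,q}_0`, and growth `q` lets the inequality pass to
the limit. -/
theorem isW1QuasiconvexAt_of_growth {p : ℝ} (hp : 1 ≤ p) (hq : 1 ≤ q) (hf : Continuous f)
    (hbdd : BddBelow (Set.range f)) {L : ℝ} (hL0 : 0 ≤ L)
    (hL : ∀ ξ, f ξ ≤ L * (1 + matNorm ξ ^ q)) {ξ : Mat N n} (hqc : IsW1QuasiconvexAt p f ξ) :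
    IsW1QuasiconvexAt q f ξ := by
  obtain ⟨b, hb⟩ := hbdd
  have hb' : ∀ η, b ≤ f η := fun η => hb ⟨η, rfl⟩
  obtain ⟨Ω, hΩ0, hΩb, hΩo, hΩf, hΩ⟩ := hqc
  refine ⟨Ω, hΩ0, hΩb, hΩo, hΩf, fun φ Φ hφ => ?_⟩
  have hΩfin : volume Ω ≠ ⊤ := hΩb.measure_lt_top.ne
  have hfin : IsFiniteMeasure (volume.restrict Ω) := ⟨by simpa using hΩfin.lt_top⟩
  obtain ⟨u, hu, -, hu'⟩ := hφ.approx
  have hshift : ∀ {Ψ : E n → Mat N n},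
      (∀ i j, MemLp (fun x => Ψ x i j) (ENNReal.ofReal q) (volume.restrict Ω)) →
      ∀ i j, MemLp (fun x => (ξ + Ψ x) i j) (ENNReal.ofReal q) (volume.restrict Ω) :=
    fun hΨ i j => MemLp.add (f := fun _ => ξ i j) (memLp_const _) (hΨ i j)
  have hΨ := fun k => hshift ((hu k).memSobolevZero hΩfin hq).memLp_grad
  have hΦ := hshift hφ.memLp_grad
  rw [extIntegral_eq_of_integrable (integrable_of_growth hΩfin hq hf hb' hL0 hL hΦ),
    EReal.coe_le_coe_iff]
  refine le_integral_of_tendsto hΩfin hq hf hb' hL0 hL hΦ hΨ (fun i j => ?_) fun k => ?_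
  · refine (hu' i j).congr fun k => ?_
    congr 1
    ext x
    rw [partialDeriv_coord ((hu k).contDiff.differentiable (by simp) x)]
    simp
  · have h1 := hΩ _ _ ((hu k).memSobolevZero hΩfin hp)
    rwa [extIntegral_eq_of_integrable (integrable_of_growth hΩfin hq hf hb' hL0 hL (hΨ k)),
      EReal.coe_le_coe_iff] at h1

end Density

end GrowthQC

theorem theorem2 (n N k : ℕ) (hk : 2 ≤ k) (hkn : k ≤ min n N)
    (p q : ℝ) (hp : 1 ≤ p) (hpk : p < k) (hq : 1 ≤ q) (hqk : q < k)
    (f : GrowthQC.Mat N n → ℝ) (hcont : Continuous f) (hbdd : BddBelow (Set.range f))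
    (hqc : GrowthQC.IsW1Quasiconvex p f)
    (L : ℝ)
    (hL : ∀ ξ : GrowthQC.Mat N n, ξ.rank ≤ k - 1 → f ξ ≤ L * (1 + GrowthQC.matNorm ξ ^ q)) :
    (∃ L' : ℝ, L ≤ L' ∧ ∀ ξ : GrowthQC.Mat N n, f ξ ≤ L' * (1 + GrowthQC.matNorm ξ ^ q)) ∧
      GrowthQC.IsW1Quasiconvex q f := by
  obtain ⟨L', hLL', hL'0, hL'⟩ :=
    GrowthQC.exists_growth hp hq hpk hqk hcont hbdd hqc.quasiconvexAt hL
  exact ⟨⟨L', hLL', hL'⟩, hqc.measurable, hqc.bddBelow, fun ξ =>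
    GrowthQC.isW1QuasiconvexAt_of_growth hp hq hcont hbdd hL'0 hL' (hqc.quasiconvexAt ξ)⟩
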